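/- Let $\mathbb{K}$ be an algebraically closed field of characteristic $p>0$, $G$ a connected reductive algebraic group over $\mathbb{K}$, $T\subseteq B$ a maximal torus and a Borel subgroup of $G$, $X=X(T)$ the character group, $\mathfrak{g},\mathfrak{h},\mathfrak{b}$ the Lie algebras of $G,T,B$, $R\subset X$ the set of roots, $R^+$ and $\Pi$ the positive and simple roots given by $B$. Fix a basis $\{e_\alpha, h_i \mid \alpha\in R,\ 1\le i\le d\}$ of $\mathfrak{g}$ with $e_\alpha\in\mathfrak{g}_\alpha$, $h_1,\dots,h_d$ a basis of $\mathfrak{h}$ and $h_i^{[p]}=h_i$. Let $\chi\in\mathfrak{g}^*$ be in standard Levi form with associated subset $I\subseteq\Pi$: $\chi(\mathfrak{b})=0$ and, for $\alpha\in R^+$, $\chi(e_{-\alpha})=1$ if $\alpha\in I$ and $\chi(e_{-\alpha})=0$ otherwise. Put $$U_\chi=U(\mathfrak{g})/\langle e_\alpha^p-\chi(e_\alpha)^p\mid\alpha\in R\rangle,\qquad U^0=U(\mathfrak{h}),$$ and let $U^0U^+\subseteq U_\chi$ be the subalgebra generated by $\mathfrak{h}$ and the $e_\alpha$ with $\alpha\in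 R^+$. Grade $U_\chi$ by $X/\mathbb{Z}I$ with $e_\alpha$ in degree $\alpha+\mathbb{Z}I$ and $\mathfrak{h}$ in degree $0$, and let $(U_\chi)_{\xi}^{w}$, for $w\in\mathfrak{h}^*$, be the subspace of $(U_\chi)_\xi$ on which $\mathfrak{h}$ acts by commutators with weight $w$. For $\mu\in X$ let $d\mu\in\mathfrak{h}^*$ be its differential and $\widetilde\mu$ the automorphism of $U^0$ with $\widetilde\mu(h)=h+d\mu(h)$ for $h\in\mathfrak{h}$. Let $A$ be a commutative Noetherian $U^0$-algebra with structure map $\pi:U^0\to A$. The category $\mathcal{C}_A$ has as objects the $U_\chi\otimes_{\mathbb{K}} A$-modules $M$ (written as left $U_\chi$- and right $A$-modules) with a decomposition $M=\bigoplus_{\xi\in X/\mathbb{Z}I}M_\xi$ such that: (A) $M_\xi A\subseteq M_\xi$; (B) only finitely many $M_\xi$ are nonzero, and each is finitely generated over $A$; (C) $(U_\chi)_\sigma M_\xi\subseteq M_{\sigma+\xi}$; (D) each $M_{\lambda+\mathbb{Z}I}$ has a decomposition $M_{\lambda+\mathbb{Z}I}=\bigoplus M_{\lambda+\mathbb{Z}I}^{d\mu}$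 over the $d\mu\in\mathfrak{h}^*$ with $\mu\in\lambda+\mathbb{Z}I+pX$, such that, for $m\in M_{\lambda+\mathbb{Z}I}^{d\mu}$, $sm=m\,\pi(\widetilde\mu(s))$ for $s\in U^0$, $e_\alpha m\in M_{\lambda+\alpha+\mathbb{Z}I}^{d(\mu+\alpha)}$ for $\alpha\in R$, and $ma\in M_{\lambda+\mathbb{Z}I}^{d\mu}$ for $a\in A$. Morphisms are the $U_\chi\otimes A$-homomorphisms that send $M_{\lambda+\mathbb{Z}I}^{d\mu}$ to $N_{\lambda+\mathbb{Z}I}^{d\mu}$. For $\lambda\in X$ let $A^\lambda$ be $A$ with $e_\alpha$ ($\alpha\in R^+$) acting as $0$ and $s\in U^0$ acting as multiplication by $\pi(\widetilde\lambda(s))$, and let $Z_{A,\chi}(\lambda)=U_\chi\otimes_{U^0U^+}A^\lambda$ be the baby Verma module, in which $Z_{A,\chi}(\lambda)_{\xi}^{w}$ is the image of $(U_\chi)_{\xi-\lambda}^{w-d\lambda}\otimes A$. Then for every object $M$ of $\mathcal{C}_A$ there are a projective object $Q$ of $\mathcal{C}_A$ and a surjective morphism $Q\to M$ in $\mathcal{C}_A$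 such that $Q$ has a $Z$-filtration, i.e. a finite chain $0=Q_0\subseteq Q_1\subseteq\cdots\subseteq Q_r=Q$ of submodules in $\mathcal{C}_A$ with $Q_i/Q_{i-1}\cong Z_{A,\chi}(\lambda_i)$ in $\mathcal{C}_A$ for some $\lambda_1,\dots,\lambda_r\in X$. -/

import Mathlib

open scoped TensorProduct MatrixGroups

universe u v

noncomputable section

namespace GradedLevi

attribute [local instance 100] LieRing.ofAssociativeRing

/-! ### Linear algebraic groups over an algebraically closed field

A linear algebraic group is a Zariski closed subgroup of `GL n K`.  Regular functions on `GL n K`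
are the polynomials in the entries of `g` (variables `Sum.inl (i, j)`) and of `g⁻¹`
(variables `Sum.inr (i, j)`). -/

section AlgebraicGroups

variable {K : Type u} [Field K] {n : ℕ}

/-- Index set of the coordinate functions: entries of `g` and entries of `g⁻¹`. -/
abbrev CoordIdx (n : ℕ) : Type := (Fin n × Fin n) ⊕ (Fin n × Fin n)

/-- Polynomials representing the regular functions on `GL n K`. -/
abbrev Coord (n : ℕ) (K : Type u) [Field K] : Type u := MvPolynomial (CoordIdx n) K

/-- The value at `g` of the regular function represented by `f`. -/
def evalAt (f : Coord n K) (g : GL (Fin n) K) : K :=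
  MvPolynomial.eval
    (Sum.elim (fun ij => (g : Matrix (Fin n) (Fin n) K) ij.1 ij.2)
      (fun ij => ((g⁻¹ : GL (Fin n) K) : Matrix (Fin n) (Fin n) K) ij.1 ij.2)) f

/-- Zariski closed subsets of `GL n K`. -/
def IsZClosed (Z : Set (GL (Fin n) K)) : Prop :=
  ∃ S : Set (Coord n K), ∀ g : GL (Fin n) K, g ∈ Z ↔ ∀ f ∈ S, evalAt f g = 0

/-- Connectedness in the Zariski topology (of a subset that contains some point). -/
def IsZConnected (Z : Set (GL (Fin n) K)) : Prop :=
  Z.Nonempty ∧ ∀ Z₁ Z₂ : Set (GL (Fin n) K), IsZClosed Z₁ → IsZClosed Z₂ →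
    Z ⊆ Z₁ ∪ Z₂ → Z ∩ Z₁ ∩ Z₂ = ∅ → Z ⊆ Z₁ ∨ Z ⊆ Z₂

/-- The ideal of the regular functions that vanish on `H`. -/
def vanishingIdeal (H : Subgroup (GL (Fin n) K)) : Ideal (Coord n K) where
  carrier := {f | ∀ g ∈ H, evalAt f g = 0}
  add_mem' := by
    intro a b ha hb g hg
    have h1 := ha g hg
    have h2 := hb g hg
    simp only [evalAt] at h1 h2 ⊢
    rw [map_add, h1, h2, add_zero]
  zero_mem' := by intro g _; simp [evalAt]
  smul_mem' := by
    intro c f hf g hg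
    have h1 := hf g hg
    simp only [evalAt] at h1 ⊢
    rw [smul_eq_mul, map_mul, h1, mul_zero]

/-- The left invariant derivation of the ring of regular functions on `GL n K` attached to a
matrix `x`: it sends `f` to `g ↦ (d/dε) f (g (1 + ε x))` at `ε = 0`. -/
def leftDer : Matrix (Fin n) (Fin n) K →ₗ[K] Derivation K (Coord n K) (Coord n K) where
  toFun x := MvPolynomial.mkDerivation K
    (Sum.elim
      (fun ij => ∑ k, MvPolynomial.C (x k ij.2) * MvPolynomial.X (Sum.inl (ij.1, k)))
      (fun ij => -∑ k, MvPolynomial.C (x ij.1 k) * MvPolynomial.X (Sum.inr (k, ij.2))))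
  map_add' x y := by
    apply MvPolynomial.derivation_ext
    intro v
    rw [Derivation.add_apply, MvPolynomial.mkDerivation_X, MvPolynomial.mkDerivation_X,
      MvPolynomial.mkDerivation_X]
    rcases v with ij | ij
    · simp only [Sum.elim_inl, Matrix.add_apply, map_add, add_mul, Finset.sum_add_distrib]
    · simp only [Sum.elim_inr, Matrix.add_apply, map_add, add_mul, Finset.sum_add_distrib, neg_add]
  map_smul' c x := by
    apply MvPolynomial.derivation_ext
    intro v
    rw [Derivation.smul_apply, MvPolynomial.mkDerivation_X, MvPolynomial.mkDerivation_X]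
    rcases v with ij | ij
    · simp only [Sum.elim_inl, Matrix.smul_apply, smul_eq_mul, map_mul, mul_assoc, RingHom.id_apply,
        MvPolynomial.smul_eq_C_mul, Finset.mul_sum]
    · simp only [Sum.elim_inr, Matrix.smul_apply, smul_eq_mul, map_mul, mul_assoc, RingHom.id_apply,
        MvPolynomial.smul_eq_C_mul, Finset.mul_sum, mul_neg]

theorem leftDer_inl (x : Matrix (Fin n) (Fin n) K) (i j : Fin n) :
    leftDer x (MvPolynomial.X (Sum.inl (i, j))) =
      ∑ k, MvPolynomial.C (x k j) * MvPolynomial.X (Sum.inl (i, k)) := by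
  simp [leftDer, MvPolynomial.mkDerivation_X]

theorem leftDer_inr (x : Matrix (Fin n) (Fin n) K) (i j : Fin n) :
    leftDer x (MvPolynomial.X (Sum.inr (i, j))) =
      -∑ k, MvPolynomial.C (x i k) * MvPolynomial.X (Sum.inr (k, j)) := by
  simp [leftDer, MvPolynomial.mkDerivation_X]

theorem leftDer_C_mul (x : Matrix (Fin n) (Fin n) K) (c : K) (f : Coord n K) :
    leftDer x (MvPolynomial.C c * f) = MvPolynomial.C c * leftDer x f := by
  rw [← MvPolynomial.smul_eq_C_mul, ← MvPolynomial.smul_eq_C_mul, Derivation.map_smul]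

theorem leftDer_lie (x y : Matrix (Fin n) (Fin n) K) : leftDer ⁅x, y⁆ = ⁅leftDer x, leftDer y⁆ := by
  apply MvPolynomial.derivation_ext
  rintro (⟨i, j⟩ | ⟨i, j⟩)
  · rw [Derivation.commutator_apply, Ring.lie_def, map_sub, Derivation.sub_apply]
    simp only [leftDer_inl, map_sum, leftDer_C_mul, Matrix.mul_apply, map_mul, Finset.sum_mul,
      Finset.mul_sum]
    refine congrArg₂ (· - ·) ?_ ?_
    · refine Finset.sum_comm.trans (Finset.sum_congr rfl fun _ _ => Finset.sum_congr rfl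
        fun _ _ => ?_)
      ring
    · refine Finset.sum_comm.trans (Finset.sum_congr rfl fun _ _ => Finset.sum_congr rfl
        fun _ _ => ?_)
      ring
  · rw [Derivation.commutator_apply, Ring.lie_def, map_sub, Derivation.sub_apply]
    simp only [leftDer_inr, map_neg, map_sum, leftDer_C_mul, Matrix.mul_apply, map_mul,
      Finset.sum_mul, Finset.mul_sum, mul_neg, Finset.sum_neg_distrib, neg_neg]
    rw [neg_sub_neg]
    refine congrArg₂ (· - ·) ?_ ?_
    · refine Finset.sum_comm.trans (Finset.sum_congr rfl fun _ _ => Finset.sum_congr rfl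
        fun _ _ => ?_)
      ring
    · refine Finset.sum_comm.trans (Finset.sum_congr rfl fun _ _ => Finset.sum_congr rfl
        fun _ _ => ?_)
      ring

/-- The Lie algebra of a closed subgroup `H` of `GL n K`, as a subalgebra of `𝔤𝔩 n`: the matrices
whose left invariant derivation preserves the ideal of `H`.  Its `p`-th power map is the `p`-th
power of matrices. -/
def lieAlg (H : Subgroup (GL (Fin n) K)) : LieSubalgebra K (Matrix (Fin n) (Fin n) K) where
  carrier := {x | ∀ f ∈ vanishingIdeal H, leftDer x f ∈ vanishingIdeal H}
  add_mem' := by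
    intro x y hx hy f hf
    rw [map_add, Derivation.add_apply]
    exact add_mem (hx f hf) (hy f hf)
  zero_mem' := by intro f _; simp
  smul_mem' := by
    intro c x hx f hf
    rw [map_smul, Derivation.smul_apply, MvPolynomial.smul_eq_C_mul]
    exact Ideal.mul_mem_left _ _ (hx f hf)
  lie_mem' := by
    intro x y hx hy f hf
    rw [leftDer_lie, Derivation.commutator_apply]
    exact sub_mem (hx _ (hy f hf)) (hy _ (hx f hf))

/-- A torus: a closed connected subgroup that is conjugate to a group of diagonal matrices. -/
def IsTorus (T : Subgroup (GL (Fin n) K)) : Prop :=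
  IsZClosed (T : Set (GL (Fin n) K)) ∧ IsZConnected (T : Set (GL (Fin n) K)) ∧
    ∃ c : GL (Fin n) K, ∀ t ∈ T, ((c * t * c⁻¹ : GL (Fin n) K) : Matrix (Fin n) (Fin n) K).IsDiag

/-- A maximal torus of `G`. -/
def IsMaximalTorus (T G : Subgroup (GL (Fin n) K)) : Prop :=
  T ≤ G ∧ IsTorus T ∧ ∀ T' : Subgroup (GL (Fin n) K), IsTorus T' → T' ≤ G → T ≤ T' → T' = T

/-- A Borel subgroup of `G`: a maximal closed connected solvable subgroup. -/
def IsBorel (B G : Subgroup (GL (Fin n) K)) : Prop :=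
  (B ≤ G ∧ IsZClosed (B : Set (GL (Fin n) K)) ∧ IsZConnected (B : Set (GL (Fin n) K)) ∧
    Group.IsSolvable B) ∧
  ∀ B' : Subgroup (GL (Fin n) K), B' ≤ G → IsZClosed (B' : Set (GL (Fin n) K)) →
    IsZConnected (B' : Set (GL (Fin n) K)) → Group.IsSolvable B' → B ≤ B' → B' = B

/-- A connected reductive group: closed, connected, and without nontrivial closed connected normal
unipotent subgroups. -/
def IsConnectedReductive (G : Subgroup (GL (Fin n) K)) : Prop :=
  IsZClosed (G : Set (GL (Fin n) K)) ∧ IsZConnected (G : Set (GL (Fin n) K)) ∧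
  ∀ N : Subgroup (GL (Fin n) K), N ≤ G → (N.subgroupOf G).Normal →
    IsZClosed (N : Set (GL (Fin n) K)) → IsZConnected (N : Set (GL (Fin n) K)) →
    (∀ g ∈ N, IsNilpotent ((g : Matrix (Fin n) (Fin n) K) - 1)) → N = ⊥

/-- The group `Hom(T, 𝔾ₘ)` of characters: the homomorphisms `T → Kˣ` that are regular functions
on `T` (written multiplicatively). -/
def charSubgroup (T : Subgroup (GL (Fin n) K)) : Subgroup (T →* Kˣ) where
  carrier := {μ | ∃ f : Coord n K, ∀ t : T, (μ t : K) = evalAt f (t : GL (Fin n) K)}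
  mul_mem' := by
    rintro μ ν ⟨f, hf⟩ ⟨g, hg⟩
    refine ⟨f * g, fun t => ?_⟩
    rw [MonoidHom.mul_apply, Units.val_mul, hf, hg]
    simp [evalAt]
  one_mem' := ⟨1, fun t => by simp [evalAt]⟩
  inv_mem' := by
    rintro μ ⟨f, hf⟩
    refine ⟨MvPolynomial.rename Sum.swap f, fun t => ?_⟩
    rw [MonoidHom.inv_apply, ← map_inv, hf]
    simp only [evalAt, MvPolynomial.eval_rename]
    congr 1
    congr 1
    funext ij
    rcases ij with ij | ij <;> simp

/-- The character group `X(T)`, written additively. -/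
abbrev CharLattice (T : Subgroup (GL (Fin n) K)) : Type u := Additive (charSubgroup T)

/-- The value `μ(t)` of a character. -/
def CharLattice.val {T : Subgroup (GL (Fin n) K)} (μ : CharLattice T) (t : T) : Kˣ :=
  (Additive.toMul (α := charSubgroup T) μ).1 t

/-- A polynomial that represents the character `μ` on `T`. -/
def CharLattice.rep {T : Subgroup (GL (Fin n) K)} (μ : CharLattice T) : Coord n K :=
  (Additive.toMul (α := charSubgroup T) μ).2.choose

/-- The differential at `1` of a character `μ`, evaluated at a matrix `x`; for `x` in the Lie
algebra of `T` it does not depend on the polynomial that represents `μ` on `T`. -/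
def CharLattice.differential {T : Subgroup (GL (Fin n) K)} (μ : CharLattice T) :
    Matrix (Fin n) (Fin n) K →ₗ[K] K where
  toFun x := evalAt (leftDer x μ.rep) 1
  map_add' x y := by simp [evalAt]
  map_smul' c x := by simp [evalAt]

/-- A cocharacter of `T`: a homomorphism `Kˣ → T` whose matrix entries are Laurent polynomials. -/
def IsCocharacter {T : Subgroup (GL (Fin n) K)} (φ : Kˣ →* T) : Prop :=
  ∀ i j : Fin n, ∃ (q : Polynomial K) (m : ℕ), ∀ c : Kˣ,
    ((φ c : GL (Fin n) K) : Matrix (Fin n) (Fin n) K) i j * (c : K) ^ m = q.eval (c : K)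

/-- The weight space of weight `μ` for the adjoint action of `T` on the Lie algebra of `G`. -/
def weightSpace (G T : Subgroup (GL (Fin n) K)) (μ : CharLattice T) :
    Submodule K (Matrix (Fin n) (Fin n) K) where
  carrier := {x | x ∈ lieAlg G ∧ ∀ t : T,
    ((t : GL (Fin n) K) : Matrix (Fin n) (Fin n) K) * x *
      (((t : GL (Fin n) K)⁻¹ : GL (Fin n) K) : Matrix (Fin n) (Fin n) K) = (μ.val t : K) • x}
  add_mem' := by
    rintro x y ⟨hx, hx'⟩ ⟨hy, hy'⟩
    exact ⟨add_mem hx hy, fun t => by rw [mul_add, add_mul, hx', hy', smul_add]⟩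
  zero_mem' := ⟨zero_mem _, fun t => by simp⟩
  smul_mem' := by
    rintro c x ⟨hx, hx'⟩
    refine ⟨(lieAlg G).smul_mem c hx, fun t => ?_⟩
    rw [Matrix.mul_smul, Matrix.smul_mul, hx', smul_comm]

/-- The roots of `G` with respect to `T`: the nonzero weights of `T` on the Lie algebra of `G`. -/
def Roots (G T : Subgroup (GL (Fin n) K)) : Type u :=
  {α : CharLattice T // α ≠ 0 ∧ weightSpace G T α ≠ ⊥}

end AlgebraicGroups

/-! ### The standard notation attached to a connected reductive group -/

/-- A connected reductive group `G` over `K` with a maximal torus `T`, a Borel subgroup `B`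
containing `T`, the root datum of `(G, T)`, the set of simple roots given by `B`, and a basis of
the Lie algebra that consists of root vectors and of toral elements `h` with `h ^ [p] = h`. -/
structure ReductiveGroup (K : Type u) [Field K] (p : ℕ) where
  n : ℕ
  G : Subgroup (GL (Fin n) K)
  T : Subgroup (GL (Fin n) K)
  B : Subgroup (GL (Fin n) K)
  isConnectedReductive : IsConnectedReductive G
  isMaximalTorus : IsMaximalTorus T G
  isBorel : IsBorel B G
  T_le_B : T ≤ B
  /-- The coroot of a root, a cocharacter of `T` with values in the derived subgroup of `G`. -/
  coroot : Roots G T → (Kˣ →* T)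
  isCocharacter_coroot : ∀ α, IsCocharacter (coroot α)
  coroot_mem : ∀ α c, (coroot α c : GL (Fin n) K) ∈ ⁅G, G⁆
  /-- The (reduced) root datum of `(G, T)`; the cocharacter lattice is written as `Hom(X(T), ℤ)`. -/
  rootDatum : RootDatum (Roots G T) (CharLattice T) (Module.Dual ℤ (CharLattice T))
  pairing_apply : ∀ μ y, rootDatum.toLinearMap μ y = y μ
  root_apply : ∀ α, rootDatum.root α = α.1
  coroot_apply : ∀ α μ c, μ.val (coroot α c) = c ^ (rootDatum.coroot α μ)
  isReduced : rootDatum.IsReduced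
  /-- The simple roots. -/
  base : rootDatum.Base
  /-- The positive roots are the roots of `B`. -/
  pos_iff : ∀ α : Roots G T,
    rootDatum.root α ∈ AddSubmonoid.closure (rootDatum.root '' base.support) ↔
      weightSpace G T α.1 ≤ (lieAlg B).toSubmodule
  d : ℕ
  /-- The basis of the Lie algebra of `G`: root vectors and a basis of the Lie algebra of `T`. -/
  basis : Module.Basis (Roots G T ⊕ Fin d) K (lieAlg G)
  basis_root : ∀ α, (basis (Sum.inl α) : Matrix (Fin n) (Fin n) K) ∈ weightSpace G T α.1
  span_basis_torus : Submodule.span K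
    (Set.range fun i => (basis (Sum.inr i) : Matrix (Fin n) (Fin n) K)) = (lieAlg T).toSubmodule
  basis_torus_pow : ∀ i, (basis (Sum.inr i) : Matrix (Fin n) (Fin n) K) ^ p = basis (Sum.inr i)

namespace ReductiveGroup

variable {K : Type u} [Field K] {p : ℕ} (S : ReductiveGroup K p)

/-- The character lattice `X = X(T)`. -/
abbrev X : Type u := CharLattice S.T

/-- The set `R` of roots. -/
abbrev R : Type u := Roots S.G S.T

/-- The Lie algebra `𝔤` of `G`. -/
abbrev g : Type u := lieAlg S.G

/-- The Lie algebra `𝔥` of `T`, as a subalgebra of `𝔤`. -/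
def h : LieSubalgebra K S.g := (lieAlg S.T).comap (lieAlg S.G).incl

/-- The root vector `e_α`. -/
def e (α : S.R) : S.g := S.basis (Sum.inl α)

/-- The positive roots. -/
def IsPos (α : S.R) : Prop :=
  S.rootDatum.root α ∈ AddSubmonoid.closure (S.rootDatum.root '' S.base.support)

/-- The differential `dμ ∈ 𝔥*` of a character `μ`. -/
def diff (μ : S.X) : Module.Dual K S.h :=
  μ.differential.comp ((lieAlg S.G).toSubmodule.subtype.comp S.h.toSubmodule.subtype)

/-- `χ` is in standard Levi form with associated set `I` of simple roots. -/
def IsStandardLeviForm (χ : Module.Dual K S.g) (I : Set S.R) : Prop :=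
  I ⊆ S.base.support ∧
  (∀ x : S.g, (x : Matrix (Fin S.n) (Fin S.n) K) ∈ lieAlg S.B → χ x = 0) ∧
  ∀ α β : S.R, S.IsPos α → β.1 = -α.1 → (α ∈ I → χ (S.e β) = 1) ∧ (α ∉ I → χ (S.e β) = 0)

/-- The subgroup `ℤI` of `X`. -/
def ZI (I : Set S.R) : AddSubgroup S.X := AddSubgroup.closure (Subtype.val '' I)

/-- The quotient group `X/ℤI`. -/
abbrev XI (I : Set S.R) : Type u := S.X ⧸ S.ZI I

/-! ### The algebra `U_χ` and its grading -/

/-- The defining relations `e_α ^ p = χ(e_α) ^ p` of `U_χ`. -/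
inductive URel (χ : Module.Dual K S.g) :
    UniversalEnvelopingAlgebra K S.g → UniversalEnvelopingAlgebra K S.g → Prop
  | pow (α : S.R) : URel χ (UniversalEnvelopingAlgebra.ι K (S.e α) ^ p)
      (algebraMap K _ (χ (S.e α) ^ p))

/-- The algebra `U_χ = U(𝔤)/⟨e_α ^ p - χ(e_α) ^ p⟩`. -/
def U (χ : Module.Dual K S.g) : Type u := RingQuot (S.URel χ)

instance (χ : Module.Dual K S.g) : Ring (S.U χ) := inferInstanceAs (Ring (RingQuot (S.URel χ)))

instance (χ : Module.Dual K S.g) : Algebra K (S.U χ) :=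
  inferInstanceAs (Algebra K (RingQuot (S.URel χ)))

/-- The quotient map `U(𝔤) → U_χ`. -/
def toU (χ : Module.Dual K S.g) : UniversalEnvelopingAlgebra K S.g →ₐ[K] S.U χ :=
  RingQuot.mkAlgHom K (S.URel χ)

/-- The image in `U_χ` of an element of `𝔤`. -/
def ofLie (χ : Module.Dual K S.g) (x : S.g) : S.U χ := S.toU χ (UniversalEnvelopingAlgebra.ι K x)

/-- `u` is a product of root vectors `e_α` (of degree `α + ℤI`) and elements of `𝔥`
(of degree `0`), of total degree `ξ`. -/
inductive IsMonomial (χ : Module.Dual K S.g) (I : Set S.R) : S.XI I → S.U χ → Prop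
  | one : IsMonomial χ I 0 1
  | root (α : S.R) {ξ : S.XI I} {u : S.U χ} (hu : IsMonomial χ I ξ u) :
      IsMonomial χ I (QuotientAddGroup.mk α.1 + ξ) (S.ofLie χ (S.e α) * u)
  | torus (x : S.h) {ξ : S.XI I} {u : S.U χ} (hu : IsMonomial χ I ξ u) :
      IsMonomial χ I ξ (S.ofLie χ x * u)

/-- The graded piece `(U_χ)_ξ` for `ξ ∈ X/ℤI`. -/
def Ugr (χ : Module.Dual K S.g) (I : Set S.R) (ξ : S.XI I) : Submodule K (S.U χ) :=
  Submodule.span K {u | S.IsMonomial χ I ξ u}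

/-- The subspace `(U_χ)_ξ ^ w` of `(U_χ)_ξ` on which `𝔥` acts (by commutators) with weight `w`. -/
def Uwt (χ : Module.Dual K S.g) (I : Set S.R) (ξ : S.XI I) (w : Module.Dual K S.h) :
    Submodule K (S.U χ) where
  carrier := {u | u ∈ S.Ugr χ I ξ ∧
    ∀ x : S.h, S.ofLie χ x * u - u * S.ofLie χ x = w x • u}
  add_mem' := by
    rintro a b ⟨ha, ha'⟩ ⟨hb, hb'⟩
    refine ⟨add_mem ha hb, fun x => ?_⟩
    rw [smul_add, ← ha', ← hb', mul_add, add_mul]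
    abel
  zero_mem' := ⟨zero_mem _, fun x => by simp⟩
  smul_mem' := by
    rintro c a ⟨ha, ha'⟩
    refine ⟨Submodule.smul_mem _ c ha, fun x => ?_⟩
    rw [mul_smul_comm, smul_mul_assoc, ← smul_sub, ha', smul_comm]

/-- The algebra `U⁰ = U(𝔥)`. -/
abbrev U0 : Type u := UniversalEnvelopingAlgebra K S.h

/-- The weights that occur in degree `ξ = λ + ℤI`: the `dμ` with `μ ∈ λ + ℤI + pX`. -/
def weightsOf (I : Set S.R) (ξ : S.XI I) : Set (Module.Dual K S.h) :=
  {w | ∃ μ τ : S.X, (QuotientAddGroup.mk (μ - p • τ) : S.XI I) = ξ ∧ w = S.diff μ}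

end ReductiveGroup

/-! ### The category `𝒞_A` -/

section Category

variable {K : Type u} [Field K] {p : ℕ} (S : ReductiveGroup K p) (χ : Module.Dual K S.g)
  (I : Set S.R) {A : Type v} [CommRing A] [Algebra K A] (π : S.U0 →ₐ[K] A)

/-- The objects of `𝒞_A`: modules over `U_χ ⊗ A` with an `X/ℤI`-grading `gr` and decompositions
`wt` of the graded pieces.  The action of `a ∈ A` is that of `1 ⊗ a`, the action of `u ∈ U_χ` is
that of `u ⊗ 1`. -/
structure CA where
  carrier : Type (max u v)
  [addCommGroup : AddCommGroup carrier]
  [module : Module (S.U χ ⊗[K] A) carrier]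
  /-- `M_{λ+ℤI}` -/
  gr : S.XI I → AddSubgroup carrier
  /-- `M_{λ+ℤI}^{dμ}` -/
  wt : S.XI I → Module.Dual K S.h → AddSubgroup carrier
  gr_indep : iSupIndep gr
  gr_top : ⨆ ξ, gr ξ = ⊤
  /-- the action of `A` preserves the grading -/
  gr_smul : ∀ ξ (a : A), ∀ m ∈ gr ξ, ((1 : S.U χ) ⊗ₜ[K] a) • m ∈ gr ξ
  /-- finitely many nonzero pieces, each finitely generated over `A` -/
  gr_finite : {ξ | gr ξ ≠ ⊥}.Finite
  gr_fg : ∀ ξ, ∃ s : Finset carrier, gr ξ =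
    AddSubgroup.closure {y | ∃ m ∈ s, ∃ a : A, y = ((1 : S.U χ) ⊗ₜ[K] a) • m}
  /-- compatibility with the grading of `U_χ` -/
  gr_mul : ∀ σ ξ, ∀ u ∈ S.Ugr χ I σ, ∀ m ∈ gr ξ, (u ⊗ₜ[K] (1 : A)) • m ∈ gr (σ + ξ)
  /-- the decomposition of `M_ξ`, whose index set is `weightsOf` -/
  wt_eq_bot : ∀ ξ w, w ∉ S.weightsOf I ξ → wt ξ w = ⊥
  wt_indep : ∀ ξ, iSupIndep (wt ξ)
  wt_iSup : ∀ ξ, ⨆ w, wt ξ w = gr ξ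
  /-- `h m = m π(h + dμ(h))` for `h ∈ 𝔥`; since `𝔥` generates `U⁰`, this is `s m = m π(μ~(s))` for
  all `s ∈ U⁰`, where `μ~` is the automorphism of `U⁰` with `μ~(h) = h + dμ(h)` -/
  wt_torus : ∀ ξ (μ : S.X) (x : S.h), ∀ m ∈ wt ξ (S.diff μ),
    (S.ofLie χ x ⊗ₜ[K] (1 : A)) • m =
      ((1 : S.U χ) ⊗ₜ[K]
        π (UniversalEnvelopingAlgebra.ι K x + algebraMap K _ (S.diff μ x))) • m
  wt_root : ∀ ξ (μ : S.X) (α : S.R), ∀ m ∈ wt ξ (S.diff μ),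
    (S.ofLie χ (S.e α) ⊗ₜ[K] (1 : A)) • m ∈
      wt (ξ + QuotientAddGroup.mk α.1) (S.diff (μ + α.1))
  wt_smul : ∀ ξ w (a : A), ∀ m ∈ wt ξ w, ((1 : S.U χ) ⊗ₜ[K] a) • m ∈ wt ξ w

namespace CA

attribute [instance] CA.addCommGroup CA.module

variable {S χ I π}

/-- The morphisms of `𝒞_A`: homomorphisms of `U_χ ⊗ A`-modules that send `M_{λ+ℤI}^{dμ}` to
`N_{λ+ℤI}^{dμ}`. -/
@[ext]
structure Hom (M N : CA S χ I π) where
  toLinearMap : M.carrier →ₗ[S.U χ ⊗[K] A] N.carrier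
  map_wt : ∀ ξ w, ∀ m ∈ M.wt ξ w, toLinearMap m ∈ N.wt ξ w

instance : CategoryTheory.Category (CA S χ I π) where
  Hom M N := Hom M N
  id M := ⟨LinearMap.id, fun _ _ _ hm => hm⟩
  comp f g := ⟨g.toLinearMap.comp f.toLinearMap,
    fun ξ w m hm => g.map_wt ξ w _ (f.map_wt ξ w m hm)⟩

/-- The homomorphism of modules that underlies a morphism of `𝒞_A`. -/
def linearMap {M N : CA S χ I π} (f : M ⟶ N) : M.carrier →ₗ[S.U χ ⊗[K] A] N.carrier :=
  Hom.toLinearMap f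

end CA

/-! ### Baby Verma modules and `Z`-filtrations -/

/-- The defining relations of `Z_{A,χ}(μ) = U_χ ⊗_{U⁰U⁺} A^μ` as a quotient of `U_χ ⊗ A`: the left
ideal generated by `e_α ⊗ 1`, for `α` positive, and `h ⊗ 1 - 1 ⊗ π(h + dμ(h))`, for `h ∈ 𝔥`. -/
def babyVermaRel (μ : S.X) : Submodule (S.U χ ⊗[K] A) (S.U χ ⊗[K] A) :=
  Submodule.span _
    ({y | ∃ α : S.R, S.IsPos α ∧ y = S.ofLie χ (S.e α) ⊗ₜ[K] (1 : A)} ∪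
     {y | ∃ x : S.h, y = S.ofLie χ x ⊗ₜ[K] (1 : A) -
        (1 : S.U χ) ⊗ₜ[K]
          π (UniversalEnvelopingAlgebra.ι K x + algebraMap K _ (S.diff μ x))})

/-- The baby Verma module `Z_{A,χ}(μ) = U_χ ⊗_{U⁰U⁺} A^μ`, where `U⁰U⁺` is generated by `𝔥` and
the positive root vectors, and `A^μ = A` with `e_α` acting as `0` and `h` as `π(h + dμ(h))`. -/
abbrev BabyVerma (μ : S.X) : Type (max u v) := (S.U χ ⊗[K] A) ⧸ babyVermaRel S χ π μ

/-- The piece `Z_{A,χ}(μ)_ξ ^ w` of a baby Verma module: the image of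
`(U_χ)_{ξ - μ} ^ {w - dμ} ⊗ A`. -/
def babyVermaWt (μ : S.X) (ξ : S.XI I) (w : Module.Dual K S.h) :
    AddSubgroup (BabyVerma S χ π μ) :=
  AddSubgroup.closure {z | ∃ u ∈ S.Uwt χ I (ξ - QuotientAddGroup.mk μ) (w - S.diff μ), ∃ a : A,
    z = (babyVermaRel S χ π μ).mkQ (u ⊗ₜ[K] a)}

variable {S χ I π}

/-- `M ∈ 𝒞_A` has a `Z`-filtration: a chain `0 = F₀ ⊆ F₁ ⊆ ⋯ ⊆ Fᵣ = M` of submodules of `M` in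
`𝒞_A` (submodules that are the sum of their intersections with the pieces of `M`), such that each
`Fᵢ₊₁/Fᵢ`, with the induced pieces, is isomorphic to some `Z_{A,χ}(μ)`. -/
def CA.HasZFiltration (M : CA S χ I π) : Prop :=
  ∃ (r : ℕ) (F : Fin (r + 1) → Submodule (S.U χ ⊗[K] A) M.carrier),
    Monotone F ∧ F 0 = ⊥ ∧ F (Fin.last r) = ⊤ ∧
    (∀ i, (F i).toAddSubgroup = ⨆ ξ, ⨆ w, (F i).toAddSubgroup ⊓ M.wt ξ w) ∧
    ∀ i : Fin r, ∃ (μ : S.X)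
      (φ : (F i.succ ⧸ (F i.castSucc).submoduleOf (F i.succ)) ≃ₗ[S.U χ ⊗[K] A]
        BabyVerma S χ π μ),
      ∀ ξ w (z : BabyVerma S χ π μ), z ∈ babyVermaWt S χ I π μ ξ w ↔
        ∃ y : F i.succ, (y : M.carrier) ∈ M.wt ξ w ∧ φ (Submodule.Quotient.mk y) = z

end Category

end GradedLevi

end

/-!
For weights `λ₁, …, λₖ ∈ X` let `Q = ⨁ⱼ U_χ ⊗_{U⁰} A^{λⱼ}`. Morphisms from `Q` to an object `N` of
`𝒞_A` are families of vectors of `N` of weights `λⱼ`. Epimorphisms of `𝒞_A` are surjective, hence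
surjective on weight spaces, so `Q` is projective; and a finite set of weight vectors generating `M`
gives a surjection `Q → M`.

By the Poincaré-Birkhoff-Witt theorem, `Q` is free over `A` on the products `f e ⊗ 1ⱼ`, where `f`
and `e` run through the monomials with exponents `< p` in the negative and the positive root
vectors. A positive root vector sends `e ⊗ 1ⱼ` to a combination of `d ⊗ 1ⱼ` with `d` of larger
height, since `χ` vanishes on the positive root vectors. If the `e ⊗ 1ⱼ` are listed by decreasing
height, each is therefore a highest weight vector modulo the submodule generated by the preceding
ones, and generates a baby Verma module there.
-/

noncomputable section

namespace GradedLevi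

open UniversalEnvelopingAlgebra (ι)

attribute [local instance 100] LieRing.ofAssociativeRing
attribute [local instance] Algebra.TensorProduct.rightAlgebra

/-! ### The Poincaré–Birkhoff–Witt theorem -/

section SortedMultisets

variable {σ : Type*} [LinearOrder σ]

@[elab_as_elim]
theorem multiset_induction_on_min {q : Multiset σ → Prop} (zero : q 0)
    (cons : ∀ (j : σ) (N : Multiset σ), (∀ k ∈ N, j ≤ k) → q N → q (j ::ₘ N)) (M : Multiset σ) :
    q M := by
  suffices h : ∀ l : List σ, l.Pairwise (· ≤ ·) → q l from
    M.sort_eq (· ≤ ·) ▸ h _ (M.pairwise_sort _)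
  intro l hl
  induction hl with
  | nil => exact zero
  | @cons j l hj _ ih => exact cons j l hj ih

theorem forall_le_or_exists_lt_min_cons (i : σ) (M : Multiset σ) :
    (∀ k ∈ M, i ≤ k) ∨ ∃ j N, j < i ∧ (∀ k ∈ N, j ≤ k) ∧ M = j ::ₘ N := by
  induction M using multiset_induction_on_min with
  | zero => exact Or.inl (by simp)
  | cons j N hN _ =>
    rcases le_or_gt i j with hij | hji
    · exact Or.inl (Multiset.forall_mem_cons.2 ⟨hij, fun k hk => hij.trans (hN k hk)⟩)
    · exact Or.inr ⟨j, N, hji, hN, rfl⟩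

end SortedMultisets

namespace PBW

section Degree

variable {K σ : Type*} [CommRing K]

/-- Polynomials of degree at most `n` in commuting variables `x_i`, `i : σ`. The multiset `M`
stands for the monomial `∏ i ∈ M, x_i`. -/
def degLE (K : Type*) [CommRing K] (σ : Type*) (n : ℕ) : Submodule K (Multiset σ →₀ K) :=
  Finsupp.supported K K {M | M.card ≤ n}

theorem single_mem_degLE {M : Multiset σ} {n : ℕ} (h : M.card ≤ n) (c : K) :
    Finsupp.single M c ∈ degLE K σ n :=
  Finsupp.single_mem_supported K c h

theorem degLE_mono {m n : ℕ} (h : m ≤ n) : degLE K σ m ≤ degLE K σ n :=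
  Finsupp.supported_mono fun _ hM => le_trans hM h

theorem exists_mem_degLE (x : Multiset σ →₀ K) : ∃ n, x ∈ degLE K σ n :=
  ⟨x.support.sup Multiset.card, (Finsupp.mem_supported K x).2 fun _ hM =>
    Finset.le_sup (f := Multiset.card) hM⟩

theorem supported_le_of_single_mem {s : Set (Multiset σ)} {N : Submodule K (Multiset σ →₀ K)}
    (h : ∀ M ∈ s, Finsupp.single M 1 ∈ N) : Finsupp.supported K K s ≤ N := by
  rw [Finsupp.supported_eq_span_single, Submodule.span_le]
  rintro _ ⟨M, hM, rfl⟩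
  exact h M hM

end Degree

section Weight

variable {σ Γ : Type*} [AddCommMonoid Γ] {P : Set σ} {wt : σ → Γ}

/-- The multisets with elements in `P` and total weight `γ`. -/
def multisetsOfWeight (P : Set σ) (wt : σ → Γ) (γ : Γ) : Set (Multiset σ) :=
  {M | (∀ i ∈ M, i ∈ P) ∧ (M.map wt).sum = γ}

theorem cons_mem_multisetsOfWeight {i : σ} (hi : i ∈ P) {M : Multiset σ} {γ : Γ}
    (hM : M ∈ multisetsOfWeight P wt γ) : i ::ₘ M ∈ multisetsOfWeight P wt (wt i + γ) :=
  ⟨Multiset.forall_mem_cons.2 ⟨hi, hM.1⟩, by rw [Multiset.map_cons, Multiset.sum_cons, hM.2]⟩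

end Weight

section Enveloping

variable {K : Type*} [CommRing K] {L : Type*} [LieRing L] [LieAlgebra K L]

theorem subalgebra_eq_top_of_forall_ι_mem (B : Subalgebra K (UniversalEnvelopingAlgebra K L))
    (hB : ∀ X, ι K X ∈ B) : B = ⊤ := by
  let f : L →ₗ⁅K⁆ B :=
    { toFun := fun X => ⟨ι K X, hB X⟩
      map_add' := fun X Y => Subtype.ext (map_add (ι K) X Y)
      map_smul' := fun c X => Subtype.ext (map_smul (ι K) c X)
      map_lie' := fun {X Y} => Subtype.ext (LieHom.map_lie (ι K) X Y) }
  have h : B.val.comp (UniversalEnvelopingAlgebra.lift K f) = AlgHom.id K _ := by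
    refine UniversalEnvelopingAlgebra.hom_ext _ (LieHom.ext fun X => ?_)
    simp [f]
  refine eq_top_iff.2 fun u _ => ?_
  rw [← AlgHom.id_apply (R := K) u, ← h]
  exact (UniversalEnvelopingAlgebra.lift K f u).2

@[elab_as_elim]
theorem enveloping_induction {q : UniversalEnvelopingAlgebra K L → Prop}
    (algebraMap : ∀ c, q (algebraMap K _ c)) (ι : ∀ X, q (ι K X))
    (mul : ∀ u v, q u → q v → q (u * v)) (add : ∀ u v, q u → q v → q (u + v))
    (u : UniversalEnvelopingAlgebra K L) : q u := by
  let B : Subalgebra K (UniversalEnvelopingAlgebra K L) :=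
    { carrier := {u | q u}
      mul_mem' := mul _ _
      add_mem' := add _ _
      algebraMap_mem' := algebraMap }
  have : u ∈ B := subalgebra_eq_top_of_forall_ι_mem B ι ▸ Algebra.mem_top
  exact this

end Enveloping

variable {K : Type*} [CommRing K] {L : Type*} [LieRing L] [LieAlgebra K L]
  {σ : Type*} [LinearOrder σ] (b : Module.Basis σ K L)

/-- The action of the basis vector `b i` on polynomials that makes the polynomials isomorphic to
`U(L)` as a left `L`-module. The formula for `b i • (x_j * N)` with `j < i` involves the action on
polynomials of degree `N.card` only; the recursion runs over an upper bound `n` of the degrees in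
which the value is correct. -/
def approxAct : ℕ → σ → (Multiset σ →₀ K) →ₗ[K] (Multiset σ →₀ K)
  | 0, i => Finsupp.lmapDomain K K (i ::ₘ ·)
  | n + 1, i => Finsupp.lmapDomain K K (i ::ₘ ·) + Finsupp.linearCombination K fun M =>
      match M.sort with
      | [] => 0
      | j :: l => if i ≤ j then 0 else
          approxAct n j (approxAct n i (Finsupp.single (l : Multiset σ) 1) -
            Finsupp.single (i ::ₘ (l : Multiset σ)) 1) +
          (b.repr ⁅b i, b j⁆).sum fun k c => c • approxAct n k (Finsupp.single (l : Multiset σ) 1)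

theorem approxAct_of_le (n : ℕ) {i : σ} {M : Multiset σ} (h : ∀ k ∈ M, i ≤ k) :
    approxAct b n i (Finsupp.single M 1) = Finsupp.single (i ::ₘ M) 1 := by
  cases n with
  | zero => simp [approxAct]
  | succ n =>
    simp only [approxAct, LinearMap.add_apply, Finsupp.lmapDomain_apply, Finsupp.mapDomain_single,
      Finsupp.linearCombination_single, one_smul]
    induction M using multiset_induction_on_min with
    | zero => simp
    | cons j N hN _ => simp [Multiset.sort_cons j N (· ≤ ·) hN, h j (by simp)]

theorem approxAct_succ_of_lt (n : ℕ) {i j : σ} (hij : j < i) {N : Multiset σ}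
    (h : ∀ k ∈ N, j ≤ k) :
    approxAct b (n + 1) i (Finsupp.single (j ::ₘ N) 1) = Finsupp.single (i ::ₘ j ::ₘ N) 1 +
      (approxAct b n j (approxAct b n i (Finsupp.single N 1) - Finsupp.single (i ::ₘ N) 1) +
        (b.repr ⁅b i, b j⁆).sum fun k c => c • approxAct b n k (Finsupp.single N 1)) := by
  simp only [approxAct, LinearMap.add_apply, Finsupp.lmapDomain_apply, Finsupp.mapDomain_single,
    Finsupp.linearCombination_single, one_smul, Multiset.sort_cons j N (· ≤ ·) h, not_le.2 hij,
    if_false, Multiset.sort_eq]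

theorem approxAct_sub_mem_degLE (n : ℕ) (i : σ) (M : Multiset σ) :
    approxAct b n i (Finsupp.single M 1) - Finsupp.single (i ::ₘ M) 1 ∈ degLE K σ M.card := by
  induction n generalizing i M with
  | zero => simp [approxAct]
  | succ n ih =>
    have raises_degree : ∀ (i : σ) (d : ℕ),
        degLE K σ d ≤ (degLE K σ (d + 1)).comap (approxAct b n i) := by
      refine fun i d => supported_le_of_single_mem fun M (hM : M.card ≤ d) => ?_
      rw [Submodule.mem_comap, ← sub_add_cancel (approxAct b n i _) (Finsupp.single (i ::ₘ M) 1)]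
      exact add_mem (degLE_mono (by lia) (ih i M)) (single_mem_degLE (by simpa using hM) 1)
    rcases forall_le_or_exists_lt_min_cons i M with h | ⟨j, N, hij, h, rfl⟩
    · rw [approxAct_of_le b _ h, sub_self]
      exact zero_mem _
    · rw [approxAct_succ_of_lt b n hij h, add_sub_cancel_left, Multiset.card_cons]
      exact add_mem (raises_degree _ _ (ih i N)) (Submodule.sum_mem _ fun k _ =>
        Submodule.smul_mem _ _ (raises_degree _ _ (single_mem_degLE le_rfl 1)))

theorem approxAct_eq_of_mem_degLE {d n m : ℕ} (hn : d ≤ n) (hm : d ≤ m) (i : σ)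
    {x : Multiset σ →₀ K} (hx : x ∈ degLE K σ d) : approxAct b n i x = approxAct b m i x := by
  induction d generalizing n m i x with
  | zero =>
    refine supported_le_of_single_mem
      (N := LinearMap.eqLocus (approxAct b n i) (approxAct b m i)) (fun M hM => ?_) hx
    obtain rfl : M = 0 := by simpa using hM
    rw [LinearMap.mem_eqLocus, approxAct_of_le b _ (by simp), approxAct_of_le b _ (by simp)]
  | succ d ih =>
    refine supported_le_of_single_mem
      (N := LinearMap.eqLocus (approxAct b n i) (approxAct b m i)) (fun M hM => ?_) hx
    rw [LinearMap.mem_eqLocus]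
    obtain ⟨n, rfl⟩ : ∃ n', n = n' + 1 := ⟨n - 1, by lia⟩
    obtain ⟨m, rfl⟩ : ∃ m', m = m' + 1 := ⟨m - 1, by lia⟩
    rw [add_le_add_iff_right] at hn hm
    rcases forall_le_or_exists_lt_min_cons i M with h | ⟨j, N, hij, h, rfl⟩
    · rw [approxAct_of_le b _ h, approxAct_of_le b _ h]
    · have hN : N.card ≤ d := by simpa using hM
      have agree_on_N : ∀ k,
          approxAct b n k (Finsupp.single N 1) = approxAct b m k (Finsupp.single N 1) :=
        fun k => ih hn hm k (single_mem_degLE hN 1)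
      simp only [approxAct_succ_of_lt b _ hij h, agree_on_N]
      rw [ih hn hm j (degLE_mono hN (approxAct_sub_mem_degLE b m i N))]

/-- The action of the basis vector `b i` on polynomials. -/
def act (i : σ) : (Multiset σ →₀ K) →ₗ[K] (Multiset σ →₀ K) :=
  Finsupp.linearCombination K fun M => approxAct b M.card i (Finsupp.single M 1)

/-- The linear extension of `act` to `L`. -/
def actL : L →ₗ[K] (Multiset σ →₀ K) →ₗ[K] (Multiset σ →₀ K) := b.constr K (act b)

@[simp] theorem actL_basis (i : σ) : actL b (b i) = act b i := b.constr_basis K _ i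

theorem actL_apply (X : L) (x : Multiset σ →₀ K) :
    actL b X x = (b.repr X).sum fun k c => c • act b k x := by
  simp only [actL, Module.Basis.constr_apply, Finsupp.sum, LinearMap.sum_apply,
    LinearMap.smul_apply]

theorem act_eq_approxAct (n : ℕ) (i : σ) {x : Multiset σ →₀ K} (hx : x ∈ degLE K σ n) :
    act b i x = approxAct b n i x := by
  refine supported_le_of_single_mem (N := LinearMap.eqLocus (act b i) (approxAct b n i))
    (fun M hM => ?_) hx
  rw [LinearMap.mem_eqLocus, act, Finsupp.linearCombination_single, one_smul]
  exact approxAct_eq_of_mem_degLE b le_rfl hM i (single_mem_degLE le_rfl 1)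

theorem act_of_le {i : σ} {M : Multiset σ} (h : ∀ k ∈ M, i ≤ k) :
    act b i (Finsupp.single M 1) = Finsupp.single (i ::ₘ M) 1 := by
  rw [act_eq_approxAct b M.card i (single_mem_degLE le_rfl 1), approxAct_of_le b _ h]

theorem act_sub_mem_degLE (i : σ) (M : Multiset σ) :
    act b i (Finsupp.single M 1) - Finsupp.single (i ::ₘ M) 1 ∈ degLE K σ M.card := by
  rw [act_eq_approxAct b M.card i (single_mem_degLE le_rfl 1)]
  exact approxAct_sub_mem_degLE b _ i M

theorem act_act_of_lt_of_le {i j : σ} (hji : j < i) {N : Multiset σ} (h : ∀ k ∈ N, j ≤ k) :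
    act b i (act b j (Finsupp.single N 1)) =
      act b j (act b i (Finsupp.single N 1)) + actL b ⁅b i, b j⁆ (Finsupp.single N 1) := by
  have hN : Finsupp.single N (1 : K) ∈ degLE K σ N.card := single_mem_degLE le_rfl 1
  have hiN : ∀ k ∈ i ::ₘ N, j ≤ k := Multiset.forall_mem_cons.2 ⟨hji.le, h⟩
  rw [act_of_le b h, act_eq_approxAct b (N.card + 1) i (single_mem_degLE (by simp) 1),
    approxAct_succ_of_lt b _ hji h, ← act_eq_approxAct b _ _ (approxAct_sub_mem_degLE b _ i N),
    ← act_eq_approxAct b _ i hN, map_sub, act_of_le b hiN, actL_apply, Multiset.cons_swap i j]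
  simp only [← act_eq_approxAct b _ _ hN]
  abel

/-- The polynomials on which `actL` satisfies the identity of a Lie algebra action. -/
def lieCompatible : Submodule K (Multiset σ →₀ K) where
  carrier := {x | ∀ X Y, actL b X (actL b Y x) = actL b Y (actL b X x) + actL b ⁅X, Y⁆ x}
  add_mem' hx hy X Y := by
    simp only [map_add, hx X Y, hy X Y]
    abel
  zero_mem' X Y := by simp
  smul_mem' c x hx X Y := by simp only [map_smul, hx X Y, smul_add]

theorem mem_lieCompatible_of_lt {x : Multiset σ →₀ K}
    (h : ∀ i j, j < i →
      act b i (act b j x) = act b j (act b i x) + actL b ⁅b i, b j⁆ x) :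
    x ∈ lieCompatible b := by
  let lhs : L →ₗ[K] L →ₗ[K] (Multiset σ →₀ K) := LinearMap.mk₂ K
    (fun X Y => actL b X (actL b Y x)) (by simp) (by simp) (by simp) (by simp)
  let rhs : L →ₗ[K] L →ₗ[K] (Multiset σ →₀ K) := LinearMap.mk₂ K
    (fun X Y => actL b Y (actL b X x) + actL b ⁅X, Y⁆ x)
    (fun _ _ _ => by simp only [map_add, LinearMap.add_apply, add_lie]; abel)
    (fun _ _ _ => by simp only [map_smul, LinearMap.smul_apply, smul_lie, smul_add])
    (fun _ _ _ => by simp only [map_add, LinearMap.add_apply, lie_add]; abel)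
    (fun _ _ _ => by simp only [map_smul, LinearMap.smul_apply, lie_smul, smul_add])
  suffices lhs = rhs from fun X Y => LinearMap.congr_fun₂ this X Y
  refine LinearMap.ext_basis b b fun i j => ?_
  simp only [lhs, rhs, LinearMap.mk₂_apply, actL_basis]
  rcases lt_trichotomy j i with hji | rfl | hij
  · exact h i j hji
  · simp
  · rw [h j i hij, ← lie_skew (b j), map_neg, LinearMap.neg_apply, neg_add_cancel_right]

section JacobiStep

variable {i j k : σ} {N : Multiset σ}

theorem act_act_act_of_lt_of_lt (hki : k < i) (hkj : k < j) (hN : ∀ l ∈ N, k ≤ l)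
    (hc : degLE K σ N.card ≤ lieCompatible b) :
    actL b (b i) (actL b (b k) (actL b (b j) (Finsupp.single N 1))) =
      actL b (b k) (actL b (b i) (actL b (b j) (Finsupp.single N 1))) +
        actL b ⁅b i, b k⁆ (actL b (b j) (Finsupp.single N 1)) := by
  have lower_terms := hc (act_sub_mem_degLE b j N) (b i) (b k)
  have top_term := act_act_of_lt_of_le b hki (N := j ::ₘ N)
    (Multiset.forall_mem_cons.2 ⟨hkj.le, hN⟩)
  simp only [← actL_basis] at top_term
  rw [actL_basis b j,
    ← sub_add_cancel (act b j (Finsupp.single N 1)) (Finsupp.single (j ::ₘ N) 1)]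
  simp only [map_add] at lower_terms top_term ⊢
  rw [lower_terms, top_term]
  abel

/-- Both sides are moved past `b k`, which acts first on `x_k * N`; the terms that remain agree by
the Jacobi identity. -/
theorem act_act_cons_of_lt_of_lt (hki : k < i) (hkj : k < j) (hN : ∀ l ∈ N, k ≤ l)
    (hc : degLE K σ N.card ≤ lieCompatible b) :
    act b i (act b j (Finsupp.single (k ::ₘ N) 1)) =
      act b j (act b i (Finsupp.single (k ::ₘ N) 1)) +
        actL b ⁅b i, b j⁆ (Finsupp.single (k ::ₘ N) 1) := by
  set z : Multiset σ →₀ K := Finsupp.single N 1 with hz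
  have comm_z := hc (single_mem_degLE (K := K) (M := N) le_rfl 1)
  have expand : ∀ i j, k < i → k < j → actL b (b i) (actL b (b j) (actL b (b k) z)) =
      actL b (b k) (actL b (b i) (actL b (b j) z)) + actL b ⁅b i, b k⁆ (actL b (b j) z) +
        (actL b ⁅b j, b k⁆ (actL b (b i) z) + actL b ⁅b i, ⁅b j, b k⁆⁆ z) := by
    intro i j hi hj
    rw [comm_z (b j) (b k), map_add, act_act_act_of_lt_of_lt b hi hj hN hc,
      comm_z (b i) ⁅b j, b k⁆]
  rw [show Finsupp.single (k ::ₘ N) 1 = actL b (b k) z by rw [actL_basis, hz, act_of_le b hN]]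
  simp only [← actL_basis]
  rw [expand i j hki hkj, expand j i hkj hki, comm_z _ (b k), comm_z (b i) (b j), map_add,
    lie_lie (b i) (b j) (b k), map_sub, LinearMap.sub_apply]
  abel

end JacobiStep

theorem degLE_le_lieCompatible (d : ℕ) : degLE K σ d ≤ lieCompatible b := by
  induction d using Nat.strong_induction_on with
  | _ d ih =>
  refine supported_le_of_single_mem fun M hM => mem_lieCompatible_of_lt b fun i j hji => ?_
  rcases forall_le_or_exists_lt_min_cons j M with h | ⟨k, N, hkj, h, rfl⟩
  · exact act_act_of_lt_of_le b hji h
  · exact act_act_cons_of_lt_of_lt b (hkj.trans hji) hkj h (ih _ (by simpa using hM))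

/-- The representation of `L` on polynomials. -/
def actHom : L →ₗ⁅K⁆ Module.End K (Multiset σ →₀ K) where
  toLinearMap := actL b
  map_lie' {X Y} := by
    refine LinearMap.ext fun x => ?_
    obtain ⟨d, hd⟩ := exists_mem_degLE x
    rw [Ring.lie_def]
    exact eq_sub_of_add_eq' (degLE_le_lieCompatible b d hd X Y).symm

/-- The ordered monomial `b i₁ * ⋯ * b iₙ ∈ U(L)` with `i₁ ≤ ⋯ ≤ iₙ` the elements of `M`. -/
def orderedMonomial (M : Multiset σ) : UniversalEnvelopingAlgebra K L :=
  (M.sort.map fun i => ι K (b i)).prod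

theorem orderedMonomial_zero : orderedMonomial b 0 = 1 := by simp [orderedMonomial]

theorem orderedMonomial_cons {i : σ} {M : Multiset σ} (h : ∀ k ∈ M, i ≤ k) :
    orderedMonomial b (i ::ₘ M) = ι K (b i) * orderedMonomial b M := by
  rw [orderedMonomial, Multiset.sort_cons i M _ h, List.map_cons, List.prod_cons, orderedMonomial]

/-- The linear map from polynomials to `U(L)` that orders the factors of each monomial. -/
def orderedMap : (Multiset σ →₀ K) →ₗ[K] UniversalEnvelopingAlgebra K L :=
  Finsupp.linearCombination K (orderedMonomial b)

theorem orderedMap_single (M : Multiset σ) :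
    orderedMap b (Finsupp.single M 1) = orderedMonomial b M := by
  simp [orderedMap]

theorem orderedMap_actL_of_act {x : Multiset σ →₀ K}
    (h : ∀ i, orderedMap b (act b i x) = ι K (b i) * orderedMap b x) (X : L) :
    orderedMap b (actL b X x) = ι K X * orderedMap b x := by
  have : orderedMap b ∘ₗ (actL b).flip x =
      LinearMap.mulRight K (orderedMap b x) ∘ₗ (ι K : L →ₗ⁅K⁆ UniversalEnvelopingAlgebra K L) :=
    b.ext fun i => by simpa using h i
  exact LinearMap.congr_fun this X

theorem orderedMap_act (d : ℕ) (i : σ) {x : Multiset σ →₀ K} (hx : x ∈ degLE K σ d) :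
    orderedMap b (act b i x) = ι K (b i) * orderedMap b x := by
  induction d using Nat.strong_induction_on generalizing i x with
  | _ d ih =>
  refine supported_le_of_single_mem (N := LinearMap.eqLocus (orderedMap b ∘ₗ act b i)
    (LinearMap.mulLeft K (ι K (b i)) ∘ₗ orderedMap b)) (fun M hM => ?_) hx
  simp only [LinearMap.mem_eqLocus, LinearMap.comp_apply, LinearMap.mulLeft_apply]
  rcases forall_le_or_exists_lt_min_cons i M with h | ⟨j, N, hji, h, rfl⟩
  · rw [act_of_le b h, orderedMap_single, orderedMap_single, orderedMonomial_cons b h]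
  · have hNd : N.card < d := by simpa using hM
    have hN : Finsupp.single N 1 ∈ degLE K σ N.card := single_mem_degLE le_rfl (1 : K)
    have hiN : ∀ k ∈ i ::ₘ N, j ≤ k := Multiset.forall_mem_cons.2 ⟨hji.le, h⟩
    have map_act_act : orderedMap b (act b j (act b i (Finsupp.single N 1))) =
        ι K (b j) * orderedMap b (act b i (Finsupp.single N 1)) := by
      rw [← sub_add_cancel (act b i (Finsupp.single N 1)) (Finsupp.single (i ::ₘ N) 1)]
      simp only [map_add, mul_add]
      rw [ih _ hNd j (act_sub_mem_degLE b i N), act_of_le b hiN, orderedMap_single,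
        orderedMap_single, orderedMonomial_cons b hiN]
    rw [← act_of_le b h, act_act_of_lt_of_le b hji h, map_add, map_act_act,
      orderedMap_actL_of_act b fun i => ih _ hNd i hN, ih _ hNd i hN, ih _ hNd j hN,
      LieHom.map_lie, Ring.lie_def]
    noncomm_ring

theorem orderedMap_actL (X : L) (x : Multiset σ →₀ K) :
    orderedMap b (actL b X x) = ι K X * orderedMap b x := by
  obtain ⟨d, hd⟩ := exists_mem_degLE x
  exact orderedMap_actL_of_act b (fun i => orderedMap_act b d i hd) X

/-- The representation of `U(L)` on polynomials. -/
def rep : UniversalEnvelopingAlgebra K L →ₐ[K] Module.End K (Multiset σ →₀ K) :=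
  UniversalEnvelopingAlgebra.lift K (actHom b)

theorem rep_ι (X : L) : rep b (ι K X) = actL b X :=
  UniversalEnvelopingAlgebra.lift_ι_apply K (actHom b) X

theorem orderedMap_rep (u : UniversalEnvelopingAlgebra K L) (x : Multiset σ →₀ K) :
    orderedMap b (rep b u x) = u * orderedMap b x := by
  induction u using enveloping_induction generalizing x with
  | algebraMap c => rw [AlgHom.commutes, Module.algebraMap_end_apply, map_smul, Algebra.smul_def]
  | ι X => rw [rep_ι, orderedMap_actL]
  | mul u v hu hv => rw [map_mul, Module.End.mul_apply, hu, hv, mul_assoc]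
  | add u v hu hv => rw [map_add, LinearMap.add_apply, map_add, hu, hv, add_mul]

theorem rep_orderedMonomial (M : Multiset σ) :
    rep b (orderedMonomial b M) (Finsupp.single 0 1) = Finsupp.single M 1 := by
  induction M using multiset_induction_on_min with
  | zero => rw [orderedMonomial_zero, map_one, Module.End.one_apply]
  | cons j N hN ih =>
    rw [orderedMonomial_cons b hN, map_mul, Module.End.mul_apply, ih, rep_ι, actL_basis,
      act_of_le b hN]

theorem rep_orderedMap (x : Multiset σ →₀ K) :
    rep b (orderedMap b x) (Finsupp.single 0 1) = x := by
  induction x using Finsupp.induction_linear with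
  | zero => simp
  | add x y hx hy => simp only [map_add, LinearMap.add_apply, hx, hy]
  | single M c =>
    rw [← mul_one c, ← smul_eq_mul, ← Finsupp.smul_single, map_smul, orderedMap_single]
    simp only [map_smul, LinearMap.smul_apply, rep_orderedMonomial]

/-- The Poincaré–Birkhoff–Witt basis of `U(L)`: the ordered monomials. -/
def basis : Module.Basis (Multiset σ) K (UniversalEnvelopingAlgebra K L) :=
  .ofRepr <| .symm <| .ofBijective (orderedMap b)
    ⟨Function.LeftInverse.injective (g := fun u => rep b u (Finsupp.single 0 1))
      (rep_orderedMap b), fun u => ⟨rep b u (Finsupp.single 0 1), by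
        rw [orderedMap_rep, orderedMap_single, orderedMonomial_zero, mul_one]⟩⟩

@[simp] theorem basis_apply (M : Multiset σ) : basis b M = orderedMonomial b M :=
  orderedMap_single b M

theorem orderedMonomial_add {M N : Multiset σ} (h : ∀ i ∈ M, ∀ j ∈ N, i ≤ j) :
    orderedMonomial b (M + N) = orderedMonomial b M * orderedMonomial b N := by
  induction M using multiset_induction_on_min with
  | zero => rw [zero_add, orderedMonomial_zero, one_mul]
  | cons j M hj ih =>
    rw [Multiset.forall_mem_cons] at h
    rw [Multiset.cons_add, orderedMonomial_cons, ih h.2, orderedMonomial_cons b hj, mul_assoc]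
    intro k hk
    exact (Multiset.mem_add.1 hk).elim (hj k) (h.1 k)

theorem orderedMonomial_replicate (k : ℕ) (i : σ) :
    orderedMonomial b (Multiset.replicate k i) = ι K (b i) ^ k := by
  induction k with
  | zero => rw [Multiset.replicate_zero, orderedMonomial_zero, pow_zero]
  | succ k ih =>
    rw [Multiset.replicate_succ, orderedMonomial_cons, ih, pow_succ']
    exact fun j hj => (Multiset.eq_of_mem_replicate hj).ge

theorem commute_orderedMonomial {x : UniversalEnvelopingAlgebra K L} {M : Multiset σ}
    (h : ∀ j ∈ M, Commute x (ι K (b j))) : Commute x (orderedMonomial b M) :=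
  Commute.list_prod_right _ _ fun y hy => by
    obtain ⟨j, hj, rfl⟩ := List.mem_map.1 hy
    exact h j ((Multiset.mem_sort _).1 hj)

theorem orderedMonomial_add_replicate (k : ℕ) (i : σ) {M : Multiset σ}
    (h : ∀ j ∈ M, i < j → Commute (ι K (b i) ^ k) (ι K (b j))) :
    orderedMonomial b (M + Multiset.replicate k i) = orderedMonomial b M * ι K (b i) ^ k := by
  induction M using multiset_induction_on_min with
  | zero => rw [zero_add, orderedMonomial_zero, one_mul, orderedMonomial_replicate]
  | cons j M hj ih =>
    rcases le_or_gt j i with hji | hij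
    · rw [Multiset.cons_add, orderedMonomial_cons,
        ih fun l hl => h l (Multiset.mem_cons_of_mem hl), orderedMonomial_cons b hj, mul_assoc]
      intro l hl
      exact (Multiset.mem_add.1 hl).elim (hj l) fun hl => Multiset.eq_of_mem_replicate hl ▸ hji
    · have hi : ∀ l ∈ j ::ₘ M, i < l :=
        Multiset.forall_mem_cons.2 ⟨hij, fun l hl => hij.trans_le (hj l hl)⟩
      rw [add_comm, orderedMonomial_add, orderedMonomial_replicate]
      · exact commute_orderedMonomial b fun l hl => h l hl (hi l hl)
      · exact fun l hl m hm => (Multiset.eq_of_mem_replicate hl).symm ▸ (hi m hm).le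

section GradedBasis

variable {Γ : Type*} [AddCommMonoid Γ] {P : Set σ} {wt : σ → Γ}

/-- The span of the `b i` with `i ∈ P` is a subalgebra graded by the weights `wt i` of the `b i`. -/
def IsGradedBasisOn (P : Set σ) (wt : σ → Γ) : Prop :=
  ∀ i ∈ P, ∀ j ∈ P, ∀ k, b.repr ⁅b i, b j⁆ k ≠ 0 → k ∈ P ∧ wt k = wt i + wt j

theorem act_mem_supported_multisetsOfWeight (hP : IsGradedBasisOn b P wt) (d : ℕ) {i : σ}
    (hi : i ∈ P) {γ : Γ} {x : Multiset σ →₀ K} (hxd : x ∈ degLE K σ d)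
    (hxγ : x ∈ Finsupp.supported K K (multisetsOfWeight P wt γ)) :
    act b i x ∈ Finsupp.supported K K (multisetsOfWeight P wt (wt i + γ)) := by
  induction d using Nat.strong_induction_on generalizing i γ x with
  | _ d ih =>
  have hx : x ∈ Finsupp.supported K K ({M | M.card ≤ d} ∩ multisetsOfWeight P wt γ) := by
    rw [Finsupp.supported_inter]
    exact ⟨hxd, hxγ⟩
  refine supported_le_of_single_mem (N := (Finsupp.supported K K _).comap (act b i))
    (fun M hM => ?_) hx
  obtain ⟨hMd, hMP, hMγ⟩ := hM
  rw [Submodule.mem_comap]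
  rcases forall_le_or_exists_lt_min_cons i M with h | ⟨j, N, hji, h, rfl⟩
  · rw [act_of_le b h]
    exact Finsupp.single_mem_supported K _ (cons_mem_multisetsOfWeight hi ⟨hMP, hMγ⟩)
  have hNd : N.card < d := by simpa using hMd
  obtain ⟨hj, hNP⟩ := Multiset.forall_mem_cons.1 hMP
  have hN : N ∈ multisetsOfWeight P wt (N.map wt).sum := ⟨hNP, rfl⟩
  have hiN := cons_mem_multisetsOfWeight hi hN
  have single_degLE : Finsupp.single N 1 ∈ degLE K σ N.card := single_mem_degLE le_rfl (1 : K)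
  have single_wt := Finsupp.single_mem_supported K (1 : K) hN
  rw [Multiset.map_cons, Multiset.sum_cons] at hMγ
  rw [← act_of_le b h, act_act_of_lt_of_le b hji h, ← hMγ]
  refine add_mem ?_ ?_
  · rw [← sub_add_cancel (act b i (Finsupp.single N 1)) (Finsupp.single (i ::ₘ N) 1), map_add,
      add_left_comm, act_of_le b (Multiset.forall_mem_cons.2 ⟨hji.le, h⟩)]
    exact add_mem (ih _ hNd hj (act_sub_mem_degLE b i N) (sub_mem (ih _ hNd hi single_degLE
      single_wt) (Finsupp.single_mem_supported K _ hiN)))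
      (Finsupp.single_mem_supported K _ (cons_mem_multisetsOfWeight hj hiN))
  · rw [actL_apply, ← add_assoc]
    refine Submodule.sum_mem _ fun k hk => Submodule.smul_mem _ _ ?_
    obtain ⟨hkP, hkwt⟩ := hP i hi j hj k (Finsupp.mem_support_iff.1 hk)
    exact hkwt ▸ ih _ hNd hkP single_degLE single_wt

theorem ι_mul_orderedMonomial_mem_span (hP : IsGradedBasisOn b P wt) {i : σ} (hi : i ∈ P) {γ : Γ}
    {M : Multiset σ} (hM : M ∈ multisetsOfWeight P wt γ) :
    ι K (b i) * orderedMonomial b M ∈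
      Submodule.span K (orderedMonomial b '' multisetsOfWeight P wt (wt i + γ)) := by
  have h := Submodule.mem_map_of_mem (f := orderedMap b) <|
    act_mem_supported_multisetsOfWeight b hP M.card hi (single_mem_degLE le_rfl 1)
      (Finsupp.single_mem_supported K 1 hM)
  rw [Finsupp.supported_eq_span_single, Submodule.map_span, ← Set.image_comp] at h
  rw [← orderedMap_single, ← orderedMap_actL, actL_basis]
  simpa only [Function.comp_def, orderedMap_single] using h

end GradedBasis

end PBW

/-! ### Lie algebras of algebraic groups in characteristic `p` -/

section CharP

variable (K : Type*) [Field K] (p : ℕ) [Fact p.Prime] [CharP K p]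

theorem mul_sub_mul_iterate_char {A : Type*} [Ring A] [Algebra K A] (x y : A) :
    (fun z => x * z - z * x)^[p] y = x ^ p * y - y * x ^ p := by
  nontriviality A
  have : CharP (Module.End K A) p :=
    charP_of_injective_algebraMap (algebraMap K (Module.End K A)).injective p
  have h := LinearMap.congr_fun (sub_pow_char_of_commute (p := p)
    (LinearMap.commute_mulLeft_right (R := K) x x)) y
  rwa [LinearMap.pow_mulLeft, LinearMap.pow_mulRight, Module.End.pow_apply] at h

variable {K}

/-- The commutator of `D` and multiplication by `f` is multiplication by `D f`, and taking
commutators with `D` a total of `p` times is taking the commutator with `D ^ p`. -/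
theorem derivation_iterate_char_mul {A : Type*} [CommRing A] [Algebra K A] (D : Derivation K A A)
    (f g : A) : D^[p] (f * g) = f * D^[p] g + g * D^[p] f := by
  have iterate_mulLeft (k : ℕ) :
      (fun z : Module.End K A => (D : Module.End K A) * z - z * (D : Module.End K A))^[k]
        (LinearMap.mulLeft K f) = LinearMap.mulLeft K (D^[k] f) := by
    induction k with
    | zero => rfl
    | succ k ih =>
      rw [Function.iterate_succ_apply', ih, Function.iterate_succ_apply']
      ext z
      simp [mul_comm]
  have h := LinearMap.congr_fun
    (mul_sub_mul_iterate_char K p (D : Module.End K A) (LinearMap.mulLeft K f)) g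
  simp only [iterate_mulLeft, LinearMap.sub_apply, Module.End.mul_apply, LinearMap.mulLeft_apply,
    Module.End.pow_apply, Derivation.coeFn_coe] at h
  rw [← sub_eq_iff_eq_add', ← h, mul_comm]

end CharP

section AlgebraicGroups

variable {K : Type u} [Field K] {n : ℕ}

@[simp] theorem evalAt_add (f g : Coord n K) (x : GL (Fin n) K) :
    evalAt (f + g) x = evalAt f x + evalAt g x := by simp [evalAt]

@[simp] theorem evalAt_sub (f g : Coord n K) (x : GL (Fin n) K) :
    evalAt (f - g) x = evalAt f x - evalAt g x := by simp [evalAt]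

@[simp] theorem evalAt_neg (f : Coord n K) (x : GL (Fin n) K) :
    evalAt (-f) x = -evalAt f x := by simp [evalAt]

@[simp] theorem evalAt_mul (f g : Coord n K) (x : GL (Fin n) K) :
    evalAt (f * g) x = evalAt f x * evalAt g x := by simp [evalAt]

@[simp] theorem evalAt_sum {κ : Type*} (s : Finset κ) (f : κ → Coord n K) (x : GL (Fin n) K) :
    evalAt (∑ i ∈ s, f i) x = ∑ i ∈ s, evalAt (f i) x := by simp [evalAt]

@[simp] theorem evalAt_C (c : K) (x : GL (Fin n) K) : evalAt (MvPolynomial.C c) x = c := by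
  simp [evalAt]

@[simp] theorem evalAt_inl (i j : Fin n) (x : GL (Fin n) K) :
    evalAt (MvPolynomial.X (Sum.inl (i, j))) x = (x : Matrix (Fin n) (Fin n) K) i j := by
  simp [evalAt]

@[simp] theorem evalAt_inr (i j : Fin n) (x : GL (Fin n) K) :
    evalAt (MvPolynomial.X (Sum.inr (i, j))) x =
      ((x⁻¹ : GL (Fin n) K) : Matrix (Fin n) (Fin n) K) i j := by
  simp [evalAt]

theorem leftDer_C (x : Matrix (Fin n) (Fin n) K) (c : K) :
    leftDer x (MvPolynomial.C c) = 0 := by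
  rw [← MvPolynomial.algebraMap_eq, Derivation.map_algebraMap]

section Torus

variable {T : Subgroup (GL (Fin n) K)}

theorem evalAt_leftDer_one {y : Matrix (Fin n) (Fin n) K} (hy : y ∈ lieAlg T) {f : Coord n K}
    (hf : ∀ t ∈ T, evalAt f t = 0) : evalAt (leftDer y f) 1 = 0 :=
  hy f hf 1 T.one_mem

theorem commute_of_mem_lieAlg {y z : Matrix (Fin n) (Fin n) K} (hy : y ∈ lieAlg T)
    (hz : ∀ t ∈ T, Commute z t.val) : Commute z y := by
  ext i j
  have vanishes : ∀ t ∈ T, evalAt (∑ k, MvPolynomial.C (z i k) * MvPolynomial.X (Sum.inl (k, j)) -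
      ∑ k, MvPolynomial.C (z k j) * MvPolynomial.X (Sum.inl (i, k))) t = 0 := fun t ht => by
    have h := congrFun₂ (hz t ht).eq i j
    simp only [Matrix.mul_apply] at h
    simp only [evalAt_sub, evalAt_sum, evalAt_mul, evalAt_C, evalAt_inl, h, mul_comm, sub_self]
  have h := evalAt_leftDer_one hy vanishes
  simp only [map_sub, map_sum, leftDer_C_mul, leftDer_inl, evalAt_sub, evalAt_sum, evalAt_mul,
    evalAt_C, evalAt_inl, Units.val_one, Matrix.one_apply, mul_ite, mul_one, mul_zero,
    Finset.sum_ite_eq, Finset.mem_univ, if_true, sub_eq_zero] at h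
  rw [Matrix.mul_apply, Matrix.mul_apply, h]
  exact Finset.sum_congr rfl fun _ _ => mul_comm _ _

theorem IsTorus.commute (hT : IsTorus T) {s t : GL (Fin n) K} (hs : s ∈ T) (ht : t ∈ T) :
    Commute s t := by
  obtain ⟨-, -, c, hc⟩ := hT
  have conj_commute : c * s * c⁻¹ * (c * t * c⁻¹) = c * t * c⁻¹ * (c * s * c⁻¹) := by
    apply Units.ext
    rw [Units.val_mul (c * s * c⁻¹), Units.val_mul (c * t * c⁻¹), ← (hc s hs).diagonal_diag,
      ← (hc t ht).diagonal_diag, Matrix.diagonal_mul_diagonal, Matrix.diagonal_mul_diagonal]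
    simp only [mul_comm]
  exact (mul_left_inj c⁻¹).1 (by simpa [mul_assoc] using conj_commute)

theorem IsTorus.commute_of_mem_lieAlg (hT : IsTorus T) {y z : Matrix (Fin n) (Fin n) K}
    (hy : y ∈ lieAlg T) (hz : z ∈ lieAlg T) : Commute y z :=
  GradedLevi.commute_of_mem_lieAlg hz fun _ ht =>
    (GradedLevi.commute_of_mem_lieAlg hy fun _ hs => (hT.commute ht hs).map (Units.coeHom _)).symm

namespace CharLattice

theorem val_eq_evalAt_rep (μ : CharLattice T) (t : T) :
    (μ.val t : K) = evalAt μ.rep (t : GL (Fin n) K) :=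
  (Additive.toMul (α := charSubgroup T) μ).2.choose_spec t

theorem val_add (μ ν : CharLattice T) (t : T) : (μ + ν).val t = μ.val t * ν.val t := rfl

theorem val_zero (t : T) : (0 : CharLattice T).val t = 1 := rfl

theorem val_nsmul (k : ℕ) (μ : CharLattice T) (t : T) : (k • μ).val t = μ.val t ^ k := by
  induction k with
  | zero => rw [zero_smul, val_zero, pow_zero]
  | succ k ih => rw [succ_nsmul, val_add, ih, pow_succ]

theorem ext_val {μ ν : CharLattice T} (h : ∀ t, (μ.val t : K) = ν.val t) : μ = ν :=
  Additive.toMul.injective (Subtype.ext (MonoidHom.ext fun t => Units.ext (h t)))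

theorem evalAt_rep_one (μ : CharLattice T) : evalAt μ.rep 1 = 1 := by
  simpa [val] using (μ.val_eq_evalAt_rep 1).symm

theorem differential_add (μ ν : CharLattice T) {y : Matrix (Fin n) (Fin n) K}
    (hy : y ∈ lieAlg T) : (μ + ν).differential y = μ.differential y + ν.differential y := by
  have vanishes : ∀ t ∈ T, evalAt ((μ + ν).rep - μ.rep * ν.rep) t = 0 := fun t ht => by
    simp only [evalAt_sub, evalAt_mul, ← val_eq_evalAt_rep _ ⟨t, ht⟩, val_add, Units.val_mul,
      sub_self]
  have h := evalAt_leftDer_one hy vanishes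
  simp only [map_sub, Derivation.leibniz, evalAt_sub, evalAt_add, smul_eq_mul, evalAt_mul,
    evalAt_rep_one, one_mul, sub_eq_zero] at h
  exact h.trans (add_comm _ _)

end CharLattice

end Torus

section WeightSpace

variable {G T : Subgroup (GL (Fin n) K)} {α β : CharLattice T} {x y : Matrix (Fin n) (Fin n) K}

theorem mul_sub_mul_of_mem_weightSpace (hx : x ∈ weightSpace G T α) (hy : y ∈ lieAlg T) :
    y * x - x * y = α.differential y • x := by
  ext i j
  have vanishes : ∀ t ∈ T, evalAt (∑ k, ∑ l, MvPolynomial.C (x k l) *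
        (MvPolynomial.X (Sum.inl (i, k)) * MvPolynomial.X (Sum.inr (l, j))) -
      MvPolynomial.C (x i j) * α.rep) t = 0 := fun t ht => by
    have h := congrFun₂ (hx.2 ⟨t, ht⟩) i j
    simp only [Matrix.mul_apply, Matrix.smul_apply, smul_eq_mul, Finset.sum_mul] at h
    simp only [evalAt_sub, evalAt_sum, evalAt_mul, evalAt_C, evalAt_inl, evalAt_inr,
      ← CharLattice.val_eq_evalAt_rep α ⟨t, ht⟩]
    rw [mul_comm (x i j), ← h, sub_eq_zero, Finset.sum_comm]
    exact Finset.sum_congr rfl fun _ _ => Finset.sum_congr rfl fun _ _ => by ring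
  have h := evalAt_leftDer_one hy vanishes
  simp only [map_sub, map_sum, leftDer_C, Derivation.leibniz, leftDer_inl, leftDer_inr, add_zero,
    evalAt_sub, evalAt_sum, evalAt_mul, evalAt_add, evalAt_neg, smul_eq_mul,
    evalAt_C, evalAt_inl, evalAt_inr, inv_one, Units.val_one, Matrix.one_apply, mul_ite, mul_one,
    mul_zero, ite_mul, one_mul, zero_mul, mul_add, Finset.sum_ite_eq, Finset.sum_ite_eq',
    Finset.sum_add_distrib, Finset.mem_univ, if_true, sub_eq_zero] at h
  rw [Matrix.sub_apply, Matrix.mul_apply, Matrix.mul_apply, Matrix.smul_apply, smul_eq_mul,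
    mul_comm _ (x i j)]
  refine Eq.trans ?_ h
  rw [Finset.sum_comm]
  simp only [Finset.sum_ite_eq, Finset.mem_univ, if_true, mul_neg, Finset.sum_neg_distrib,
    mul_comm (y i _)]
  abel

theorem lie_mem_weightSpace (hx : x ∈ weightSpace G T α) (hy : y ∈ weightSpace G T β) :
    ⁅x, y⁆ ∈ weightSpace G T (α + β) := by
  refine ⟨(lieAlg G).lie_mem hx.1 hy.1, fun t => ?_⟩
  have conj_mul (a b : Matrix (Fin n) (Fin n) K) : t.1.1 * (a * b) * (t.1⁻¹).1 =
      (t.1.1 * a * (t.1⁻¹).1) * (t.1.1 * b * (t.1⁻¹).1) := by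
    simp only [mul_assoc, Units.inv_mul_cancel_left]
  rw [Ring.lie_def, mul_sub, sub_mul, conj_mul, conj_mul, hx.2, hy.2, CharLattice.val_add,
    Units.val_mul, smul_mul_smul_comm, smul_mul_smul_comm, smul_sub, mul_comm (β.val t : K)]

end WeightSpace

section PthPower

theorem leftDer_iterate_inl (x : Matrix (Fin n) (Fin n) K) (k : ℕ) (i j : Fin n) :
    (leftDer x)^[k] (MvPolynomial.X (Sum.inl (i, j))) =
      ∑ l, MvPolynomial.C ((x ^ k) l j) * MvPolynomial.X (Sum.inl (i, l)) := by
  induction k with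
  | zero => simp [Matrix.one_apply]
  | succ k ih =>
    rw [Function.iterate_succ_apply', ih]
    simp only [map_sum, leftDer_C_mul, leftDer_inl, pow_succ', Matrix.mul_apply, map_mul,
      Finset.sum_mul, Finset.mul_sum]
    rw [Finset.sum_comm]
    exact Finset.sum_congr rfl fun _ _ => Finset.sum_congr rfl fun _ _ => by ring

theorem leftDer_iterate_inr (x : Matrix (Fin n) (Fin n) K) (k : ℕ) (i j : Fin n) :
    (leftDer x)^[k] (MvPolynomial.X (Sum.inr (i, j))) =
      (-1) ^ k * ∑ l, MvPolynomial.C ((x ^ k) i l) * MvPolynomial.X (Sum.inr (l, j)) := by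
  induction k with
  | zero => simp [Matrix.one_apply]
  | succ k ih =>
    have neg_one_pow_eq_C : (-1 : Coord n K) ^ k = MvPolynomial.C ((-1) ^ k) := by simp
    rw [Function.iterate_succ_apply', ih, neg_one_pow_eq_C, leftDer_C_mul, ← neg_one_pow_eq_C]
    simp only [map_sum, leftDer_C_mul, leftDer_inr, pow_succ, Matrix.mul_apply, map_mul,
      Finset.sum_mul, Finset.mul_sum, mul_neg, Finset.sum_neg_distrib, mul_one, neg_mul]
    rw [Finset.sum_comm]
    exact congrArg _ (Finset.sum_congr rfl fun _ _ => Finset.sum_congr rfl fun _ _ => by ring)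

variable (p : ℕ) [Fact p.Prime] [CharP K p]

theorem leftDer_pow_char (x : Matrix (Fin n) (Fin n) K) (f : Coord n K) :
    leftDer (x ^ p) f = (leftDer x)^[p] f := by
  let D : Derivation K (Coord n K) (Coord n K) :=
    Derivation.mk' ((leftDer x : Module.End K (Coord n K)) ^ p) fun a b => by
      simp only [Module.End.pow_apply]
      exact derivation_iterate_char_mul p (leftDer x) a b
  have D_apply (f : Coord n K) : D f = (leftDer x)^[p] f := Module.End.pow_apply _ _ _
  suffices leftDer (x ^ p) = D by rw [this, D_apply]
  refine MvPolynomial.derivation_ext ?_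
  rintro (⟨i, j⟩ | ⟨i, j⟩)
  · rw [D_apply, leftDer_iterate_inl, leftDer_inl]
  · rw [D_apply, leftDer_iterate_inr, leftDer_inr, neg_one_pow_char, neg_one_mul]

theorem pow_char_mem_lieAlg {G : Subgroup (GL (Fin n) K)} {x : Matrix (Fin n) (Fin n) K}
    (hx : x ∈ lieAlg G) : x ^ p ∈ lieAlg G := fun f hf => by
  have iterate_mem (k : ℕ) : (leftDer x)^[k] f ∈ vanishingIdeal G := by
    induction k with
    | zero => exact hf
    | succ k ih => exact Function.iterate_succ_apply' (leftDer x) k f ▸ hx _ ih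
  exact leftDer_pow_char p x f ▸ iterate_mem p

theorem pow_char_mem_weightSpace {G T : Subgroup (GL (Fin n) K)} {α : CharLattice T}
    {x : Matrix (Fin n) (Fin n) K} (hx : x ∈ weightSpace G T α) :
    x ^ p ∈ weightSpace G T (p • α) := by
  refine ⟨pow_char_mem_lieAlg p hx.1, fun t => ?_⟩
  rw [← Units.conj_pow, hx.2, smul_pow, CharLattice.val_nsmul, Units.val_pow_eq_pow_val]

end PthPower

end AlgebraicGroups

namespace ReductiveGroup

/-! ### The Lie algebra of a reductive group -/

section LieBasis

variable {K : Type u} [Field K] {p : ℕ} (S : ReductiveGroup K p)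

/-- The index set of the basis of `𝔤`, as a type of its own: it carries the order for which PBW
monomials are formed, negative roots first, then positive roots, then the torus. -/
inductive BasisIndex : Type u
  | root (α : S.R)
  | torus (i : Fin S.d)

/-- The identification of `BasisIndex` with the index set of `ReductiveGroup.basis`. -/
def basisIndexEquiv : S.R ⊕ Fin S.d ≃ S.BasisIndex where
  toFun := Sum.elim .root .torus
  invFun
    | .root α => .inl α
    | .torus i => .inr i
  left_inv := by rintro (_ | _) <;> rfl
  right_inv := by rintro (_ | _) <;> rfl

/-- The basis of `𝔤` fixed in `S`, indexed by `BasisIndex`. -/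
def lieBasis : Module.Basis S.BasisIndex K S.g := S.basis.reindex S.basisIndexEquiv

theorem lieBasis_root (α : S.R) : S.lieBasis (.root α) = S.e α :=
  S.basis.reindex_apply S.basisIndexEquiv _

theorem basis_inr_mem_h (i : Fin S.d) : S.basis (Sum.inr i) ∈ S.h := by
  have h : (S.basis (Sum.inr i) : Matrix (Fin S.n) (Fin S.n) K) ∈ (lieAlg S.T).toSubmodule :=
    S.span_basis_torus ▸ Submodule.subset_span ⟨i, rfl⟩
  exact h

/-- The basis vectors `h_1, …, h_d` of `𝔥`. -/
def torusBasis (i : Fin S.d) : S.h := ⟨S.basis (Sum.inr i), S.basis_inr_mem_h i⟩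

theorem lieBasis_torus (i : Fin S.d) : S.lieBasis (.torus i) = S.torusBasis i :=
  S.basis.reindex_apply S.basisIndexEquiv _

theorem span_range_torusBasis : Submodule.span K (Set.range S.torusBasis) = ⊤ := by
  let toMatrix : S.h →ₗ[K] Matrix (Fin S.n) (Fin S.n) K :=
    (lieAlg S.G).toSubmodule.subtype ∘ₗ S.h.toSubmodule.subtype
  have toMatrix_injective : Function.Injective toMatrix :=
    Subtype.val_injective.comp Subtype.val_injective
  refine Submodule.map_injective_of_injective toMatrix_injective (le_antisymm
    (Submodule.map_mono le_top) ?_)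
  have map_span : (Submodule.span K (Set.range S.torusBasis)).map toMatrix =
      (lieAlg S.T).toSubmodule := by
    rw [Submodule.map_span, ← Set.range_comp, ← S.span_basis_torus]
    rfl
  rw [map_span]
  rintro _ ⟨x, -, rfl⟩
  exact x.2

instance : Finite S.BasisIndex := Module.Finite.finite_basis S.lieBasis

instance : Finite S.R := Finite.of_injective BasisIndex.root fun _ _ h => BasisIndex.root.inj h

instance : Fintype S.R := Fintype.ofFinite _

open Classical in
/-- The position of a basis vector in the order of `BasisIndex`: `0` for a negative root, `1` for
a positive root and `2` for the torus. -/
def block : S.BasisIndex → ℕ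
  | .root α => if S.IsPos α then 1 else 0
  | .torus _ => 2

instance : LinearOrder S.BasisIndex :=
  LinearOrder.lift' (fun i => toLex (S.block i, (exists_injective_nat S.BasisIndex).choose i))
    fun _ _ h => (exists_injective_nat S.BasisIndex).choose_spec
      (congrArg (fun x => (ofLex x).2) h)

variable {S}

theorem lt_of_block_lt {i j : S.BasisIndex} (h : S.block i < S.block j) : i < j :=
  Prod.Lex.toLex_lt_toLex.2 (Or.inl h)

theorem root_lt_torus (α : S.R) (i : Fin S.d) : BasisIndex.root α < .torus i := by
  refine lt_of_block_lt ?_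
  rw [block, block]
  split_ifs <;> decide

theorem root_lt_root {α β : S.R} (hα : ¬ S.IsPos α) (hβ : S.IsPos β) :
    BasisIndex.root α < .root β := by
  refine lt_of_block_lt ?_
  rw [block, block, if_neg hα, if_pos hβ]
  exact zero_lt_one

end LieBasis

section Weights

variable {K : Type u} [Field K] {p : ℕ} (S : ReductiveGroup K p)

/-- The weight in `X` of a basis vector of `𝔤`. -/
def weight : S.BasisIndex → S.X
  | .root α => α.1
  | .torus _ => 0

@[simp] theorem weight_root (α : S.R) : S.weight (.root α) = α.1 := rfl

@[simp] theorem weight_torus (i : Fin S.d) : S.weight (.torus i) = 0 := rfl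

theorem isTorus : IsTorus S.T := S.isMaximalTorus.2.1

theorem mem_weightSpace_zero_of_mem_lieAlg {x : Matrix (Fin S.n) (Fin S.n) K} (hx : x ∈ lieAlg S.T)
    (hxG : x ∈ lieAlg S.G) : x ∈ weightSpace S.G S.T 0 := by
  refine ⟨hxG, fun t => ?_⟩
  have h : Commute (t : GL (Fin S.n) K).val x := commute_of_mem_lieAlg hx fun _ hs =>
    (S.isTorus.commute t.2 hs).map (Units.coeHom _)
  rw [h.eq, Units.mul_inv_cancel_right, CharLattice.val_zero, Units.val_one, one_smul]

theorem lieBasis_mem_weightSpace (i : S.BasisIndex) :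
    (S.lieBasis i : Matrix (Fin S.n) (Fin S.n) K) ∈ weightSpace S.G S.T (S.weight i) := by
  cases i with
  | root α => exact S.lieBasis_root α ▸ S.basis_root α
  | torus i =>
    rw [lieBasis_torus]
    exact S.mem_weightSpace_zero_of_mem_lieAlg (S.torusBasis i).2 (S.torusBasis i).1.2

theorem weight_eq_of_repr_ne_zero {x : S.g} {γ : S.X}
    (hx : (x : Matrix (Fin S.n) (Fin S.n) K) ∈ weightSpace S.G S.T γ) {i : S.BasisIndex}
    (hi : S.lieBasis.repr x i ≠ 0) : S.weight i = γ := by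
  have := Fintype.ofFinite S.BasisIndex
  refine CharLattice.ext_val fun t => ?_
  have expansion : (x : Matrix (Fin S.n) (Fin S.n) K) =
      ∑ j, S.lieBasis.repr x j • (S.lieBasis j : Matrix (Fin S.n) (Fin S.n) K) := by
    simpa only [map_sum, map_smul, Submodule.subtype_apply] using
      (congrArg (lieAlg S.G).toSubmodule.subtype (S.lieBasis.sum_repr x)).symm
  have relation :
      ∑ j, (S.lieBasis.repr x j * ((S.weight j).val t - γ.val t : K)) • S.lieBasis j = 0 := by
    apply Subtype.ext
    have h := hx.2 t
    rw [expansion, Finset.mul_sum, Finset.sum_mul, Finset.smul_sum, ← sub_eq_zero,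
      ← Finset.sum_sub_distrib] at h
    rw [AddSubmonoidClass.coe_finsetSum, ZeroMemClass.coe_zero, ← h]
    refine Finset.sum_congr rfl fun j _ => ?_
    rw [Matrix.mul_smul, Matrix.smul_mul, (S.lieBasis_mem_weightSpace j).2 t, smul_smul, smul_smul,
      ← sub_smul, mul_sub, mul_comm (γ.val t : K)]
    rfl
  have coeff := Fintype.linearIndependent_iff.1 S.lieBasis.linearIndependent _ relation i
  exact sub_eq_zero.1 ((mul_eq_zero.1 coeff).resolve_left hi)

theorem weight_of_repr_lie_ne_zero {i j k : S.BasisIndex}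
    (h : S.lieBasis.repr ⁅S.lieBasis i, S.lieBasis j⁆ k ≠ 0) :
    S.weight k = S.weight i + S.weight j := by
  refine S.weight_eq_of_repr_ne_zero ?_ h
  rw [LieSubalgebra.coe_bracket]
  exact lie_mem_weightSpace (S.lieBasis_mem_weightSpace i) (S.lieBasis_mem_weightSpace j)

theorem lie_torus (x y : S.h) : ⁅(x : S.g), (y : S.g)⁆ = 0 := by
  apply Subtype.ext
  rw [LieSubalgebra.coe_bracket, Ring.lie_def]
  exact sub_eq_zero.2 (S.isTorus.commute_of_mem_lieAlg x.2 y.2).eq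

theorem lie_lieBasis (x : S.h) (i : S.BasisIndex) :
    ⁅(x : S.g), S.lieBasis i⁆ = S.diff (S.weight i) x • S.lieBasis i := by
  apply Subtype.ext
  rw [LieSubalgebra.coe_bracket, Ring.lie_def]
  exact mul_sub_mul_of_mem_weightSpace (S.lieBasis_mem_weightSpace i) x.2

end Weights

section Differential

variable {K : Type u} [Field K] {p : ℕ} (S : ReductiveGroup K p)

/-- The differential of characters as a homomorphism of groups. -/
def diffHom : S.X →+ Module.Dual K S.h :=
  AddMonoidHom.mk' S.diff fun μ ν =>
    LinearMap.ext fun x => CharLattice.differential_add μ ν x.2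

theorem diff_add (μ ν : S.X) : S.diff (μ + ν) = S.diff μ + S.diff ν := map_add S.diffHom μ ν

theorem diff_zero : S.diff 0 = 0 := map_zero S.diffHom

theorem diff_sub (μ ν : S.X) : S.diff (μ - ν) = S.diff μ - S.diff ν := map_sub S.diffHom μ ν

theorem diff_p_smul [CharP K p] (μ : S.X) : S.diff (p • μ) = 0 := by
  rw [show S.diff (p • μ) = p • S.diff μ from map_nsmul S.diffHom p μ]
  ext x
  simp

end Differential

section PthPowers

variable {K : Type u} [Field K] {p : ℕ} [Fact p.Prime] (S : ReductiveGroup K p)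

theorem weight_ne_p_smul_root (i : S.BasisIndex) (α : S.R) : S.weight i ≠ p • α.1 := by
  have := S.isReduced
  have : Module.IsReflexive ℤ S.X := .of_isPerfPair S.rootDatum.toLinearMap
  have : IsAddTorsionFree S.X := Module.isTorsionFree_int_iff_isAddTorsionFree.1 inferInstance
  have : p.AtLeastTwo := ⟨(Fact.out : p.Prime).two_le⟩
  rw [← S.root_apply]
  cases i with
  | root β => exact fun h => S.rootDatum.nsmul_notMem_range_root ⟨β, (S.root_apply β).trans h⟩
  | torus i => exact (smul_ne_zero (NeZero.ne p) (S.rootDatum.ne_zero α)).symm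

variable [CharP K p]

theorem e_pow_char (α : S.R) : (S.e α : Matrix (Fin S.n) (Fin S.n) K) ^ p = 0 := by
  have h := pow_char_mem_weightSpace p (S.basis_root α)
  let x : S.g := ⟨(S.e α : Matrix (Fin S.n) (Fin S.n) K) ^ p, h.1⟩
  suffices hx : x = 0 from congrArg Subtype.val hx
  refine S.lieBasis.ext_elem fun i => ?_
  rw [map_zero, Finsupp.zero_apply]
  by_contra hi
  exact S.weight_ne_p_smul_root i α (S.weight_eq_of_repr_ne_zero (x := x) h hi)

theorem lie_e_iterate_char (α : S.R) (y : S.g) : (fun z => ⁅S.e α, z⁆)^[p] y = 0 := by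
  apply Subtype.ext
  have h : Function.Semiconj (Subtype.val : S.g → _) (fun z => ⁅S.e α, z⁆)
      (fun z => (S.e α).1 * z - z * (S.e α).1) := fun z => by
    rw [LieSubalgebra.coe_bracket, Ring.lie_def]
  rw [h.iterate_right p y, mul_sub_mul_iterate_char K p, S.e_pow_char, zero_mul, mul_zero,
    sub_zero]
  rfl

theorem commute_e_pow (α : S.R) (u : UniversalEnvelopingAlgebra K S.g) :
    Commute (ι K (S.e α) ^ p) u := by
  induction u using PBW.enveloping_induction with
  | algebraMap c => exact Algebra.commute_algebraMap_right c _
  | mul u v hu hv => exact hu.mul_right hv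
  | add u v hu hv => exact hu.add_right hv
  | ι y =>
    have h : Function.Semiconj (ι K) (fun z => ⁅S.e α, z⁆)
        (fun z => ι K (S.e α) * z - z * ι K (S.e α)) := fun z => by
      rw [LieHom.map_lie, Ring.lie_def]
    have := mul_sub_mul_iterate_char K p (ι K (S.e α)) (ι K y)
    rw [← h.iterate_right p y, S.lie_e_iterate_char, map_zero] at this
    exact sub_eq_zero.1 this.symm

end PthPowers

/-! ### Positive roots -/

section Positive

variable {K : Type u} [Field K] {p : ℕ} (S : ReductiveGroup K p)

variable {S}

theorem IsPos.base_isPos {α : S.R} (h : S.IsPos α) : S.base.IsPos α := by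
  rw [IsPos, ← Submodule.span_nat_eq_addSubmonoidClosure, Submodule.mem_toAddSubmonoid,
    Submodule.mem_span_image_finset_iff_exists_fun'] at h
  obtain ⟨f, hf⟩ := h
  rw [RootPairing.Base.isPos_iff', RootPairing.Base.height_eq_sum (f := fun j => (f j : ℤ))
    (by simpa only [natCast_zsmul] using hf.symm)]
  exact Finset.sum_nonneg fun _ _ => Int.natCast_nonneg _

theorem isPos_or_exists_eq_neg (α : S.R) : S.IsPos α ∨ ∃ β : S.R, S.IsPos β ∧ α.1 = -β.1 := by
  refine (S.base.root_mem_or_neg_mem α).imp_right fun h => ?_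
  have neg_root : S.rootDatum.root (S.rootDatum.reflectionPerm α α) = -S.rootDatum.root α := by
    simp
  refine ⟨S.rootDatum.reflectionPerm α α, ?_, ?_⟩
  · rwa [IsPos, neg_root]
  · rw [← S.root_apply, ← S.root_apply, neg_root, neg_neg]

variable (S)

/-- The indices of the positive root vectors. -/
def posIndices : Set S.BasisIndex := {i | ∃ α, S.IsPos α ∧ i = .root α}

/-- The height of a basis vector: that of its root, and `0` on the torus. -/
def height : S.BasisIndex → ℤ
  | .root α => S.base.height α
  | .torus _ => 0

variable {S}

theorem height_pos {i : S.BasisIndex} (hi : i ∈ S.posIndices) : 0 < S.height i := by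
  obtain ⟨α, hα, rfl⟩ := hi
  exact hα.base_isPos

theorem add_ne_zero_of_isPos {α β : S.R} (hα : S.IsPos α) (hβ : S.IsPos β) : α.1 + β.1 ≠ 0 := by
  intro h
  have root_eq : S.rootDatum.root β = S.rootDatum.root α + (-2 : ℤ) • S.rootDatum.root α := by
    have : S.rootDatum.root β = -S.rootDatum.root α := by
      rw [S.root_apply, S.root_apply]
      exact eq_neg_of_add_eq_zero_right h
    rw [this]
    module
  have height_eq := S.base.height_add_zsmul root_eq
  have height_pos_α : 0 < S.base.height α := hα.base_isPos
  have height_pos_β : 0 < S.base.height β := hβ.base_isPos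
  rw [smul_eq_mul] at height_eq
  lia

theorem isGradedBasisOn_posIndices :
    PBW.IsGradedBasisOn S.lieBasis S.posIndices S.height := by
  rintro _ ⟨α, hα, rfl⟩ _ ⟨β, hβ, rfl⟩ k hk
  have hw := S.weight_of_repr_lie_ne_zero hk
  cases k with
  | root γ =>
    have hγ : S.rootDatum.root γ = S.rootDatum.root α + S.rootDatum.root β := by
      rw [S.root_apply, S.root_apply, S.root_apply]
      exact hw
    refine ⟨⟨γ, ?_, rfl⟩, S.base.height_add hγ⟩
    rw [IsPos, hγ]
    exact add_mem hα hβ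
  | torus i => exact absurd hw.symm (add_ne_zero_of_isPos hα hβ)

end Positive

section Levi

variable {K : Type u} [Field K] {p : ℕ} {S : ReductiveGroup K p} {χ : Module.Dual K S.g}
  {I : Set S.R}

theorem chi_e_of_isPos (hχ : S.IsStandardLeviForm χ I) {α : S.R} (h : S.IsPos α) :
    χ (S.e α) = 0 :=
  hχ.2.1 _ ((S.pos_iff α).1 h (S.basis_root α))

theorem mem_ZI_of_chi_e_ne_zero (hχ : S.IsStandardLeviForm χ I) {α : S.R} (h : χ (S.e α) ≠ 0) :
    α.1 ∈ S.ZI I := by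
  obtain ⟨β, hβ, hαβ⟩ := (isPos_or_exists_eq_neg α).resolve_left fun hα =>
    h (chi_e_of_isPos hχ hα)
  have hβI : β ∈ I := by_contra fun hI => h ((hχ.2.2 β α hβ hαβ).2 hI)
  rw [hαβ]
  exact neg_mem (AddSubgroup.subset_closure ⟨β, hβI, rfl⟩)

end Levi

end ReductiveGroup

namespace ReductiveGroup

/-! ### Monomials in `U_χ` -/

section Monomials

variable {K : Type u} [Field K] {p : ℕ} (S : ReductiveGroup K p)

/-- The weight in `X` of the monomial with factors `M`. -/
def monomialWeight (M : Multiset S.BasisIndex) : S.X := (M.map S.weight).sum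

@[simp] theorem monomialWeight_zero : S.monomialWeight 0 = 0 := by simp [monomialWeight]

@[simp] theorem monomialWeight_cons (i : S.BasisIndex) (M : Multiset S.BasisIndex) :
    S.monomialWeight (i ::ₘ M) = S.weight i + S.monomialWeight M := by simp [monomialWeight]

@[simp] theorem monomialWeight_add (M N : Multiset S.BasisIndex) :
    S.monomialWeight (M + N) = S.monomialWeight M + S.monomialWeight N := by simp [monomialWeight]

@[simp] theorem monomialWeight_replicate (k : ℕ) (i : S.BasisIndex) :
    S.monomialWeight (Multiset.replicate k i) = k • S.weight i := by simp [monomialWeight]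

theorem torus_mul_orderedMonomial (x : S.h) (M : Multiset S.BasisIndex) :
    ι K (x : S.g) * PBW.orderedMonomial S.lieBasis M =
      PBW.orderedMonomial S.lieBasis M * ι K (x : S.g) +
        S.diff (S.monomialWeight M) x • PBW.orderedMonomial S.lieBasis M := by
  induction M using multiset_induction_on_min with
  | zero => simp [PBW.orderedMonomial_zero, diff_zero]
  | cons j M hj ih =>
    have h : ι K (x : S.g) * ι K (S.lieBasis j) =
        ι K (S.lieBasis j) * ι K (x : S.g) + S.diff (S.weight j) x • ι K (S.lieBasis j) := by
      rw [← sub_eq_iff_eq_add', ← Ring.lie_def, ← LieHom.map_lie, lie_lieBasis, map_smul]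
    rw [PBW.orderedMonomial_cons S.lieBasis hj, ← mul_assoc, h, add_mul, mul_assoc, ih,
      monomialWeight_cons, diff_add, LinearMap.add_apply, add_smul, mul_add, mul_smul_comm,
      smul_mul_assoc, mul_assoc]
    abel

theorem orderedMonomial_cons_torus (i : Fin S.d) (M : Multiset S.BasisIndex) :
    PBW.orderedMonomial S.lieBasis (.torus i ::ₘ M) =
      PBW.orderedMonomial S.lieBasis M * ι K (S.torusBasis i : S.g) := by
  have commute_of_gt : ∀ j ∈ M, .torus i < j →
      Commute (ι K (S.lieBasis (.torus i)) ^ 1) (ι K (S.lieBasis j)) := by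
    rintro (α | k) - hj
    · exact absurd hj (S.root_lt_torus α i).asymm
    · rw [pow_one, commute_iff_eq, ← sub_eq_zero, ← Ring.lie_def, ← LieHom.map_lie,
        lieBasis_torus, lieBasis_torus, lie_torus, map_zero]
  have h := PBW.orderedMonomial_add_replicate S.lieBasis 1 (.torus i) commute_of_gt
  rwa [pow_one, Multiset.replicate_one, add_comm, Multiset.singleton_add, lieBasis_torus] at h

theorem orderedMonomial_add_replicate_root [Fact p.Prime] [CharP K p]
    (M : Multiset S.BasisIndex) (α : S.R) :
    PBW.orderedMonomial S.lieBasis (M + Multiset.replicate p (.root α)) =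
      PBW.orderedMonomial S.lieBasis M * ι K (S.e α) ^ p := by
  rw [← lieBasis_root]
  exact PBW.orderedMonomial_add_replicate S.lieBasis p (.root α) fun _ _ _ =>
    S.lieBasis_root α ▸ S.commute_e_pow α _

variable (χ : Module.Dual K S.g)

theorem toU_surjective : Function.Surjective (S.toU χ) := RingQuot.mkAlgHom_surjective K _

theorem toU_e_pow (α : S.R) :
    S.toU χ (ι K (S.e α) ^ p) = algebraMap K _ (χ (S.e α) ^ p) :=
  (RingQuot.mkAlgHom_rel K (URel.pow (χ := χ) α)).trans (AlgHom.commutes _ _)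

/-- The image in `U_χ` of an ordered monomial in the basis of `𝔤`. -/
def monomial (M : Multiset S.BasisIndex) : S.U χ := S.toU χ (PBW.orderedMonomial S.lieBasis M)

theorem monomial_zero : S.monomial χ 0 = 1 := by
  rw [monomial, PBW.orderedMonomial_zero, map_one]

theorem torus_mul_monomial (x : S.h) (M : Multiset S.BasisIndex) :
    S.ofLie χ x * S.monomial χ M =
      S.monomial χ M * S.ofLie χ x + S.diff (S.monomialWeight M) x • S.monomial χ M := by
  rw [ofLie, monomial, ← map_mul, torus_mul_orderedMonomial, map_add, map_mul, map_smul]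

theorem monomial_cons_torus (i : Fin S.d) (M : Multiset S.BasisIndex) :
    S.monomial χ (.torus i ::ₘ M) = S.monomial χ M * S.ofLie χ (S.torusBasis i) := by
  rw [monomial, orderedMonomial_cons_torus, map_mul, monomial, ofLie]

theorem monomial_add_replicate_root [Fact p.Prime] [CharP K p]
    (M : Multiset S.BasisIndex) (α : S.R) :
    S.monomial χ (M + Multiset.replicate p (.root α)) = χ (S.e α) ^ p • S.monomial χ M := by
  rw [monomial, orderedMonomial_add_replicate_root, map_mul, toU_e_pow, ← Algebra.commutes,
    ← Algebra.smul_def, monomial]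

theorem span_range_monomial : Submodule.span K (Set.range (S.monomial χ)) = ⊤ := by
  have h : Set.range (S.monomial χ) =
      (S.toU χ).toLinearMap '' Set.range (PBW.basis S.lieBasis) := by
    rw [← Set.range_comp]
    exact congrArg Set.range (funext fun M => by simp [monomial])
  rw [h, ← Submodule.map_span, Module.Basis.span_eq, Submodule.map_top,
    LinearMap.range_eq_top.2 (S.toU_surjective χ)]

-- The `p`-th powers are central, so `U_χ` acts on the quotient by the left ideal they generate.
theorem mem_span_of_toU_eq_zero [Fact p.Prime] [CharP K p] {u : UniversalEnvelopingAlgebra K S.g}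
    (hu : S.toU χ u = 0) :
    u ∈ Submodule.span (UniversalEnvelopingAlgebra K S.g)
      (Set.range fun α : S.R => ι K (S.e α) ^ p - algebraMap K _ (χ (S.e α) ^ p)) := by
  set N := Submodule.span (UniversalEnvelopingAlgebra K S.g)
    (Set.range fun α : S.R => ι K (S.e α) ^ p - algebraMap K _ (χ (S.e α) ^ p))
  let act : S.U χ →ₐ[K] Module.End K (UniversalEnvelopingAlgebra K S.g ⧸ N) :=
    RingQuot.liftAlgHom K ⟨Algebra.lsmul K K _, by
      rintro _ _ ⟨α⟩
      refine LinearMap.ext fun w => ?_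
      obtain ⟨u, rfl⟩ := N.mkQ_surjective w
      rw [Algebra.lsmul_coe, Algebra.lsmul_coe, ← sub_eq_zero, ← sub_smul, ← map_smul,
        Submodule.mkQ_apply, Submodule.Quotient.mk_eq_zero, smul_eq_mul, sub_mul,
        (S.commute_e_pow α u).eq, Algebra.commutes, ← mul_sub]
      exact N.smul_mem _ (Submodule.subset_span ⟨α, rfl⟩)⟩
  have act_toU : act (S.toU χ u) = Algebra.lsmul K K _ u :=
    RingQuot.liftAlgHom_mkAlgHom_apply K _ _ u
  have mk_eq : N.mkQ u = act (S.toU χ u) (N.mkQ 1) := by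
    rw [act_toU]
    change _ = u • N.mkQ 1
    rw [← map_smul, smul_eq_mul, mul_one]
  rwa [hu, map_zero, LinearMap.zero_apply, Submodule.mkQ_apply,
    Submodule.Quotient.mk_eq_zero] at mk_eq

end Monomials

/-! ### Restricted monomials -/

section Restricted

variable {K : Type u} [Field K] {p : ℕ} (S : ReductiveGroup K p)

/-- The factors of the monomial in the root vectors with exponents `n`. -/
def rootMultiset (n : S.R → Fin p) : Multiset S.BasisIndex :=
  ∑ α, Multiset.replicate (n α) (.root α)

theorem count_root_rootMultiset (n : S.R → Fin p) (α : S.R) :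
    (S.rootMultiset n).count (.root α) = n α := by
  rw [rootMultiset, Multiset.count_sum', Finset.sum_eq_single_of_mem α (Finset.mem_univ α)]
  · rw [Multiset.count_replicate_self]
  · intro β _ h
    rw [Multiset.count_replicate, if_neg fun h' => h (BasisIndex.root.inj h')]

theorem count_torus_rootMultiset (n : S.R → Fin p) (i : Fin S.d) :
    (S.rootMultiset n).count (.torus i) = 0 := by
  rw [rootMultiset, Multiset.count_sum']
  exact Finset.sum_eq_zero fun α _ => by
    rw [Multiset.count_replicate, if_neg nofun]

variable {S} in
theorem count_root_add_replicate [DecidableEq S.R] (M : Multiset S.BasisIndex) (α β : S.R) :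
    (M + Multiset.replicate p (BasisIndex.root α)).count (BasisIndex.root β) =
      M.count (.root β) + p * if α = β then 1 else 0 := by
  rw [Multiset.count_add, Multiset.count_replicate, mul_ite, mul_one, mul_zero]
  simp only [BasisIndex.root.injEq]

variable {S} in
theorem count_root_cons_torus (i : Fin S.d) (M : Multiset S.BasisIndex) (α : S.R) :
    (BasisIndex.torus i ::ₘ M).count (BasisIndex.root α) = M.count (.root α) :=
  Multiset.count_cons_of_ne (by simp) M

variable [Fact p.Prime]

/-- The exponents modulo `p` of the root vectors in the monomial with factors `M`. -/
def expMod (M : Multiset S.BasisIndex) (α : S.R) : Fin p :=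
  ⟨M.count (.root α) % p, Nat.mod_lt _ (Fact.out : p.Prime).pos⟩

theorem expMod_rootMultiset (n : S.R → Fin p) : S.expMod (S.rootMultiset n) = n := by
  funext α
  apply Fin.ext
  simp only [expMod, count_root_rootMultiset, Nat.mod_eq_of_lt (n α).2]

theorem eq_rootMultiset_expMod {M : Multiset S.BasisIndex} (no_torus : ∀ i, .torus i ∉ M)
    (count_lt : ∀ α, M.count (.root α) < p) : M = S.rootMultiset (S.expMod M) := by
  ext (α | i)
  · rw [count_root_rootMultiset]
    exact (Nat.mod_eq_of_lt (count_lt α)).symm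
  · rw [count_torus_rootMultiset, Multiset.count_eq_zero_of_notMem (no_torus i)]

theorem restricted_induction {q : Multiset S.BasisIndex → Prop}
    (restricted : ∀ n, q (S.rootMultiset n)) (torus : ∀ i M, q M → q (.torus i ::ₘ M))
    (pow : ∀ α M, q M → q (M + Multiset.replicate p (.root α))) (M : Multiset S.BasisIndex) :
    q M := by
  induction hk : M.card using Nat.strong_induction_on generalizing M with
  | _ k ih =>
  by_cases no_torus : ∃ i, .torus i ∈ M
  · obtain ⟨i, hi⟩ := no_torus
    obtain ⟨N, rfl⟩ := Multiset.exists_cons_of_mem hi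
    exact torus i N (ih N.card (by simp [← hk]) N rfl)
  by_cases count_lt : ∃ α, p ≤ M.count (.root α)
  · obtain ⟨α, hα⟩ := count_lt
    rw [Multiset.le_count_iff_replicate_le] at hα
    rw [← Multiset.sub_add_cancel hα] at hk ⊢
    refine pow α _ (ih _ ?_ _ rfl)
    simp [← hk, (Fact.out : p.Prime).pos]
  push Not at no_torus count_lt
  rw [S.eq_rootMultiset_expMod no_torus count_lt]
  exact restricted _

theorem expMod_add_replicate_root (M : Multiset S.BasisIndex) (α : S.R) :
    S.expMod (M + Multiset.replicate p (.root α)) = S.expMod M := by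
  classical
  funext β
  apply Fin.ext
  simp only [expMod, count_root_add_replicate, Nat.add_mul_mod_self_left]

theorem expMod_cons_torus (i : Fin S.d) (M : Multiset S.BasisIndex) :
    S.expMod (.torus i ::ₘ M) = S.expMod M := by
  funext β
  apply Fin.ext
  simp only [expMod, count_root_cons_torus]

end Restricted

/-! ### Reduction to restricted monomials -/

section Reduction

variable {K : Type u} [Field K] {p : ℕ} (S : ReductiveGroup K p) (χ : Module.Dual K S.g)
  {A : Type v} [CommRing A] [Algebra K A] (π : S.U0 →ₐ[K] A)

/-- The map `x ↦ π(μ~(x))`, by which `𝔥` acts on vectors of weight `μ`. -/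
def torusChar (μ : S.X) : S.h →ₗ[K] A where
  toFun x := π (ι K x + algebraMap K _ (S.diff μ x))
  map_add' x y := by simp only [map_add]; abel
  map_smul' c x := by
    simp only [map_smul, map_add, AlgHom.commutes, smul_eq_mul, map_mul, RingHom.id_apply,
      Algebra.smul_def, mul_add]

theorem torusChar_add (μ ν : S.X) (x : S.h) :
    S.torusChar π (μ + ν) x = S.torusChar π μ x + algebraMap K A (S.diff ν x) := by
  change π _ = π _ + _
  rw [diff_add, LinearMap.add_apply, map_add (algebraMap K _), ← add_assoc, map_add π,
    AlgHom.commutes]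

/-- The scalar that splits off when the monomial with factors `M` is applied to a vector on which
`𝔥` acts by `torusChar π μ` and is reduced to a restricted monomial. -/
def coeff (μ : S.X) (M : Multiset S.BasisIndex) : A :=
  (∏ α, algebraMap K A ((χ (S.e α) ^ p) ^ (M.count (.root α) / p))) *
    ∏ i, S.torusChar π μ (S.torusBasis i) ^ M.count (.torus i)

theorem coeff_rootMultiset (μ : S.X) (n : S.R → Fin p) :
    S.coeff χ π μ (S.rootMultiset n) = 1 := by
  simp [coeff, count_root_rootMultiset, count_torus_rootMultiset, Nat.div_eq_of_lt (Fin.is_lt _)]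

theorem coeff_cons_torus (μ : S.X) (i : Fin S.d) (M : Multiset S.BasisIndex) :
    S.coeff χ π μ (.torus i ::ₘ M) = S.torusChar π μ (S.torusBasis i) * S.coeff χ π μ M := by
  have count_torus (j : Fin S.d) : (BasisIndex.torus i ::ₘ M).count (BasisIndex.torus j) =
      M.count (.torus j) + if i = j then 1 else 0 := by
    simp only [Multiset.count_cons, BasisIndex.torus.injEq, eq_comm]
  simp only [coeff, count_root_cons_torus, count_torus, pow_add, Finset.prod_mul_distrib,
    Finset.prod_pow_boole, Finset.mem_univ, if_true]
  ring

variable [Fact p.Prime]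

theorem coeff_add_replicate_root (μ : S.X) (M : Multiset S.BasisIndex) (α : S.R) :
    S.coeff χ π μ (M + Multiset.replicate p (.root α)) =
      χ (S.e α) ^ p • S.coeff χ π μ M := by
  classical
  have count_torus (i : Fin S.d) : (M + Multiset.replicate p (BasisIndex.root α)).count
      (BasisIndex.torus i) = M.count (.torus i) := by
    rw [Multiset.count_add, Multiset.count_replicate, if_neg nofun, add_zero]
  simp only [coeff, count_root_add_replicate, count_torus,
    Nat.add_mul_div_left _ _ (Fact.out : p.Prime).pos, pow_add, map_mul, Finset.prod_mul_distrib]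
  rw [← map_prod (algebraMap K A) (fun β => _ ^ if α = β then 1 else 0), Finset.prod_pow_boole,
    if_pos (Finset.mem_univ α), Algebra.smul_def]
  ring

/-- The linear map `U(𝔤) → A^(restricted monomials)` that reduces monomials to restricted ones. -/
def reduce (μ : S.X) : UniversalEnvelopingAlgebra K S.g →ₗ[K] ((S.R → Fin p) →₀ A) :=
  (PBW.basis S.lieBasis).constr K fun M => Finsupp.single (S.expMod M) (S.coeff χ π μ M)

theorem reduce_orderedMonomial (μ : S.X) (M : Multiset S.BasisIndex) :
    S.reduce χ π μ (PBW.orderedMonomial S.lieBasis M) =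
      Finsupp.single (S.expMod M) (S.coeff χ π μ M) := by
  rw [← PBW.basis_apply, reduce, Module.Basis.constr_basis]

theorem reduce_mul_torus (μ : S.X) (u : UniversalEnvelopingAlgebra K S.g) (x : S.h) :
    S.reduce χ π μ (u * ι K (x : S.g)) = S.torusChar π μ x • S.reduce χ π μ u := by
  have reduce_mul_torusBasis (i : Fin S.d) :
      S.reduce χ π μ (u * ι K (S.torusBasis i : S.g)) =
        S.torusChar π μ (S.torusBasis i) • S.reduce χ π μ u := by
    suffices h : S.reduce χ π μ ∘ₗ LinearMap.mulRight K (ι K (S.torusBasis i : S.g)) =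
        S.torusChar π μ (S.torusBasis i) • S.reduce χ π μ from LinearMap.congr_fun h u
    refine (PBW.basis S.lieBasis).ext fun M => ?_
    rw [PBW.basis_apply, LinearMap.comp_apply, LinearMap.mulRight_apply, LinearMap.smul_apply,
      ← orderedMonomial_cons_torus, reduce_orderedMonomial, reduce_orderedMonomial,
      Finsupp.smul_single, expMod_cons_torus, coeff_cons_torus, smul_eq_mul]
  have hx : x ∈ Submodule.span K (Set.range S.torusBasis) :=
    S.span_range_torusBasis ▸ Submodule.mem_top
  induction hx using Submodule.span_induction with
  | zero => rw [ZeroMemClass.coe_zero, map_zero, map_zero, mul_zero, map_zero, zero_smul]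
  | add x y _ _ hx hy => rw [AddMemClass.coe_add, map_add, map_add, mul_add, map_add, hx, hy,
      add_smul]
  | smul c x _ hx => rw [SetLike.val_smul, map_smul, map_smul, mul_smul_comm, map_smul, hx,
      smul_assoc]
  | mem x hx =>
    obtain ⟨i, rfl⟩ := hx
    exact reduce_mul_torusBasis i

variable [CharP K p]

theorem reduce_mul_e_pow_sub (μ : S.X) (u : UniversalEnvelopingAlgebra K S.g) (α : S.R) :
    S.reduce χ π μ (u * (ι K (S.e α) ^ p - algebraMap K _ (χ (S.e α) ^ p))) = 0 := by
  suffices h : S.reduce χ π μ ∘ₗ LinearMap.mulRight K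
      (ι K (S.e α) ^ p - algebraMap K _ (χ (S.e α) ^ p)) = 0 from LinearMap.congr_fun h u
  refine (PBW.basis S.lieBasis).ext fun M => ?_
  rw [PBW.basis_apply, LinearMap.comp_apply, LinearMap.mulRight_apply, mul_sub, map_sub,
    ← orderedMonomial_add_replicate_root, ← Algebra.commutes, ← Algebra.smul_def, map_smul,
    reduce_orderedMonomial, reduce_orderedMonomial, LinearMap.zero_apply, sub_eq_zero,
    Finsupp.smul_single, expMod_add_replicate_root, coeff_add_replicate_root]

theorem ker_toU_le_ker_reduce (μ : S.X) :
    LinearMap.ker (S.toU χ).toLinearMap ≤ LinearMap.ker (S.reduce χ π μ) := by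
  intro u hu
  obtain ⟨c, rfl⟩ := (Submodule.mem_span_range_iff_exists_fun _).1
    (S.mem_span_of_toU_eq_zero χ hu)
  rw [LinearMap.mem_ker, map_sum]
  exact Finset.sum_eq_zero fun α _ => S.reduce_mul_e_pow_sub χ π μ (c α) α

/-- The map `reduce`, extended to `U_χ ⊗ A`. -/
def reduceTensor (μ : S.X) : S.U χ ⊗[K] A →ₗ[A] ((S.R → Fin p) →₀ A) :=
  LinearMap.liftBaseChange A
    ((LinearMap.ker (S.toU χ).toLinearMap).liftQ (S.reduce χ π μ) (S.ker_toU_le_ker_reduce χ π μ) ∘ₗ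
      ((S.toU χ).toLinearMap.quotKerEquivOfSurjective (S.toU_surjective χ)).symm.toLinearMap) ∘ₗ
    (Algebra.TensorProduct.commRight K A (S.U χ)).symm.toLinearEquiv.toLinearMap

theorem reduceTensor_toU_tmul (μ : S.X) (u : UniversalEnvelopingAlgebra K S.g) (a : A) :
    S.reduceTensor χ π μ (S.toU χ u ⊗ₜ[K] a) = a • S.reduce χ π μ u := by
  have symm_toU : ((S.toU χ).toLinearMap.quotKerEquivOfSurjective (S.toU_surjective χ)).symm
      (S.toU χ u) = (LinearMap.ker (S.toU χ).toLinearMap).mkQ u := by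
    rw [LinearEquiv.symm_apply_eq]
    rfl
  change a • (LinearMap.ker (S.toU χ).toLinearMap).liftQ (S.reduce χ π μ)
    (S.ker_toU_le_ker_reduce χ π μ) (LinearEquiv.symm _ (S.toU χ u)) = _
  rw [symm_toU, Submodule.mkQ_apply, Submodule.liftQ_apply]

end Reduction

end ReductiveGroup

/-! ### Modules over `U_χ ⊗ A` generated by torus vectors -/

section TensorModules

variable {K U A V : Type*} [CommRing K] [Ring U] [Algebra K U] [CommRing A] [Algebra K A]
  [AddCommGroup V] [Module (U ⊗[K] A) V]

theorem mul_tmul_one_smul (x y : U) (v : V) :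
    ((x * y) ⊗ₜ[K] (1 : A)) • v = (x ⊗ₜ[K] (1 : A)) • (y ⊗ₜ[K] (1 : A)) • v := by
  rw [smul_smul, Algebra.TensorProduct.tmul_mul_tmul, one_mul]

theorem add_tmul_one_smul (x y : U) (v : V) :
    ((x + y) ⊗ₜ[K] (1 : A)) • v = (x ⊗ₜ[K] (1 : A)) • v + (y ⊗ₜ[K] (1 : A)) • v := by
  rw [TensorProduct.add_tmul, add_smul]

variable [Module A V] [IsScalarTower A (U ⊗[K] A) V]

theorem one_tmul_smul (a : A) (v : V) : ((1 : U) ⊗ₜ[K] a) • v = a • v := by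
  rw [← Algebra.TensorProduct.right_algebraMap_apply, algebraMap_smul]

theorem tmul_smul (u : U) (a : A) (v : V) : (u ⊗ₜ[K] a) • v = a • (u ⊗ₜ[K] (1 : A)) • v := by
  rw [← one_tmul_smul (K := K) (U := U), smul_smul, Algebra.TensorProduct.tmul_mul_tmul,
    one_mul, mul_one]

theorem smul_tmul_one_smul (c : K) (u : U) (v : V) :
    ((c • u) ⊗ₜ[K] (1 : A)) • v = algebraMap K A c • (u ⊗ₜ[K] (1 : A)) • v := by
  rw [← tmul_smul, TensorProduct.smul_tmul, Algebra.algebraMap_eq_smul_one]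

theorem tmul_smul_mem_span {s : Set U} {u : U} (hu : u ∈ Submodule.span K s) (a : A) (v : V) :
    (u ⊗ₜ[K] a) • v ∈ Submodule.span A ((fun u => (u ⊗ₜ[K] (1 : A)) • v) '' s) := by
  rw [tmul_smul]
  refine Submodule.smul_mem _ a ?_
  induction hu using Submodule.span_induction with
  | zero => rw [TensorProduct.zero_tmul, zero_smul]; exact zero_mem _
  | add x y _ _ hx hy => rw [add_tmul_one_smul]; exact add_mem hx hy
  | smul c x _ hx => rw [smul_tmul_one_smul]; exact Submodule.smul_mem _ _ hx
  | mem x hx => exact Submodule.subset_span ⟨x, hx, rfl⟩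

end TensorModules

namespace ReductiveGroup

section TorusVectors

variable {K : Type u} [Field K] {p : ℕ} (S : ReductiveGroup K p) (χ : Module.Dual K S.g)
  {A : Type v} [CommRing A] [Algebra K A] (π : S.U0 →ₐ[K] A)
  {V : Type*} [AddCommGroup V] [Module (S.U χ ⊗[K] A) V]

/-- Vectors of weight `μ`, that is, vectors on which `x ∈ 𝔥` acts as the scalar `π(μ~(x))`. -/
def IsTorusVector (μ : S.X) (v : V) : Prop :=
  ∀ x : S.h, (S.ofLie χ x ⊗ₜ[K] (1 : A)) • v = ((1 : S.U χ) ⊗ₜ[K] S.torusChar π μ x) • v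

variable {S χ π} [Module A V] [IsScalarTower A (S.U χ ⊗[K] A) V] {μ : S.X} {v : V}

theorem IsTorusVector.smul_eq (hv : S.IsTorusVector χ π μ v) (x : S.h) :
    (S.ofLie χ x ⊗ₜ[K] (1 : A)) • v = S.torusChar π μ x • v := by
  rw [hv x, one_tmul_smul]

theorem IsTorusVector.monomial_smul (hv : S.IsTorusVector χ π μ v) (M : Multiset S.BasisIndex) :
    S.IsTorusVector χ π (μ + S.monomialWeight M) ((S.monomial χ M ⊗ₜ[K] (1 : A)) • v) := by
  intro x
  rw [← mul_tmul_one_smul, torus_mul_monomial, add_tmul_one_smul, mul_tmul_one_smul, hv.smul_eq,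
    smul_tmul_one_smul, smul_algebra_smul_comm, one_tmul_smul, torusChar_add, add_smul]

variable [Fact p.Prime] [CharP K p]

theorem IsTorusVector.monomial_smul_eq (hv : S.IsTorusVector χ π μ v)
    (M : Multiset S.BasisIndex) :
    (S.monomial χ M ⊗ₜ[K] (1 : A)) • v =
      S.coeff χ π μ M • (S.monomial χ (S.rootMultiset (S.expMod M)) ⊗ₜ[K] (1 : A)) • v := by
  induction M using S.restricted_induction with
  | restricted n => rw [expMod_rootMultiset, coeff_rootMultiset, one_smul]
  | torus i M ih =>
    rw [monomial_cons_torus, mul_tmul_one_smul, hv.smul_eq, smul_algebra_smul_comm, ih,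
      expMod_cons_torus, coeff_cons_torus, mul_smul]
  | pow α M ih =>
    rw [monomial_add_replicate_root, smul_tmul_one_smul, ih, expMod_add_replicate_root,
      coeff_add_replicate_root, Algebra.smul_def, mul_smul]

theorem IsTorusVector.smul_mem_span (hv : S.IsTorusVector χ π μ v) (x : S.U χ ⊗[K] A) :
    x • v ∈ Submodule.span A (Set.range fun n : S.R → Fin p =>
      (S.monomial χ (S.rootMultiset n) ⊗ₜ[K] (1 : A)) • v) := by
  induction x using TensorProduct.induction_on with
  | zero => rw [zero_smul]; exact zero_mem _
  | add x y hx hy => rw [add_smul]; exact add_mem hx hy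
  | tmul u a =>
    have hu : u ∈ Submodule.span K (Set.range (S.monomial χ)) :=
      S.span_range_monomial χ ▸ Submodule.mem_top
    refine Submodule.span_le.2 ?_ (tmul_smul_mem_span hu a v)
    rintro _ ⟨_, ⟨M, rfl⟩, rfl⟩
    change (S.monomial χ M ⊗ₜ[K] (1 : A)) • v ∈ _
    rw [hv.monomial_smul_eq M]
    exact Submodule.smul_mem _ _ (Submodule.subset_span ⟨_, rfl⟩)

end TorusVectors

section Degree

variable {K : Type u} [Field K] {p : ℕ} {S : ReductiveGroup K p} {χ : Module.Dual K S.g}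
  (I : Set S.R)

variable (S) in
/-- The map `μ ↦ (μ + ℤI, dμ)`, whose values index the pieces of the objects of `𝒞_A`. -/
def degree : S.X →+ S.XI I × Module.Dual K S.h := (QuotientAddGroup.mk' (S.ZI I)).prod S.diffHom

theorem degree_apply (μ : S.X) : S.degree I μ = (QuotientAddGroup.mk μ, S.diff μ) := rfl

theorem ofLie_mul_monomial_mem_span (α : S.R) (M : Multiset S.BasisIndex) :
    S.ofLie χ (S.e α) * S.monomial χ M ∈ Submodule.span K
      (S.monomial χ '' {N | S.monomialWeight N = α.1 + S.monomialWeight M}) := by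
  have h := PBW.ι_mul_orderedMonomial_mem_span S.lieBasis (P := Set.univ) (wt := S.weight)
    (fun i _ j _ k hk => ⟨Set.mem_univ k, S.weight_of_repr_lie_ne_zero hk⟩) (i := .root α)
    (Set.mem_univ _) (γ := S.monomialWeight M) (M := M) ⟨fun _ _ => Set.mem_univ _, rfl⟩
  have h' := Submodule.mem_map_of_mem (f := (S.toU χ).toLinearMap) h
  rw [Submodule.map_span, AlgHom.toLinearMap_apply, map_mul, lieBasis_root, weight_root] at h'
  refine Submodule.span_mono ?_ h'
  rintro _ ⟨_, ⟨N, hN, rfl⟩, rfl⟩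
  exact ⟨N, hN.2, rfl⟩

variable {I} [CharP K p]

theorem degree_p_smul_eq_zero (hχ : S.IsStandardLeviForm χ I) {α : S.R} (hα : χ (S.e α) ≠ 0) :
    S.degree I (p • α.1) = 0 := by
  rw [degree_apply, diff_p_smul,
    (QuotientAddGroup.eq_zero_iff _).2 (nsmul_mem (mem_ZI_of_chi_e_ne_zero hχ hα) p)]
  rfl

variable {A : Type v} [CommRing A] [Algebra K A] {π : S.U0 →ₐ[K] A} [Fact p.Prime]

theorem degree_monomialWeight_expMod (hχ : S.IsStandardLeviForm χ I) {μ : S.X}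
    {M : Multiset S.BasisIndex} (hM : S.coeff χ π μ M ≠ 0) :
    S.degree I (S.monomialWeight (S.rootMultiset (S.expMod M))) =
      S.degree I (S.monomialWeight M) := by
  induction M using S.restricted_induction with
  | restricted n => rw [expMod_rootMultiset]
  | torus i M ih =>
    rw [coeff_cons_torus] at hM
    rw [expMod_cons_torus, monomialWeight_cons, weight_torus, zero_add,
      ih (right_ne_zero_of_mul hM)]
  | pow α M ih =>
    rw [coeff_add_replicate_root] at hM
    have hα : χ (S.e α) ≠ 0 := ne_zero_pow (Fact.out : p.Prime).ne_zero (left_ne_zero_of_smul hM)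
    rw [expMod_add_replicate_root, ih (right_ne_zero_of_smul hM), monomialWeight_add,
      monomialWeight_replicate, weight_root, map_add, degree_p_smul_eq_zero hχ hα, add_zero]

variable {V : Type*} [AddCommGroup V] [Module (S.U χ ⊗[K] A) V] [Module A V]
  [IsScalarTower A (S.U χ ⊗[K] A) V] {μ : S.X} {v : V}

theorem IsTorusVector.monomial_smul_mem_span (hv : S.IsTorusVector χ π μ v)
    (hχ : S.IsStandardLeviForm χ I) (M : Multiset S.BasisIndex) :
    (S.monomial χ M ⊗ₜ[K] (1 : A)) • v ∈ Submodule.span A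
      ((fun n => (S.monomial χ (S.rootMultiset n) ⊗ₜ[K] (1 : A)) • v) ''
        {n | S.degree I (S.monomialWeight (S.rootMultiset n)) =
          S.degree I (S.monomialWeight M)}) := by
  rw [hv.monomial_smul_eq M]
  by_cases hM : S.coeff χ π μ M = 0
  · rw [hM, zero_smul]
    exact zero_mem _
  · exact Submodule.smul_mem _ _
      (Submodule.subset_span ⟨_, degree_monomialWeight_expMod hχ hM, rfl⟩)

theorem IsTorusVector.e_smul_monomial_smul_mem_span (hv : S.IsTorusVector χ π μ v)
    (hχ : S.IsStandardLeviForm χ I) (α : S.R) (M : Multiset S.BasisIndex) :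
    (S.ofLie χ (S.e α) ⊗ₜ[K] (1 : A)) • (S.monomial χ M ⊗ₜ[K] (1 : A)) • v ∈ Submodule.span A
      ((fun n => (S.monomial χ (S.rootMultiset n) ⊗ₜ[K] (1 : A)) • v) ''
        {n | S.degree I (S.monomialWeight (S.rootMultiset n)) =
          S.degree I (α.1 + S.monomialWeight M)}) := by
  rw [← mul_tmul_one_smul]
  refine Submodule.span_le.2 ?_ (tmul_smul_mem_span (ofLie_mul_monomial_mem_span α M) 1 v)
  rintro _ ⟨_, ⟨N, hN, rfl⟩, rfl⟩
  exact hN ▸ hv.monomial_smul_mem_span hχ N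

end Degree

section TorusInduced

variable {K : Type u} [Field K] {p : ℕ} (S : ReductiveGroup K p) (χ : Module.Dual K S.g)
  {A : Type v} [CommRing A] [Algebra K A] (π : S.U0 →ₐ[K] A) (μ : S.X)

/-- The left ideal of `U_χ ⊗ A` generated by the `h ⊗ 1 - 1 ⊗ π(μ~(h))` for `h ∈ 𝔥`. -/
def torusRel : Submodule (S.U χ ⊗[K] A) (S.U χ ⊗[K] A) :=
  Submodule.span _ (Set.range fun x : S.h =>
    S.ofLie χ x ⊗ₜ[K] (1 : A) - (1 : S.U χ) ⊗ₜ[K] S.torusChar π μ x)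

/-- The module `U_χ ⊗_{U⁰} A^μ`, as a quotient of `U_χ ⊗ A`. -/
abbrev TorusInduced : Type (max u v) := (S.U χ ⊗[K] A) ⧸ S.torusRel χ π μ

/-- The generator of `U_χ ⊗_{U⁰} A^μ`. -/
def torusGen : S.TorusInduced χ π μ := (S.torusRel χ π μ).mkQ 1

theorem smul_torusGen (x : S.U χ ⊗[K] A) : x • S.torusGen χ π μ = (S.torusRel χ π μ).mkQ x := by
  rw [torusGen, ← map_smul, smul_eq_mul, mul_one]

theorem isTorusVector_torusGen : S.IsTorusVector χ π μ (S.torusGen χ π μ) := by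
  intro x
  rw [← sub_eq_zero, ← sub_smul, smul_torusGen, Submodule.mkQ_apply,
    Submodule.Quotient.mk_eq_zero]
  exact Submodule.subset_span ⟨x, rfl⟩

variable [Fact p.Prime] [CharP K p]

theorem torusRel_le_ker_reduceTensor :
    (S.torusRel χ π μ).restrictScalars A ≤ LinearMap.ker (S.reduceTensor χ π μ) := by
  have reduceTensor_mul (y : S.U χ ⊗[K] A) (x : S.h) : S.reduceTensor χ π μ
      (y * (S.ofLie χ x ⊗ₜ[K] (1 : A) - (1 : S.U χ) ⊗ₜ[K] S.torusChar π μ x)) = 0 := by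
    induction y using TensorProduct.induction_on with
    | zero => rw [zero_mul, map_zero]
    | add y z hy hz => rw [add_mul, map_add, hy, hz, add_zero]
    | tmul u a =>
      obtain ⟨u, rfl⟩ := S.toU_surjective χ u
      rw [mul_sub, Algebra.TensorProduct.tmul_mul_tmul, Algebra.TensorProduct.tmul_mul_tmul,
        mul_one, mul_one, ofLie, ← map_mul, map_sub, reduceTensor_toU_tmul, reduceTensor_toU_tmul,
        reduce_mul_torus, smul_smul, sub_self]
  intro y hy
  rw [Submodule.restrictScalars_mem] at hy
  induction hy using Submodule.closure_induction with
  | zero => exact zero_mem _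
  | add y z _ _ hy hz => exact add_mem hy hz
  | smul_mem y z hz =>
    obtain ⟨x, rfl⟩ := hz
    exact reduceTensor_mul y x

theorem linearIndependent_monomial_smul_torusGen :
    LinearIndependent A fun n : S.R → Fin p =>
      (S.monomial χ (S.rootMultiset n) ⊗ₜ[K] (1 : A)) • S.torusGen χ π μ := by
  let f : S.TorusInduced χ π μ →ₗ[A] ((S.R → Fin p) →₀ A) :=
    ((S.torusRel χ π μ).restrictScalars A).liftQ (S.reduceTensor χ π μ)
        (S.torusRel_le_ker_reduceTensor χ π μ) ∘ₗ
      (Submodule.Quotient.restrictScalarsEquiv A (S.torusRel χ π μ)).symm.toLinearMap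
  have f_monomial (n : S.R → Fin p) :
      f ((S.monomial χ (S.rootMultiset n) ⊗ₜ[K] (1 : A)) • S.torusGen χ π μ) =
        Finsupp.single n 1 := by
    rw [smul_torusGen]
    change S.reduceTensor χ π μ (S.toU χ _ ⊗ₜ[K] (1 : A)) = _
    rw [reduceTensor_toU_tmul, reduce_orderedMonomial, expMod_rootMultiset, coeff_rootMultiset,
      one_smul]
  refine LinearIndependent.of_comp f ?_
  rw [show (f ∘ fun n : S.R → Fin p => _) = fun n => Finsupp.single n 1 from funext f_monomial]
  exact Finsupp.basisSingleOne.linearIndependent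

/-- The basis of `U_χ ⊗_{U⁰} A^μ` that consists of the restricted monomials in the root vectors. -/
def torusInducedBasis : Module.Basis (S.R → Fin p) A (S.TorusInduced χ π μ) :=
  Module.Basis.mk (S.linearIndependent_monomial_smul_torusGen χ π μ) fun w _ => by
    obtain ⟨x, rfl⟩ := (S.torusRel χ π μ).mkQ_surjective w
    rw [← smul_torusGen]
    exact (S.isTorusVector_torusGen χ π μ).smul_mem_span x

theorem torusInducedBasis_apply (n : S.R → Fin p) :
    S.torusInducedBasis χ π μ n =
      (S.monomial χ (S.rootMultiset n) ⊗ₜ[K] (1 : A)) • S.torusGen χ π μ :=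
  Module.Basis.mk_apply _ _ n

end TorusInduced

end ReductiveGroup

/-! ### Independent families of subgroups -/

section Independence

variable {C M N : Type*} [AddCommGroup M] [AddCommGroup N]

theorem iSup_toAddSubgroup {C : Sort*} {A : Type*} [Ring A] [Module A M] (P : C → Submodule A M) :
    ⨆ c, (P c).toAddSubgroup = (⨆ c, P c).toAddSubgroup := by
  refine le_antisymm (iSup_le fun c => Submodule.toAddSubgroup_mono (le_iSup P c)) fun x hx => ?_
  rw [Submodule.mem_toAddSubgroup] at hx
  induction hx using Submodule.iSup_induction' with
  | mem c x hx => exact AddSubgroup.mem_iSup_of_mem c hx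
  | zero => exact zero_mem _
  | add x y _ _ hx hy => exact add_mem hx hy

theorem iSupIndep_toAddSubgroup {A : Type*} [Ring A] [Module A M] {P : C → Submodule A M}
    (hP : iSupIndep P) : iSupIndep fun c => (P c).toAddSubgroup := fun c => by
  rw [AddSubgroup.disjoint_def]
  intro x hx hx'
  refine Submodule.disjoint_def.1 (hP c) x hx (?_ : x ∈ (⨆ (d) (_ : d ≠ c), P d).toAddSubgroup)
  simpa only [iSup_toAddSubgroup] using hx'

theorem iSupIndep_span_image {J A : Type*} [Ring A] [Module A M] {b : J → M}
    (hb : LinearIndependent A b) {s : C → Set J} (hs : ∀ c d, c ≠ d → Disjoint (s c) (s d)) :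
    iSupIndep fun c => Submodule.span A (b '' s c) := fun c =>
  (hb.disjoint_span_image (disjoint_compl_right (a := s c))).mono_right <|
    iSup₂_le fun d hd => Submodule.span_mono (Set.image_mono (hs d c hd).subset_compl_right)

theorem span_toAddSubgroup {A : Type*} [Ring A] [Module A M] (s : Set M) :
    (Submodule.span A s).toAddSubgroup =
      AddSubgroup.closure {y | ∃ m ∈ s, ∃ a : A, y = a • m} := by
  apply le_antisymm
  · intro x hx
    rw [Submodule.mem_toAddSubgroup] at hx
    induction hx using Submodule.closure_induction with
    | zero => exact zero_mem _
    | add x y _ _ hx hy => exact add_mem hx hy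
    | smul_mem a x hx => exact AddSubgroup.subset_closure ⟨x, hx, a, rfl⟩
  · rw [AddSubgroup.closure_le]
    rintro _ ⟨m, hm, a, rfl⟩
    exact Submodule.smul_mem _ _ (Submodule.subset_span hm)

theorem exists_add_of_mem_iSup {G : C → AddSubgroup M} {y : M} (hy : y ∈ ⨆ c, G c) (c : C) :
    ∃ y₁ ∈ G c, ∃ y₂ ∈ ⨆ (d) (_ : d ≠ c), G d, y₁ + y₂ = y := by
  refine AddSubgroup.mem_sup.1 ((iSup_le fun d => ?_ : ⨆ c, G c ≤ _) hy)
  rcases eq_or_ne d c with rfl | hd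
  · exact le_sup_left
  · exact (le_iSup₂ (f := fun d (_ : d ≠ c) => G d) d hd).trans le_sup_right

theorem exists_homogeneous_preimage {G : C → AddSubgroup N} (hG : iSupIndep G)
    {H : C → AddSubgroup M} (f : M →+ N) (hf : ∀ c, ∀ x ∈ H c, f x ∈ G c) {y : M}
    (hy : y ∈ ⨆ c, H c) {c : C} (hc : f y ∈ G c) : ∃ y' ∈ H c, f y' = f y := by
  obtain ⟨y₁, hy₁, y₂, hy₂, rfl⟩ := exists_add_of_mem_iSup hy c
  have hle : (⨆ (d) (_ : d ≠ c), H d) ≤ (⨆ (d) (_ : d ≠ c), G d).comap f :=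
    iSup₂_le fun d hd x hx => AddSubgroup.mem_iSup_of_mem d
      (AddSubgroup.mem_iSup_of_mem hd (hf d x hx))
  have hfy₂ : f y₂ ∈ G c := by
    rwa [map_add, AddSubgroup.add_mem_cancel_left _ (hf c _ hy₁)] at hc
  exact ⟨y₁, hy₁, by rw [map_add, AddSubgroup.disjoint_def.1 (hG c) hfy₂ (hle hy₂), add_zero]⟩

theorem iSupIndep_map_of_ker_le {G : C → AddSubgroup M} (hG : iSupIndep G) (q : M →+ N)
    (hq : ∀ x ∈ ⨆ c, G c, q x = 0 → x ∈ ⨆ c, G c ⊓ q.ker) : iSupIndep fun c => (G c).map q := by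
  intro c
  rw [AddSubgroup.disjoint_def]
  rintro _ ⟨x, hx, rfl⟩ hqx
  simp only [← AddSubgroup.map_iSup] at hqx
  obtain ⟨y, hy, hxy⟩ := hqx
  have hsub : x - y ∈ ⨆ c, G c ⊓ q.ker := by
    refine hq _ (sub_mem (AddSubgroup.mem_iSup_of_mem c hx) ?_) (by rw [map_sub, hxy, sub_self])
    exact (iSup₂_le fun d _ => le_iSup G d : (⨆ (d) (_ : d ≠ c), G d) ≤ _) hy
  obtain ⟨a, ha, a', ha', haa'⟩ := exists_add_of_mem_iSup hsub c
  have hxa : x - a = 0 := by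
    refine AddSubgroup.disjoint_def.1 (hG c) (sub_mem hx ha.1) ?_
    rw [show x - a = a' + y by rw [← sub_eq_iff_eq_add, sub_right_comm, ← haa',
      add_sub_cancel_left]]
    have hle : (⨆ (d) (_ : d ≠ c), G d ⊓ q.ker) ≤ ⨆ (d) (_ : d ≠ c), G d :=
      iSup₂_mono fun d _ => inf_le_left
    exact add_mem (hle ha') hy
  rw [sub_eq_zero.1 hxa]
  exact ha.2

theorem mem_of_simultaneous_eigenvector {K V ι : Type*} [Field K] [AddCommGroup V] [Module K V]
    {T : ι → Module.End K V} (hT : ∀ i j, Commute (T i) (T j)) {c : C → ι → K}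
    (hc : Function.Injective c) {W : C → AddSubgroup V}
    (hW : ∀ d, ∀ v ∈ W d, ∀ i, T i v = c d i • v) {v : V} (hv : v ∈ ⨆ d, W d) {d : C}
    (hvd : ∀ i, T i v = c d i • v) : v ∈ W d := by
  have indep : iSupIndep fun d => (⨅ i, (T i).maxGenEigenspace (c d i)).toAddSubgroup :=
    iSupIndep_toAddSubgroup ((Module.End.independent_iInf_maxGenEigenspace_of_forall_mapsTo T
      fun i j μ => Module.End.mapsTo_maxGenEigenspace_of_comm (hT j i) μ).comp hc)
  have mem_of_eigen {d : C} {v : V} (h : ∀ i, T i v = c d i • v) :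
      v ∈ (⨅ i, (T i).maxGenEigenspace (c d i)).toAddSubgroup :=
    (Submodule.mem_iInf _).2 fun i => (Module.End.genEigenspace (T i) (c d i)).mono le_top
      (Module.End.mem_eigenspace_iff.2 (h i))
  obtain ⟨_, hv', rfl⟩ := exists_homogeneous_preimage indep (AddMonoidHom.id V)
    (fun d v hv => mem_of_eigen (hW d v hv)) hv (mem_of_eigen hvd)
  exact hv'

end Independence

/-! ### Objects of `𝒞_A` -/

theorem smul_mem_of_mem_span {A B V : Type*} [CommRing A] [Ring B] [Algebra A B] [AddCommGroup V]
    [Module B V] [Module A V] [IsScalarTower A B V] {s : Set V} {P : Submodule A V} (x : B)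
    (h : ∀ v ∈ s, x • v ∈ P) {v : V} (hv : v ∈ Submodule.span A s) : x • v ∈ P :=
  (Submodule.span_le.2 h : Submodule.span A s ≤ P.comap (Algebra.lsmul A A V x)) hv

namespace ReductiveGroup

variable {K : Type u} [Field K] {p : ℕ} {S : ReductiveGroup K p} {χ : Module.Dual K S.g}
  {I : Set S.R} {A : Type v} [CommRing A] [Algebra K A]

theorem Ugr_smul_mem {V : Type*} [AddCommGroup V] [Module (S.U χ ⊗[K] A) V] [Module A V]
    [IsScalarTower A (S.U χ ⊗[K] A) V] {P : S.XI I → Submodule A V}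
    (hroot : ∀ ξ (α : S.R), ∀ v ∈ P ξ, (S.ofLie χ (S.e α) ⊗ₜ[K] (1 : A)) • v ∈
      P (QuotientAddGroup.mk α.1 + ξ))
    (htorus : ∀ ξ (x : S.h), ∀ v ∈ P ξ, (S.ofLie χ x ⊗ₜ[K] (1 : A)) • v ∈ P ξ)
    {σ ξ : S.XI I} {u : S.U χ} (hu : u ∈ S.Ugr χ I σ) {v : V} (hv : v ∈ P ξ) :
    (u ⊗ₜ[K] (1 : A)) • v ∈ P (σ + ξ) := by
  have of_isMonomial {σ : S.XI I} {u : S.U χ} (hu : S.IsMonomial χ I σ u) :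
      (u ⊗ₜ[K] (1 : A)) • v ∈ P (σ + ξ) := by
    induction hu with
    | one => rwa [← Algebra.TensorProduct.one_def, one_smul, zero_add]
    | root α _ ih =>
      rw [mul_tmul_one_smul, add_assoc]
      exact hroot _ α _ ih
    | torus x _ ih =>
      rw [mul_tmul_one_smul]
      exact htorus _ x _ ih
  refine Submodule.span_le.2 ?_ (tmul_smul_mem_span hu (1 : A) v)
  rintro _ ⟨u, hu, rfl⟩
  exact of_isMonomial hu

theorem monomial_mem_Uwt (M : Multiset S.BasisIndex) :
    S.monomial χ M ∈ S.Uwt χ I (QuotientAddGroup.mk (S.monomialWeight M))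
      (S.diff (S.monomialWeight M)) := by
  refine ⟨Submodule.subset_span ?_, fun x => by rw [torus_mul_monomial, add_sub_cancel_left]⟩
  induction M using multiset_induction_on_min with
  | zero =>
    rw [monomial_zero, monomialWeight_zero]
    exact .one
  | cons i M hi ih =>
    rw [monomial, PBW.orderedMonomial_cons S.lieBasis hi, map_mul, monomialWeight_cons]
    cases i with
    | root α => exact lieBasis_root S α ▸ ih.root α
    | torus i =>
      rw [weight_torus, zero_add, lieBasis_torus]
      exact ih.torus (S.torusBasis i)

variable (S χ) in
/-- The element `h ⊗ 1 - 1 ⊗ π(h)` of `U_χ ⊗ A`.  On the pieces of weight `w` of the objects of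
`𝒞_A` it acts as the scalar `w(h)`. -/
def shiftedTorus (π : S.U0 →ₐ[K] A) (x : S.h) : S.U χ ⊗[K] A :=
  S.ofLie χ x ⊗ₜ[K] (1 : A) - (1 : S.U χ) ⊗ₜ[K] π (ι K x)

variable {π : S.U0 →ₐ[K] A}

theorem commute_shiftedTorus (x y : S.h) :
    Commute (S.shiftedTorus χ π x) (S.shiftedTorus χ π y) := by
  have ofLie_commute : Commute (S.ofLie χ x) (S.ofLie χ y) := by
    rw [ofLie, ofLie]
    refine Commute.map (sub_eq_zero.1 ?_) (S.toU χ)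
    rw [← LieRing.of_associative_ring_bracket, ← LieHom.map_lie, lie_torus, map_zero]
  refine Commute.sub_left (.sub_right ?_ ?_) (.sub_right ?_ ?_)
  · simp only [Commute, SemiconjBy, Algebra.TensorProduct.tmul_mul_tmul, ofLie_commute.eq]
  all_goals simp only [Commute, SemiconjBy, Algebra.TensorProduct.tmul_mul_tmul, one_mul, mul_one,
    mul_comm (π (ι K x))]

theorem shiftedTorus_mul_tmul_one {ξ : S.XI I} {w : Module.Dual K S.h} {u : S.U χ}
    (hu : u ∈ S.Uwt χ I ξ w) (x : S.h) :
    S.shiftedTorus χ π x * (u ⊗ₜ[K] (1 : A)) =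
      (u ⊗ₜ[K] (1 : A)) * S.shiftedTorus χ π x + w x • (u ⊗ₜ[K] (1 : A)) := by
  simp only [shiftedTorus, sub_mul, mul_sub, Algebra.TensorProduct.tmul_mul_tmul, mul_one, one_mul,
    TensorProduct.smul_tmul', ← hu.2 x, TensorProduct.sub_tmul]
  abel

theorem isTorusVector_iff {V : Type*} [AddCommGroup V] [Module (S.U χ ⊗[K] A) V] {μ : S.X} {v : V} :
    S.IsTorusVector χ π μ v ↔ ∀ x, S.shiftedTorus χ π x • v =
      algebraMap K (S.U χ ⊗[K] A) (S.diff μ x) • v := by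
  refine forall_congr' fun x => ?_
  change _ = ((1 : S.U χ) ⊗ₜ[K] π (ι K x + algebraMap K _ (S.diff μ x))) • v ↔ _
  rw [shiftedTorus, sub_smul, sub_eq_iff_eq_add', map_add, AlgHom.commutes, TensorProduct.tmul_add,
    add_smul, Algebra.algebraMap_eq_smul_one (A := A), ← TensorProduct.smul_tmul,
    Algebra.TensorProduct.algebraMap_apply, Algebra.algebraMap_eq_smul_one]

end ReductiveGroup

namespace CA

open ReductiveGroup

variable {K : Type u} [Field K] {p : ℕ} {S : ReductiveGroup K p} {χ : Module.Dual K S.g}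
  {I : Set S.R} {A : Type v} [CommRing A]

section OfBasis

variable {V : Type (max u v)} [AddCommGroup V] [Module A V] {J : Type*}

/-- The span of the basis vectors `b j` for which `ω j + ℤI` is `ξ`. -/
def basisGr (I : Set S.R) (b : Module.Basis J A V) (ω : J → S.X) (ξ : S.XI I) : Submodule A V :=
  Submodule.span A (b '' {j | QuotientAddGroup.mk (ω j) = ξ})

/-- The span of the basis vectors `b j` for which `ω j + ℤI` is `ξ` and `d(ω j)` is `w`. -/
def basisWt (I : Set S.R) (b : Module.Basis J A V) (ω : J → S.X) (ξ : S.XI I)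
    (w : Module.Dual K S.h) : Submodule A V :=
  Submodule.span A (b '' {j | S.degree I (ω j) = (ξ, w)})

variable (b : Module.Basis J A V) (ω : J → S.X)

theorem iSup_basisGr : ⨆ ξ, basisGr I b ω ξ = ⊤ := by
  have hcover : ⋃ ξ : S.XI I, {j | QuotientAddGroup.mk (ω j) = ξ} = Set.univ :=
    Set.eq_univ_of_forall fun j => Set.mem_iUnion.2 ⟨_, rfl⟩
  simp only [basisGr]
  rw [← Submodule.span_iUnion, ← Set.image_iUnion, hcover, Set.image_univ, b.span_eq]

theorem iSup_basisWt (ξ : S.XI I) : ⨆ w, basisWt I b ω ξ w = basisGr I b ω ξ := by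
  simp only [basisGr, basisWt, ← Submodule.span_iUnion, ← Set.image_iUnion]
  congr 2
  ext j
  simp [degree_apply]

theorem basisGr_eq_bot {ξ : S.XI I} (hξ : ξ ∉ Set.range fun j => QuotientAddGroup.mk (ω j)) :
    basisGr I b ω ξ = ⊥ := by
  rw [basisGr, Set.eq_empty_of_forall_notMem (s := {j | _ = ξ}) fun j hj => hξ ⟨j, hj⟩,
    Set.image_empty, Submodule.span_empty]

theorem basisWt_eq_bot {ξ : S.XI I} {w : Module.Dual K S.h} (hw : w ∉ S.weightsOf I ξ) :
    basisWt I b ω ξ w = ⊥ := by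
  have hempty : {j | S.degree I (ω j) = (ξ, w)} = ∅ :=
    Set.eq_empty_of_forall_notMem fun j hj =>
      hw ⟨ω j, 0, by rw [smul_zero, sub_zero]; exact congrArg Prod.fst hj,
        (congrArg Prod.snd hj).symm⟩
  rw [basisWt, hempty, Set.image_empty, Submodule.span_empty]

variable {b ω} [Algebra K A] {π : S.U0 →ₐ[K] A} [Module (S.U χ ⊗[K] A) V]
  [IsScalarTower A (S.U χ ⊗[K] A) V]

theorem smul_mem_basisWt {α : S.R} (hroot : ∀ j, (S.ofLie χ (S.e α) ⊗ₜ[K] (1 : A)) • b j ∈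
      Submodule.span A (b '' {k | S.degree I (ω k) = S.degree I (ω j + α.1)}))
    {ξ : S.XI I} {μ : S.X} {v : V} (hv : v ∈ basisWt I b ω ξ (S.diff μ)) :
    (S.ofLie χ (S.e α) ⊗ₜ[K] (1 : A)) • v ∈
      basisWt I b ω (ξ + QuotientAddGroup.mk α.1) (S.diff (μ + α.1)) := by
  refine smul_mem_of_mem_span _ ?_ hv
  rintro _ ⟨j, hj, rfl⟩
  have h := hroot j
  rwa [map_add, show S.degree I (ω j) = _ from hj, degree_apply, Prod.mk_add_mk, ← diff_add] at h

theorem smul_mem_basisGr {α : S.R} (hroot : ∀ j, (S.ofLie χ (S.e α) ⊗ₜ[K] (1 : A)) • b j ∈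
      Submodule.span A (b '' {k | S.degree I (ω k) = S.degree I (ω j + α.1)}))
    {ξ : S.XI I} {v : V} (hv : v ∈ basisGr I b ω ξ) :
    (S.ofLie χ (S.e α) ⊗ₜ[K] (1 : A)) • v ∈ basisGr I b ω (QuotientAddGroup.mk α.1 + ξ) := by
  refine smul_mem_of_mem_span _ ?_ hv
  rintro _ ⟨j, rfl, rfl⟩
  refine Submodule.span_mono (Set.image_mono fun k hk => ?_) (hroot j)
  rw [Set.mem_ofPred_eq, ← QuotientAddGroup.mk_add, add_comm]
  exact congrArg Prod.fst hk

theorem torus_smul_mem_basisGr (htorus : ∀ j, S.IsTorusVector χ π (ω j) (b j)) {ξ : S.XI I}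
    (x : S.h) {v : V} (hv : v ∈ basisGr I b ω ξ) :
    (S.ofLie χ x ⊗ₜ[K] (1 : A)) • v ∈ basisGr I b ω ξ := by
  refine smul_mem_of_mem_span _ ?_ hv
  rintro _ ⟨j, hj, rfl⟩
  rw [(htorus j).smul_eq]
  exact Submodule.smul_mem _ _ (Submodule.subset_span ⟨j, hj, rfl⟩)

theorem isTorusVector_of_mem_basisWt (htorus : ∀ j, S.IsTorusVector χ π (ω j) (b j)) {ξ : S.XI I}
    {μ : S.X} {v : V} (hv : v ∈ basisWt I b ω ξ (S.diff μ)) : S.IsTorusVector χ π μ v := by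
  intro x
  rw [one_tmul_smul]
  induction hv using Submodule.span_induction with
  | zero => rw [smul_zero, smul_zero]
  | add v w _ _ hv hw => rw [smul_add, smul_add, hv, hw]
  | smul a v _ hv => rw [smul_algebra_smul_comm, hv, smul_comm]
  | mem v hv =>
    obtain ⟨j, hj, rfl⟩ := hv
    rw [(htorus j).smul_eq]
    change π (_ + algebraMap K _ (S.diff (ω j) x)) • _ = _
    rw [show S.diff (ω j) = _ from congrArg Prod.snd hj]
    rfl

/-- The object of `𝒞_A` given by a module with a finite `A`-basis of weight vectors. -/
def ofBasis [Finite J] (b : Module.Basis J A V) (ω : J → S.X)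
    (htorus : ∀ j, S.IsTorusVector χ π (ω j) (b j))
    (hroot : ∀ α j, (S.ofLie χ (S.e α) ⊗ₜ[K] (1 : A)) • b j ∈
      Submodule.span A (b '' {k | S.degree I (ω k) = S.degree I (ω j + α.1)})) :
    CA S χ I π where
  carrier := V
  gr ξ := (basisGr I b ω ξ).toAddSubgroup
  wt ξ w := (basisWt I b ω ξ w).toAddSubgroup
  gr_indep := iSupIndep_toAddSubgroup <| iSupIndep_span_image b.linearIndependent fun _ _ h =>
    Set.disjoint_left.2 fun _ hc hd => h (hc.symm.trans hd)
  gr_top := by rw [iSup_toAddSubgroup, iSup_basisGr, Submodule.top_toAddSubgroup]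
  gr_smul ξ a m hm := by
    rw [one_tmul_smul]
    exact Submodule.smul_mem _ _ hm
  gr_finite := (Set.finite_range fun j => (QuotientAddGroup.mk (ω j) : S.XI I)).subset <|
    fun ξ hξ => by_contra fun h => hξ <| by rw [basisGr_eq_bot b ω h, Submodule.bot_toAddSubgroup]
  gr_fg ξ := by
    refine ⟨(Set.toFinite (b '' {j | QuotientAddGroup.mk (ω j) = ξ})).toFinset, ?_⟩
    rw [basisGr, span_toAddSubgroup]
    simp only [one_tmul_smul, Set.Finite.mem_toFinset]
  gr_mul _ _ _ hu _ hm := Ugr_smul_mem (P := basisGr I b ω)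
    (fun _ α _ => smul_mem_basisGr (hroot α)) (fun _ x _ => torus_smul_mem_basisGr htorus x) hu hm
  wt_eq_bot ξ w hw := by rw [basisWt_eq_bot b ω hw, Submodule.bot_toAddSubgroup]
  wt_indep ξ := iSupIndep_toAddSubgroup <| iSupIndep_span_image b.linearIndependent fun _ _ h =>
    Set.disjoint_left.2 fun _ hc hd => h (congrArg Prod.snd (hc.symm.trans hd))
  wt_iSup ξ := by rw [iSup_toAddSubgroup, iSup_basisWt]
  wt_torus _ _ x _ hm := isTorusVector_of_mem_basisWt htorus hm x
  wt_root _ _ α _ hm := smul_mem_basisWt (hroot α) hm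
  wt_smul ξ w a m hm := by
    rw [one_tmul_smul]
    exact Submodule.smul_mem _ _ hm

end OfBasis

section Weights

variable [Algebra K A] {π : S.U0 →ₐ[K] A} {M : CA S χ I π} {ξ σ : S.XI I}
  {w w' : Module.Dual K S.h} {m : M.carrier}

theorem mem_gr_of_mem_wt (hm : m ∈ M.wt ξ w) : m ∈ M.gr ξ :=
  M.wt_iSup ξ ▸ AddSubgroup.mem_iSup_of_mem w hm

theorem isTorusVector_of_mem_wt {μ : S.X} (hm : m ∈ M.wt ξ (S.diff μ)) :
    S.IsTorusVector χ π μ m :=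
  fun x => M.wt_torus ξ μ x m hm

theorem shiftedTorus_smul_of_mem_wt (hm : m ∈ M.wt ξ w) (x : S.h) :
    S.shiftedTorus χ π x • m = algebraMap K (S.U χ ⊗[K] A) (w x) • m := by
  by_cases hw : w ∈ S.weightsOf I ξ
  · obtain ⟨μ, τ, -, rfl⟩ := hw
    exact isTorusVector_iff.1 (isTorusVector_of_mem_wt hm) x
  · rw [M.wt_eq_bot ξ w hw, AddSubgroup.mem_bot] at hm
    rw [hm, smul_zero, smul_zero]

theorem mem_wt_iff : m ∈ M.wt ξ w ↔ m ∈ M.gr ξ ∧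
    ∀ x, S.shiftedTorus χ π x • m = algebraMap K (S.U χ ⊗[K] A) (w x) • m := by
  refine ⟨fun hm => ⟨mem_gr_of_mem_wt hm, shiftedTorus_smul_of_mem_wt hm⟩, fun ⟨hm, hx⟩ => ?_⟩
  let _ : Module K M.carrier := .compHom _ (algebraMap K (S.U χ ⊗[K] A))
  have _ : IsScalarTower K (S.U χ ⊗[K] A) M.carrier := .of_algebraMap_smul fun _ _ => rfl
  rw [← M.wt_iSup] at hm
  exact mem_of_simultaneous_eigenvector
    (T := fun x => Algebra.lsmul K K M.carrier (S.shiftedTorus χ π x))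
    (fun x y => (commute_shiftedTorus x y).map _) DFunLike.coe_injective
    (fun _ _ => shiftedTorus_smul_of_mem_wt) hm hx

theorem Uwt_smul_mem_wt {u : S.U χ} (hu : u ∈ S.Uwt χ I σ w') (hm : m ∈ M.wt ξ w) :
    (u ⊗ₜ[K] (1 : A)) • m ∈ M.wt (σ + ξ) (w' + w) := by
  rw [mem_wt_iff] at hm ⊢
  refine ⟨M.gr_mul σ ξ u hu.1 m hm.1, fun x => ?_⟩
  rw [smul_smul, shiftedTorus_mul_tmul_one hu, add_smul, mul_smul, hm.2, smul_smul,
    ← Algebra.commutes, mul_smul, Algebra.smul_def, mul_smul, ← add_smul, ← map_add,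
    LinearMap.add_apply, add_comm]

theorem monomial_smul_mem_wt (hm : m ∈ M.wt ξ w) (N : Multiset S.BasisIndex) :
    (S.monomial χ N ⊗ₜ[K] (1 : A)) • m ∈ M.wt (QuotientAddGroup.mk (S.monomialWeight N) + ξ)
      (S.diff (S.monomialWeight N) + w) :=
  Uwt_smul_mem_wt (monomial_mem_Uwt N) hm

end Weights

end CA

namespace CA

open ReductiveGroup

variable {K : Type u} [Field K] {p : ℕ} {S : ReductiveGroup K p} {χ : Module.Dual K S.g}
  {I : Set S.R} {A : Type v} [CommRing A] [Algebra K A] {π : S.U0 →ₐ[K] A}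

/-! ### Epimorphisms of `𝒞_A` are surjective -/

section Cokernel

variable {M N : CA S χ I π} (f : M ⟶ N)

theorem linearMap_mem_wt {ξ : S.XI I} {w : Module.Dual K S.h} {m : M.carrier}
    (hm : m ∈ M.wt ξ w) : linearMap f m ∈ N.wt ξ w :=
  Hom.map_wt f ξ w m hm

theorem linearMap_mem_gr {ξ : S.XI I} {m : M.carrier} (hm : m ∈ M.gr ξ) :
    linearMap f m ∈ N.gr ξ := by
  rw [← M.wt_iSup] at hm
  have hle : ⨆ w, M.wt ξ w ≤ (N.gr ξ).comap (linearMap f).toAddMonoidHom :=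
    iSup_le fun _ _ hm => mem_gr_of_mem_wt (linearMap_mem_wt f hm)
  exact hle hm

theorem exists_preimage_mem_gr {ξ : S.XI I} {m : M.carrier} (h : linearMap f m ∈ N.gr ξ) :
    ∃ m' ∈ M.gr ξ, linearMap f m' = linearMap f m :=
  exists_homogeneous_preimage N.gr_indep (linearMap f).toAddMonoidHom
    (fun _ _ => linearMap_mem_gr f) (M.gr_top ▸ AddSubgroup.mem_top m) h

theorem exists_preimage_mem_wt {ξ : S.XI I} {w : Module.Dual K S.h} {m : M.carrier}
    (h : linearMap f m ∈ N.wt ξ w) : ∃ m' ∈ M.wt ξ w, linearMap f m' = linearMap f m := by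
  obtain ⟨m₁, hm₁, hfm₁⟩ := exists_preimage_mem_gr f (mem_gr_of_mem_wt h)
  rw [← hfm₁] at h ⊢
  rw [← M.wt_iSup] at hm₁
  exact exists_homogeneous_preimage (N.wt_indep ξ) (linearMap f).toAddMonoidHom
    (fun _ _ => linearMap_mem_wt f) hm₁ h

/-- The quotient map from the target of a morphism of `𝒞_A` to its cokernel. -/
abbrev cokerMap : N.carrier →ₗ[S.U χ ⊗[K] A] N.carrier ⧸ LinearMap.range (linearMap f) :=
  (LinearMap.range (linearMap f)).mkQ

theorem cokerMap_eq_zero_iff {x : N.carrier} :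
    cokerMap f x = 0 ↔ ∃ m, linearMap f m = x := by
  rw [Submodule.mkQ_apply, Submodule.Quotient.mk_eq_zero, LinearMap.mem_range]

theorem iSupIndep_map_gr_cokerMap :
    iSupIndep fun ξ => (N.gr ξ).map (cokerMap f).toAddMonoidHom := by
  refine iSupIndep_map_of_ker_le N.gr_indep _ fun x _ hx => ?_
  obtain ⟨m, rfl⟩ := (cokerMap_eq_zero_iff f).1 hx
  have hle : ⨆ ξ, M.gr ξ ≤ (⨆ ξ, N.gr ξ ⊓ (cokerMap f).toAddMonoidHom.ker).comap
      (linearMap f).toAddMonoidHom :=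
    iSup_le fun ξ m hm => AddSubgroup.mem_iSup_of_mem ξ
      ⟨linearMap_mem_gr f hm, (cokerMap_eq_zero_iff f).2 ⟨m, rfl⟩⟩
  exact hle (M.gr_top ▸ AddSubgroup.mem_top m)

theorem iSupIndep_map_wt_cokerMap (ξ : S.XI I) :
    iSupIndep fun w => (N.wt ξ w).map (cokerMap f).toAddMonoidHom := by
  refine iSupIndep_map_of_ker_le (N.wt_indep ξ) _ fun x hxξ hx => ?_
  obtain ⟨m, rfl⟩ := (cokerMap_eq_zero_iff f).1 hx
  rw [N.wt_iSup] at hxξ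
  obtain ⟨m', hm', hfm'⟩ := exists_preimage_mem_gr f hxξ
  have hle : ⨆ w, M.wt ξ w ≤ (⨆ w, N.wt ξ w ⊓ (cokerMap f).toAddMonoidHom.ker).comap
      (linearMap f).toAddMonoidHom :=
    iSup_le fun w m hm => AddSubgroup.mem_iSup_of_mem w
      ⟨linearMap_mem_wt f hm, (cokerMap_eq_zero_iff f).2 ⟨m, rfl⟩⟩
  rw [← M.wt_iSup] at hm'
  exact hfm' ▸ hle hm'

theorem exists_map_gr_eq_closure {V : Type*} [AddCommGroup V] [Module (S.U χ ⊗[K] A) V]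
    (g : N.carrier →ₗ[S.U χ ⊗[K] A] V) (ξ : S.XI I) :
    ∃ s : Finset V, (N.gr ξ).map g.toAddMonoidHom =
      AddSubgroup.closure {y | ∃ m ∈ s, ∃ a : A, y = ((1 : S.U χ) ⊗ₜ[K] a) • m} := by
  classical
  obtain ⟨s, hs⟩ := N.gr_fg ξ
  refine ⟨s.image g, ?_⟩
  rw [hs, AddMonoidHom.map_closure]
  congr 1
  ext y
  constructor
  · rintro ⟨_, ⟨m, hm, a, rfl⟩, rfl⟩
    exact ⟨_, Finset.mem_image_of_mem _ hm, a, g.map_smul _ _⟩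
  · rintro ⟨_, hy, a, rfl⟩
    obtain ⟨m, hm, rfl⟩ := Finset.mem_image.1 hy
    exact ⟨_, ⟨m, hm, a, rfl⟩, g.map_smul _ _⟩

/-- The cokernel of a morphism of `𝒞_A`, with the images of the pieces of the target as pieces. -/
def coker : CA S χ I π where
  carrier := N.carrier ⧸ LinearMap.range (linearMap f)
  gr ξ := (N.gr ξ).map (cokerMap f).toAddMonoidHom
  wt ξ w := (N.wt ξ w).map (cokerMap f).toAddMonoidHom
  gr_indep := iSupIndep_map_gr_cokerMap f
  gr_top := by
    rw [← AddSubgroup.map_iSup, N.gr_top, ← AddMonoidHom.range_eq_map]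
    exact AddMonoidHom.range_eq_top.2 (Submodule.mkQ_surjective _)
  gr_smul := by
    rintro ξ a _ ⟨m, hm, rfl⟩
    exact ⟨_, N.gr_smul ξ a m hm, (cokerMap f).map_smul _ _⟩
  gr_finite := N.gr_finite.subset fun ξ hξ h => hξ (by rw [h, AddSubgroup.map_bot])
  gr_fg := exists_map_gr_eq_closure (cokerMap f)
  gr_mul := by
    rintro σ ξ u hu _ ⟨m, hm, rfl⟩
    exact ⟨_, N.gr_mul σ ξ u hu m hm, (cokerMap f).map_smul _ _⟩
  wt_eq_bot ξ w hw := by rw [N.wt_eq_bot ξ w hw, AddSubgroup.map_bot]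
  wt_indep := iSupIndep_map_wt_cokerMap f
  wt_iSup ξ := by rw [← AddSubgroup.map_iSup, N.wt_iSup]
  wt_torus := by
    rintro ξ μ x _ ⟨m, hm, rfl⟩
    change _ • cokerMap f m = _ • cokerMap f m
    rw [← map_smul, ← map_smul, N.wt_torus ξ μ x m hm]
  wt_root := by
    rintro ξ μ α _ ⟨m, hm, rfl⟩
    exact ⟨_, N.wt_root ξ μ α m hm, (cokerMap f).map_smul _ _⟩
  wt_smul := by
    rintro ξ w a _ ⟨m, hm, rfl⟩
    exact ⟨_, N.wt_smul ξ w a m hm, (cokerMap f).map_smul _ _⟩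

theorem linearMap_surjective_of_epi [CategoryTheory.Epi f] :
    Function.Surjective (linearMap f) := by
  let q : N ⟶ coker f := (⟨cokerMap f, fun _ _ m hm => ⟨m, hm, rfl⟩⟩ : Hom N (coker f))
  let z : N ⟶ coker f := (⟨0, fun _ _ _ _ => zero_mem _⟩ : Hom N (coker f))
  have hqz : q = z := by
    rw [← CategoryTheory.cancel_epi f]
    exact Hom.ext (LinearMap.ext fun m => (cokerMap_eq_zero_iff f).2 ⟨m, rfl⟩)
  exact fun x => (cokerMap_eq_zero_iff f).1 (LinearMap.congr_fun (congrArg linearMap hqz) x)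

end Cokernel

/-! ### Projective objects of `𝒞_A` -/

section Free

variable (π) {k : ℕ} (lam : Fin k → S.X)

variable (χ) in
/-- The module `⨁ⱼ U_χ ⊗_{U⁰} A^{λⱼ}`, which represents the families of vectors `mⱼ` of
weight `λⱼ`. -/
abbrev FreeModule : Type (max u v) := ∀ j, S.TorusInduced χ π (lam j)

/-- The generators of `⨁ⱼ U_χ ⊗_{U⁰} A^{λⱼ}`. -/
def freeGen (j : Fin k) : FreeModule χ π lam := Pi.single j (S.torusGen χ π (lam j))

theorem isTorusVector_freeGen (j : Fin k) :
    S.IsTorusVector χ π (lam j) (freeGen (χ := χ) π lam j) := by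
  intro x
  rw [freeGen, ← Pi.single_smul, isTorusVector_torusGen, ← Pi.single_smul]

section Lift

variable {π lam} {V : Type*} [AddCommGroup V] [Module (S.U χ ⊗[K] A) V]

theorem torusRel_le_ker_toSpanSingleton {μ : S.X} {v : V} (hv : S.IsTorusVector χ π μ v) :
    S.torusRel χ π μ ≤ LinearMap.ker (LinearMap.toSpanSingleton (S.U χ ⊗[K] A) V v) := by
  refine Submodule.span_le.2 ?_
  rintro _ ⟨x, rfl⟩
  rw [SetLike.mem_coe, LinearMap.mem_ker, LinearMap.toSpanSingleton_apply, sub_smul, hv x,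
    sub_self]

/-- The homomorphism from `⨁ⱼ U_χ ⊗_{U⁰} A^{λⱼ}` that sends the generators to given vectors of
weights `λⱼ`. -/
def freeLinearLift {v : Fin k → V} (hv : ∀ j, S.IsTorusVector χ π (lam j) (v j)) :
    FreeModule χ π lam →ₗ[S.U χ ⊗[K] A] V :=
  ∑ j, (S.torusRel χ π (lam j)).liftQ _ (torusRel_le_ker_toSpanSingleton (hv j)) ∘ₗ
    LinearMap.proj j

theorem freeLinearLift_freeGen {v : Fin k → V} (hv : ∀ j, S.IsTorusVector χ π (lam j) (v j))
    (j : Fin k) : freeLinearLift hv (freeGen π lam j) = v j := by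
  rw [freeLinearLift, LinearMap.sum_apply, Finset.sum_eq_single_of_mem j (Finset.mem_univ j)]
  · rw [LinearMap.comp_apply, LinearMap.proj_apply, freeGen, Pi.single_eq_same, torusGen,
      Submodule.mkQ_apply, Submodule.liftQ_apply, LinearMap.toSpanSingleton_apply, one_smul]
  · intro i _ hij
    rw [LinearMap.comp_apply, LinearMap.proj_apply, freeGen, Pi.single_eq_of_ne hij, map_zero]

end Lift

variable [Fact p.Prime] [CharP K p]

variable (χ) in
/-- The basis of `⨁ⱼ U_χ ⊗_{U⁰} A^{λⱼ}` formed by the restricted monomials. -/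
def freeBasis : Module.Basis (Σ _ : Fin k, S.R → Fin p) A (FreeModule χ π lam) :=
  Pi.basis fun j => S.torusInducedBasis χ π (lam j)

theorem freeBasis_apply (x : Σ _ : Fin k, S.R → Fin p) :
    freeBasis χ π lam x =
      (S.monomial χ (S.rootMultiset x.2) ⊗ₜ[K] (1 : A)) • freeGen π lam x.1 := by
  rw [freeBasis, Pi.basis_apply, torusInducedBasis_apply]
  exact Pi.single_smul x.1 _ _

/-- The weights of the basis vectors `freeBasis`. -/
def freeWeight (x : Σ _ : Fin k, S.R → Fin p) : S.X :=
  lam x.1 + S.monomialWeight (S.rootMultiset x.2)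

variable (hχ : S.IsStandardLeviForm χ I)

/-- The object `⨁ⱼ U_χ ⊗_{U⁰} A^{λⱼ}` of `𝒞_A`. -/
def free : CA S χ I π :=
  ofBasis (freeBasis χ π lam) (freeWeight lam)
    (fun x => freeBasis_apply π lam x ▸ (isTorusVector_freeGen π lam x.1).monomial_smul _)
    fun α x => by
      rw [freeBasis_apply]
      refine Submodule.span_mono ?_ ((isTorusVector_freeGen π lam x.1).e_smul_monomial_smul_mem_span
        hχ α (S.rootMultiset x.2))
      rintro _ ⟨n, hn, rfl⟩
      refine ⟨⟨x.1, n⟩, ?_, freeBasis_apply π lam ⟨x.1, n⟩⟩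
      rw [Set.mem_ofPred_eq, freeWeight, freeWeight, map_add, add_assoc, map_add _ (lam x.1),
        add_comm _ α.1]
      exact congrArg _ hn

variable {π lam}

theorem mem_free_wt_iff {ξ : S.XI I} {w : Module.Dual K S.h} {v : FreeModule χ π lam} :
    v ∈ (free π lam hχ).wt ξ w ↔ v ∈ basisWt I (freeBasis χ π lam) (freeWeight lam) ξ w :=
  Iff.rfl

theorem freeGen_mem_wt (j : Fin k) :
    freeGen π lam j ∈ (free π lam hχ).wt (QuotientAddGroup.mk (lam j)) (S.diff (lam j)) := by
  have rootMultiset_zero : S.rootMultiset (0 : S.R → Fin p) = 0 := by simp [rootMultiset]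
  rw [mem_free_wt_iff]
  refine Submodule.subset_span ⟨⟨j, 0⟩, ?_, ?_⟩
  · rw [Set.mem_ofPred_eq, freeWeight, rootMultiset_zero, monomialWeight_zero, add_zero,
      degree_apply]
  · rw [freeBasis_apply, rootMultiset_zero, monomial_zero,
      ← Algebra.TensorProduct.one_def, one_smul]

theorem map_mem_wt_of_mem_free_wt {M : CA S χ I π}
    (F : FreeModule χ π lam →ₗ[S.U χ ⊗[K] A] M.carrier)
    (hF : ∀ j, F (freeGen π lam j) ∈ M.wt (QuotientAddGroup.mk (lam j)) (S.diff (lam j)))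
    {ξ : S.XI I} {w : Module.Dual K S.h} {v : FreeModule χ π lam}
    (hv : v ∈ (free π lam hχ).wt ξ w) : F v ∈ M.wt ξ w := by
  rw [mem_free_wt_iff] at hv
  induction hv using Submodule.span_induction with
  | zero => rw [map_zero]; exact zero_mem _
  | add v v' _ _ hv hv' => rw [map_add]; exact add_mem hv hv'
  | smul a v _ hv =>
    rw [← one_tmul_smul (K := K) (U := S.U χ), map_smul]
    exact M.wt_smul ξ w a _ hv
  | mem v hv =>
    obtain ⟨x, hx, rfl⟩ := hv
    obtain ⟨rfl, rfl⟩ := Prod.mk.inj hx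
    have h := monomial_smul_mem_wt (hF x.1) (S.rootMultiset x.2)
    rw [← QuotientAddGroup.mk_add, ← diff_add, add_comm, ← map_smul, ← freeBasis_apply] at h
    exact h

variable {M : CA S χ I π} (m : Fin k → M.carrier)
  (hm : ∀ j, m j ∈ M.wt (QuotientAddGroup.mk (lam j)) (S.diff (lam j)))

/-- The morphism from `⨁ⱼ U_χ ⊗_{U⁰} A^{λⱼ}` that sends the generators to given vectors `mⱼ`. -/
def freeLift : free π lam hχ ⟶ M :=
  have hv : ∀ j, S.IsTorusVector χ π (lam j) (m j) := fun j => isTorusVector_of_mem_wt (hm j)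
  (⟨freeLinearLift hv, fun _ _ _ => map_mem_wt_of_mem_free_wt hχ _ fun j =>
    (freeLinearLift_freeGen hv j).symm ▸ hm j⟩ : Hom (free π lam hχ) M)

theorem freeLift_freeGen (j : Fin k) :
    linearMap (freeLift hχ m hm) (freeGen π lam j) = m j :=
  freeLinearLift_freeGen (fun j => isTorusVector_of_mem_wt (hm j)) j

variable {hχ} in
theorem free_hom_ext {f g : free π lam hχ ⟶ M}
    (h : ∀ j, linearMap f (freeGen π lam j) = linearMap g (freeGen π lam j)) : f = g :=
  Hom.ext <| LinearMap.pi_ext' fun j => Submodule.linearMap_qext _ <| LinearMap.ext_ring (h j)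

theorem projective_free : CategoryTheory.Projective (free π lam hχ) where
  factors {E X} f e _ := by
    have exists_lift (j : Fin k) : ∃ m ∈ E.wt (QuotientAddGroup.mk (lam j)) (S.diff (lam j)),
        linearMap e m = linearMap f (freeGen π lam j) := by
      obtain ⟨m, hm⟩ := linearMap_surjective_of_epi e (linearMap f (freeGen π lam j))
      rw [← hm]
      exact exists_preimage_mem_wt e (hm ▸ linearMap_mem_wt f (freeGen_mem_wt hχ j))
    choose m hm hem using exists_lift
    refine ⟨freeLift hχ m hm, free_hom_ext fun j => ?_⟩
    change linearMap e (linearMap (freeLift hχ m hm) (freeGen π lam j)) = _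
    rw [freeLift_freeGen, hem]

end Free

section Generators

variable (M : CA S χ I π)

theorem top_fg [Module A M.carrier] [IsScalarTower A (S.U χ ⊗[K] A) M.carrier] :
    (⊤ : Submodule A M.carrier).FG := by
  classical
  choose s hs using M.gr_fg
  refine ⟨M.gr_finite.toFinset.biUnion s, ?_⟩
  rw [← Submodule.toAddSubgroup_eq_top, eq_top_iff, ← M.gr_top]
  refine iSup_le fun ξ => ?_
  by_cases hξ : M.gr ξ = ⊥
  · rw [hξ]
    exact bot_le
  · rw [hs ξ, AddSubgroup.closure_le]
    rintro _ ⟨m, hm, a, rfl⟩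
    rw [one_tmul_smul]
    refine Submodule.smul_mem _ _ (Submodule.subset_span ?_)
    rw [Finset.coe_biUnion]
    exact Set.mem_iUnion₂.2 ⟨ξ, M.gr_finite.mem_toFinset.2 hξ, hm⟩

variable [CharP K p]

theorem exists_degree_eq_of_mem_wt {ξ : S.XI I} {w : Module.Dual K S.h} {m : M.carrier}
    (hm : m ∈ M.wt ξ w) (hm₀ : m ≠ 0) : ∃ μ : S.X, S.degree I μ = (ξ, w) := by
  by_cases hw : w ∈ S.weightsOf I ξ
  · obtain ⟨μ, τ, rfl, rfl⟩ := hw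
    exact ⟨μ - p • τ, by rw [degree_apply, diff_sub, diff_p_smul, sub_zero]⟩
  · rw [M.wt_eq_bot ξ w hw] at hm
    exact absurd hm hm₀

theorem span_weight_vectors_eq_top [Module A M.carrier] :
    Submodule.span A {m | ∃ μ : S.X, m ∈ M.wt (QuotientAddGroup.mk μ) (S.diff μ)} = ⊤ := by
  rw [← Submodule.toAddSubgroup_eq_top, eq_top_iff, ← M.gr_top]
  refine iSup_le fun ξ => ?_
  rw [← M.wt_iSup]
  refine iSup_le fun w m hm => ?_
  by_cases hm₀ : m = 0
  · rw [hm₀]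
    exact zero_mem _
  · obtain ⟨μ, hμ⟩ := M.exists_degree_eq_of_mem_wt hm hm₀
    obtain ⟨rfl, rfl⟩ := Prod.mk.inj hμ
    exact Submodule.subset_span ⟨μ, hm⟩

theorem exists_generating_weight_vectors :
    ∃ (k : ℕ) (lam : Fin k → S.X) (m : Fin k → M.carrier),
      (∀ j, m j ∈ M.wt (QuotientAddGroup.mk (lam j)) (S.diff (lam j))) ∧
        Submodule.span (S.U χ ⊗[K] A) (Set.range m) = ⊤ := by
  let _ : Module A M.carrier := .compHom _ (algebraMap A (S.U χ ⊗[K] A))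
  have _ : IsScalarTower A (S.U χ ⊗[K] A) M.carrier := .of_algebraMap_smul fun _ _ => rfl
  have hfg := M.top_fg
  rw [← M.span_weight_vectors_eq_top, Submodule.fg_span_iff_fg_span_finset_subset] at hfg
  obtain ⟨s, hsT, hs⟩ := hfg
  rw [M.span_weight_vectors_eq_top] at hs
  choose μ hμ using fun m : s => hsT m.2
  have range_eq : Set.range (fun j => (s.equivFin.symm j : M.carrier)) = s := by
    rw [Set.range_comp' Subtype.val, s.equivFin.symm.surjective.range_eq, Set.image_univ,
      Subtype.range_coe]
  refine ⟨s.card, fun j => μ (s.equivFin.symm j), _, fun j => hμ (s.equivFin.symm j), ?_⟩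
  rw [range_eq, eq_top_iff]
  exact fun x _ => Submodule.span_le_restrictScalars A (S.U χ ⊗[K] A) _ (hs ▸ Submodule.mem_top)

end Generators

end CA

/-! ### Highest weight vectors and baby Verma modules -/

section RootSubsets

namespace ReductiveGroup

variable {K : Type u} [Field K] {p : ℕ} (S : ReductiveGroup K p)

open Classical in
/-- The multiset with the multiplicities `n < p` at the roots that satisfy `P`. -/
def rootMultisetOn {P : S.R → Prop} (n : {α // P α} → Fin p) : Multiset S.BasisIndex :=
  ∑ α, Multiset.replicate (n α) (.root α.1)

/-- The exponents of restricted monomials in the positive root vectors. -/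
abbrev PosExp : Type u := {α : S.R // S.IsPos α} → Fin p

/-- The exponents of restricted monomials in the negative root vectors. -/
abbrev NegExp : Type u := {α : S.R // ¬ S.IsPos α} → Fin p

variable {S}

theorem exists_eq_root_of_mem_rootMultisetOn {P : S.R → Prop} {n : {α // P α} → Fin p}
    {i : S.BasisIndex} (hi : i ∈ S.rootMultisetOn n) : ∃ α, P α ∧ i = .root α := by
  rw [rootMultisetOn, Multiset.mem_sum] at hi
  obtain ⟨α, -, hα⟩ := hi
  exact ⟨α.1, α.2, Multiset.eq_of_mem_replicate hα⟩

theorem rootMultiset_eq_add (P : S.R → Prop) (n : S.R → Fin p) :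
    S.rootMultiset n = S.rootMultisetOn (P := fun α => ¬ P α) (fun α => n α.1) +
      S.rootMultisetOn (P := P) (fun α => n α.1) := by
  classical
  rw [rootMultiset, rootMultisetOn, rootMultisetOn, add_comm]
  convert (Fintype.sum_subtype_add_sum_subtype P
    fun α => Multiset.replicate (n α) (BasisIndex.root α)).symm

theorem rootMultisetOn_zero {P : S.R → Prop} [NeZero p] :
    S.rootMultisetOn (0 : {α // P α} → Fin p) = 0 := by
  simp [rootMultisetOn]

theorem monomial_neg_add_pos (χ : Module.Dual K S.g) (a : S.NegExp) (b : S.PosExp) :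
    S.monomial χ (S.rootMultisetOn a + S.rootMultisetOn b) =
      S.monomial χ (S.rootMultisetOn a) * S.monomial χ (S.rootMultisetOn b) := by
  rw [monomial, PBW.orderedMonomial_add, map_mul, monomial, monomial]
  intro i hi j hj
  obtain ⟨α, hα, rfl⟩ := exists_eq_root_of_mem_rootMultisetOn hi
  obtain ⟨β, hβ, rfl⟩ := exists_eq_root_of_mem_rootMultisetOn hj
  exact (root_lt_root hα hβ).le

variable [Fact p.Prime] {χ : Module.Dual K S.g} {I : Set S.R}

theorem exists_eq_rootMultisetOn {P : S.R → Prop} {M : Multiset S.BasisIndex}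
    (hM : ∀ i ∈ M, ∃ α, P α ∧ i = .root α) (count_lt : ∀ α, M.count (.root α) < p) :
    ∃ b : {α // P α} → Fin p, M = S.rootMultisetOn b := by
  have no_torus (i : Fin S.d) (hi : .torus i ∈ M) : False := by
    obtain ⟨α, -, h⟩ := hM _ hi
    cases h
  refine ⟨fun α => S.expMod M α.1, ?_⟩
  conv_lhs => rw [S.eq_rootMultiset_expMod no_torus count_lt, rootMultiset_eq_add P]
  rw [add_eq_right, rootMultisetOn]
  refine Finset.sum_eq_zero fun α _ => ?_
  have notMem : .root α.1 ∉ M := fun hα => by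
    obtain ⟨β, hβ, h⟩ := hM _ hα
    exact α.2 (BasisIndex.root.inj h ▸ hβ)
  simp only [expMod, Multiset.count_eq_zero_of_notMem notMem, Nat.zero_mod,
    Multiset.replicate_zero]

variable [CharP K p]

theorem monomial_eq_zero_of_le_count (hχ : S.IsStandardLeviForm χ I) {M : Multiset S.BasisIndex}
    {α : S.R} (hα : S.IsPos α) (hM : p ≤ M.count (.root α)) : S.monomial χ M = 0 := by
  obtain ⟨N, rfl⟩ : ∃ N, M = N + Multiset.replicate p (.root α) :=
    ⟨_, (Multiset.sub_add_cancel (Multiset.le_count_iff_replicate_le.1 hM)).symm⟩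
  rw [monomial_add_replicate_root, chi_e_of_isPos hχ hα, zero_pow (Fact.out : p.Prime).ne_zero,
    zero_smul]

variable (S) in
/-- The height of the weight of a monomial in the positive root vectors. -/
def posHeight (b : S.PosExp) : ℤ := ((S.rootMultisetOn b).map S.height).sum

theorem e_mul_monomial_pos_mem_span (hχ : S.IsStandardLeviForm χ I) {α : S.R} (hα : S.IsPos α)
    (b : S.PosExp) :
    S.ofLie χ (S.e α) * S.monomial χ (S.rootMultisetOn b) ∈ Submodule.span K
      ((fun b' => S.monomial χ (S.rootMultisetOn b')) ''
        {b' | S.posHeight b < S.posHeight b'}) := by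
  have hα' : .root α ∈ S.posIndices := ⟨α, hα, rfl⟩
  have mem_span := Submodule.mem_map_of_mem (f := (S.toU χ).toLinearMap) <|
    PBW.ι_mul_orderedMonomial_mem_span S.lieBasis isGradedBasisOn_posIndices hα'
      ⟨fun i hi => exists_eq_root_of_mem_rootMultisetOn (n := b) hi, rfl⟩
  rw [Submodule.map_span, AlgHom.toLinearMap_apply, map_mul, lieBasis_root] at mem_span
  refine Submodule.span_le.2 ?_ mem_span
  rintro _ ⟨_, ⟨N, ⟨hN, height_eq⟩, rfl⟩, rfl⟩
  change S.monomial χ N ∈ _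
  by_cases count_lt : ∀ γ, N.count (.root γ) < p
  · obtain ⟨b', rfl⟩ := exists_eq_rootMultisetOn hN count_lt
    refine Submodule.subset_span ⟨b', ?_, rfl⟩
    rw [Set.mem_ofPred_eq, posHeight, posHeight, height_eq]
    exact lt_add_of_pos_left _ (height_pos hα')
  · push Not at count_lt
    obtain ⟨γ, hγ⟩ := count_lt
    obtain ⟨δ, hδ, h⟩ := hN _ (Multiset.count_pos.1 ((Fact.out : p.Prime).pos.trans_le hγ))
    rw [monomial_eq_zero_of_le_count hχ (BasisIndex.root.inj h ▸ hδ) hγ]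
    exact zero_mem _

end ReductiveGroup

end RootSubsets

section HighestWeight

namespace ReductiveGroup

variable {K : Type u} [Field K] {p : ℕ} (S : ReductiveGroup K p) (χ : Module.Dual K S.g)
  {A : Type v} [CommRing A] [Algebra K A] (π : S.U0 →ₐ[K] A)
  {V : Type*} [AddCommGroup V] [Module (S.U χ ⊗[K] A) V]

/-- Highest weight vectors of weight `μ`: vectors of weight `μ` that are annihilated by the
positive root vectors. -/
structure IsHighestWeightVector (μ : S.X) (v : V) : Prop where
  isTorusVector : S.IsTorusVector χ π μ v
  e_smul_eq_zero (α : S.R) : S.IsPos α → (S.ofLie χ (S.e α) ⊗ₜ[K] (1 : A)) • v = 0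

variable {S χ π} {μ : S.X} {v : V}

theorem IsHighestWeightVector.monomial_smul_eq_zero (hv : S.IsHighestWeightVector χ π μ v)
    {M : Multiset S.BasisIndex} (hM : ∀ i ∈ M, i ∈ S.posIndices) (hM₀ : M ≠ 0) :
    (S.monomial χ M ⊗ₜ[K] (1 : A)) • v = 0 := by
  induction M using multiset_induction_on_min with
  | zero => exact absurd rfl hM₀
  | cons j N hj ih =>
    rw [Multiset.forall_mem_cons] at hM
    obtain ⟨⟨α, hα, rfl⟩, hN⟩ := hM
    rw [monomial, PBW.orderedMonomial_cons S.lieBasis hj, map_mul, mul_tmul_one_smul]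
    by_cases hN₀ : N = 0
    · rw [hN₀, PBW.orderedMonomial_zero, map_one, ← Algebra.TensorProduct.one_def, one_smul,
        lieBasis_root]
      exact hv.e_smul_eq_zero α hα
    · rw [← monomial, ih hN hN₀, smul_zero]

theorem IsHighestWeightVector.smul_mem_span [Fact p.Prime] [CharP K p] [Module A V]
    [IsScalarTower A (S.U χ ⊗[K] A) V] (hv : S.IsHighestWeightVector χ π μ v)
    (x : S.U χ ⊗[K] A) :
    x • v ∈ Submodule.span A
      (Set.range fun a : S.NegExp => (S.monomial χ (S.rootMultisetOn a) ⊗ₜ[K] (1 : A)) • v) := by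
  refine Submodule.span_le.2 ?_ (hv.isTorusVector.smul_mem_span x)
  rintro _ ⟨n, rfl⟩
  beta_reduce
  rw [rootMultiset_eq_add S.IsPos, monomial_neg_add_pos, mul_tmul_one_smul]
  by_cases pos_eq_zero : S.rootMultisetOn (P := S.IsPos) (fun α => n α.1) = 0
  · rw [pos_eq_zero, monomial_zero, ← Algebra.TensorProduct.one_def, one_smul]
    exact Submodule.subset_span ⟨_, rfl⟩
  · rw [hv.monomial_smul_eq_zero (fun i hi => exists_eq_root_of_mem_rootMultisetOn hi)
      pos_eq_zero, smul_zero]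
    exact zero_mem _

end ReductiveGroup

end HighestWeight

section BabyVerma

open ReductiveGroup

variable {K : Type u} [Field K] {p : ℕ} {S : ReductiveGroup K p} {χ : Module.Dual K S.g}
  {A : Type v} [CommRing A] [Algebra K A] {π : S.U0 →ₐ[K] A} {μ : S.X}

variable (χ π μ) in
/-- The generator `1 ⊗ 1` of the baby Verma module `Z_{A,χ}(μ)`. -/
def babyVermaGen : BabyVerma S χ π μ := (babyVermaRel S χ π μ).mkQ 1

theorem smul_babyVermaGen (x : S.U χ ⊗[K] A) :
    x • babyVermaGen χ π μ = (babyVermaRel S χ π μ).mkQ x := by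
  rw [babyVermaGen, ← map_smul, smul_eq_mul, mul_one]

theorem isHighestWeightVector_babyVermaGen :
    S.IsHighestWeightVector χ π μ (babyVermaGen χ π μ) where
  isTorusVector x := by
    rw [← sub_eq_zero, ← sub_smul, smul_babyVermaGen, Submodule.mkQ_apply,
      Submodule.Quotient.mk_eq_zero]
    exact Submodule.subset_span (Or.inr ⟨x, rfl⟩)
  e_smul_eq_zero α hα := by
    rw [smul_babyVermaGen, Submodule.mkQ_apply, Submodule.Quotient.mk_eq_zero]
    exact Submodule.subset_span (Or.inl ⟨α, hα, rfl⟩)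

theorem smul_monomial_smul_babyVermaGen_mem (I : Set S.R) (M : Multiset S.BasisIndex) (c : A) :
    c • (S.monomial χ M ⊗ₜ[K] (1 : A)) • babyVermaGen χ π μ ∈
      babyVermaWt S χ I π μ (QuotientAddGroup.mk (μ + S.monomialWeight M))
        (S.diff (μ + S.monomialWeight M)) := by
  rw [← tmul_smul, smul_babyVermaGen]
  refine AddSubgroup.subset_closure ⟨_, ?_, c, rfl⟩
  rw [QuotientAddGroup.mk_add, add_sub_cancel_left, diff_add, add_sub_cancel_left]
  exact monomial_mem_Uwt M

section Lift

variable {V : Type*} [AddCommGroup V] [Module (S.U χ ⊗[K] A) V] {v : V}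

theorem babyVermaRel_le_ker_toSpanSingleton (hv : S.IsHighestWeightVector χ π μ v) :
    babyVermaRel S χ π μ ≤ LinearMap.ker (LinearMap.toSpanSingleton (S.U χ ⊗[K] A) V v) := by
  refine Submodule.span_le.2 ?_
  rintro _ (⟨α, hα, rfl⟩ | ⟨x, rfl⟩)
  · exact hv.e_smul_eq_zero α hα
  · rw [SetLike.mem_coe, LinearMap.mem_ker, LinearMap.toSpanSingleton_apply, sub_smul, sub_eq_zero]
    exact hv.isTorusVector x

/-- The homomorphism from a baby Verma module that sends the generator to a given highest weight
vector. -/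
def babyVermaLift (hv : S.IsHighestWeightVector χ π μ v) :
    BabyVerma S χ π μ →ₗ[S.U χ ⊗[K] A] V :=
  (babyVermaRel S χ π μ).liftQ _ (babyVermaRel_le_ker_toSpanSingleton hv)

theorem babyVermaLift_gen (hv : S.IsHighestWeightVector χ π μ v) :
    babyVermaLift hv (babyVermaGen χ π μ) = v := by
  rw [babyVermaGen, Submodule.mkQ_apply, babyVermaLift, Submodule.liftQ_apply,
    LinearMap.toSpanSingleton_apply, one_smul]

theorem range_babyVermaLift (hv : S.IsHighestWeightVector χ π μ v) :
    LinearMap.range (babyVermaLift hv) = Submodule.span (S.U χ ⊗[K] A) {v} := by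
  rw [babyVermaLift, Submodule.range_liftQ, LinearMap.range_toSpanSingleton]

variable [Module A V] [IsScalarTower A (S.U χ ⊗[K] A) V] [Fact p.Prime] [CharP K p]

theorem babyVermaLift_injective (hv : S.IsHighestWeightVector χ π μ v)
    (hli : LinearIndependent A fun a : S.NegExp =>
      (S.monomial χ (S.rootMultisetOn a) ⊗ₜ[K] (1 : A)) • v) :
    Function.Injective (babyVermaLift hv) := by
  classical
  rw [injective_iff_map_eq_zero]
  intro z hz
  obtain ⟨x, rfl⟩ := (babyVermaRel S χ π μ).mkQ_surjective z
  obtain ⟨c, hc⟩ := (Submodule.mem_span_range_iff_exists_fun A).1 <|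
    isHighestWeightVector_babyVermaGen (π := π) (μ := μ).smul_mem_span x
  rw [← smul_babyVermaGen] at hz ⊢
  simp only [← hc, map_sum, LinearMap.map_smul_of_tower, map_smul, babyVermaLift_gen] at hz
  have hc₀ := Fintype.linearIndependent_iff.1 hli c hz
  rw [← hc]
  exact Finset.sum_eq_zero fun a _ => by rw [hc₀ a, zero_smul]

end Lift

end BabyVerma

/-! ### Construction of `Z`-filtrations -/

theorem exists_subquotient_equiv {R M P : Type*} [Ring R] [AddCommGroup M] [Module R M]
    [AddCommGroup P] [Module R P] {N N' : Submodule R M} {f : P →ₗ[R] M ⧸ N}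
    (hf : Function.Injective f) (hrange : LinearMap.range f = N'.map N.mkQ) :
    ∃ φ : (N' ⧸ N.submoduleOf N') ≃ₗ[R] P,
      ∀ y, f (φ (Submodule.Quotient.mk y)) = N.mkQ (y : M) := by
  let g : (N' ⧸ N.submoduleOf N') →ₗ[R] M ⧸ N := (N.submoduleOf N').mapQ N N'.subtype le_rfl
  have hg : Function.Injective g := by
    rw [← LinearMap.ker_eq_bot, show g.ker = _ from Submodule.ker_mapQ ..,
      Submodule.submoduleOf, Submodule.mkQ_map_self]
  have range_eq : LinearMap.range g = LinearMap.range f := by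
    rw [hrange, show g.range = _ from Submodule.range_mapQ .., Submodule.range_subtype]
  refine ⟨LinearEquiv.ofInjective g hg ≪≫ₗ LinearEquiv.ofEq _ _ range_eq ≪≫ₗ
    (LinearEquiv.ofInjective f hf).symm, fun y => ?_⟩
  exact congrArg Subtype.val ((LinearEquiv.ofInjective f hf).apply_symm_apply _)

namespace CA

open ReductiveGroup

variable {K : Type u} [Field K] {p : ℕ} {S : ReductiveGroup K p} {χ : Module.Dual K S.g}
  {I : Set S.R} {A : Type v} [CommRing A] [Algebra K A] {π : S.U0 →ₐ[K] A}

/-- The data that give a `Z`-filtration of an object of `𝒞_A`: vectors `vᵢ` of weights `μᵢ`, sent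
by the positive root vectors to the span of the preceding ones, whose products with the restricted
monomials in the negative root vectors form a basis over `A` compatible with the grading. -/
structure ZBasis (Q : CA S χ I π) [Module A Q.carrier] (r : ℕ) where
  v : Fin r → Q.carrier
  μ : Fin r → S.X
  basis : Module.Basis (Fin r × S.NegExp) A Q.carrier
  basis_apply (i : Fin r) (a : S.NegExp) :
    basis (i, a) = (S.monomial χ (S.rootMultisetOn a) ⊗ₜ[K] (1 : A)) • v i
  e_smul_mem (i : Fin r) (α : S.R) : S.IsPos α →
    (S.ofLie χ (S.e α) ⊗ₜ[K] (1 : A)) • v i ∈ Submodule.span A (v '' Set.Iio i)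
  mem_wt_iff (ξ : S.XI I) (w : Module.Dual K S.h) (y : Q.carrier) : y ∈ Q.wt ξ w ↔
    y ∈ basisWt I basis (fun x => μ x.1 + S.monomialWeight (S.rootMultisetOn x.2)) ξ w

namespace ZBasis

variable {Q : CA S χ I π} [Module A Q.carrier] {r : ℕ} (Z : ZBasis Q r)

/-- The weights of the basis vectors. -/
def weight (x : Fin r × S.NegExp) : S.X := Z.μ x.1 + S.monomialWeight (S.rootMultisetOn x.2)

/-- The submodule generated by the first `i` of the vectors of a `ZBasis`. -/
def fil (i : ℕ) : Submodule (S.U χ ⊗[K] A) Q.carrier :=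
  Submodule.span _ (Z.v '' {l | (l : ℕ) < i})

theorem fil_mono : Monotone Z.fil := fun _ _ h =>
  Submodule.span_mono (Set.image_mono fun _ hl => lt_of_lt_of_le hl h)

theorem v_mem_fil_succ (i : Fin r) : Z.v i ∈ Z.fil (i + 1) :=
  Submodule.subset_span ⟨i, Nat.lt_succ_self _, rfl⟩

theorem fil_succ (i : Fin r) :
    Z.fil (i + 1) = Submodule.span (S.U χ ⊗[K] A) {Z.v i} ⊔ Z.fil i := by
  rw [fil, fil, ← Submodule.span_union, ← Set.image_singleton, ← Set.image_union]
  congr 2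
  ext l
  simp only [Set.mem_ofPred_eq, Set.mem_union, Set.mem_singleton_iff, Fin.ext_iff]
  omega

theorem map_fil_succ (i : Fin r) : (Z.fil (i + 1)).map (Z.fil i).mkQ =
    Submodule.span (S.U χ ⊗[K] A) {(Z.fil i).mkQ (Z.v i)} := by
  rw [fil_succ, Submodule.map_sup, Submodule.mkQ_map_self, sup_bot_eq, Submodule.map_span,
    Set.image_singleton]

variable [Fact p.Prime]

theorem v_mem_wt (i : Fin r) : Z.v i ∈ Q.wt (QuotientAddGroup.mk (Z.μ i)) (S.diff (Z.μ i)) := by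
  rw [Z.mem_wt_iff]
  refine Submodule.subset_span ⟨(i, 0), ?_, ?_⟩
  · change S.degree I (Z.μ i + S.monomialWeight (S.rootMultisetOn 0)) = _
    rw [rootMultisetOn_zero, monomialWeight_zero, add_zero, degree_apply]
  · rw [Z.basis_apply, rootMultisetOn_zero, monomial_zero, ← Algebra.TensorProduct.one_def,
      one_smul]

variable [IsScalarTower A (S.U χ ⊗[K] A) Q.carrier]

theorem isHighestWeightVector_mkQ_v (i : Fin r) :
    S.IsHighestWeightVector χ π (Z.μ i) ((Z.fil i).mkQ (Z.v i)) where
  isTorusVector x := by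
    rw [← map_smul, isTorusVector_of_mem_wt (Z.v_mem_wt i) x, map_smul]
  e_smul_eq_zero α hα := by
    rw [← map_smul, Submodule.mkQ_apply, Submodule.Quotient.mk_eq_zero]
    exact Submodule.span_le_restrictScalars A (S.U χ ⊗[K] A) _ (Z.e_smul_mem i α hα)

variable [CharP K p]

theorem smul_v_mem_sup (i : Fin r) (x : S.U χ ⊗[K] A) :
    x • Z.v i ∈ Submodule.span A (Set.range fun a => Z.basis (i, a)) ⊔
      (Z.fil i).restrictScalars A := by
  have h := (Z.isHighestWeightVector_mkQ_v i).smul_mem_span x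
  simp only [← map_smul, ← Z.basis_apply] at h
  rw [← LinearMap.coe_restrictScalars A, Set.range_comp', ← Submodule.map_span,
    ← Submodule.mem_comap, Submodule.comap_map_eq, LinearMap.ker_restrictScalars,
    Submodule.ker_mkQ] at h
  exact h

theorem restrictScalars_fil {i : ℕ} (hi : i ≤ r) :
    (Z.fil i).restrictScalars A = Submodule.span A (Z.basis '' {x | (x.1 : ℕ) < i}) := by
  refine le_antisymm ?_ <| Submodule.span_le.2 ?_
  · induction i with
    | zero => simp [fil]
    | succ i ih =>
      have fil_le : (Z.fil i).restrictScalars A ≤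
          Submodule.span A (Z.basis '' {x | (x.1 : ℕ) < i + 1}) :=
        (ih (Nat.le_of_succ_le hi)).trans <|
          Submodule.span_mono (Set.image_mono fun _ hl => Nat.lt_succ_of_lt hl)
      have row_le : Submodule.span A (Set.range fun a => Z.basis (⟨i, hi⟩, a)) ≤
          Submodule.span A (Z.basis '' {x | (x.1 : ℕ) < i + 1}) :=
        Submodule.span_mono <| Set.range_subset_iff.2 fun a => ⟨_, Nat.lt_succ_self i, rfl⟩
      intro y hy
      rw [Submodule.restrictScalars_mem, Z.fil_succ ⟨i, hi⟩, Submodule.mem_sup] at hy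
      obtain ⟨_, hx, y, hy, rfl⟩ := hy
      obtain ⟨x, rfl⟩ := Submodule.mem_span_singleton.1 hx
      exact add_mem (sup_le row_le fil_le (Z.smul_v_mem_sup ⟨i, hi⟩ x)) (fil_le hy)
  · rintro _ ⟨⟨l, a⟩, hl, rfl⟩
    rw [Z.basis_apply]
    exact Submodule.smul_mem (Z.fil i) _ (Submodule.subset_span ⟨l, hl, rfl⟩)

theorem fil_inf_wt {i : ℕ} (hi : i ≤ r) (ξ : S.XI I) (w : Module.Dual K S.h) :
    (Z.fil i).toAddSubgroup ⊓ Q.wt ξ w = (Submodule.span A (Z.basis ''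
      {x | (x.1 : ℕ) < i ∧ S.degree I (Z.weight x) = (ξ, w)})).toAddSubgroup := by
  ext y
  rw [AddSubgroup.mem_inf, Submodule.mem_toAddSubgroup, Submodule.mem_toAddSubgroup,
    ← Submodule.restrictScalars_mem A, Z.restrictScalars_fil hi, Z.mem_wt_iff, basisWt,
    Module.Basis.mem_span_image, Module.Basis.mem_span_image, Module.Basis.mem_span_image,
    ← Set.subset_inter_iff]
  rfl

theorem fil_eq_iSup {i : ℕ} (hi : i ≤ r) :
    (Z.fil i).toAddSubgroup = ⨆ ξ, ⨆ w, (Z.fil i).toAddSubgroup ⊓ Q.wt ξ w := by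
  refine le_antisymm (fun y hy => ?_) (iSup₂_le fun _ _ => inf_le_left)
  rw [Submodule.mem_toAddSubgroup, ← Submodule.restrictScalars_mem A,
    Z.restrictScalars_fil hi] at hy
  induction hy using Submodule.closure_induction with
  | zero => exact zero_mem _
  | add y y' _ _ hy hy' => exact add_mem hy hy'
  | smul_mem c y hy =>
    obtain ⟨x, hx, rfl⟩ := hy
    refine AddSubgroup.mem_iSup_of_mem (QuotientAddGroup.mk (Z.weight x)) <|
      AddSubgroup.mem_iSup_of_mem (S.diff (Z.weight x)) ?_
    rw [Z.fil_inf_wt hi]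
    exact Submodule.smul_mem _ c (Submodule.subset_span ⟨x, ⟨hx, rfl⟩, rfl⟩)

theorem linearIndependent_monomial_smul_mkQ_v (i : Fin r) :
    LinearIndependent A fun a : S.NegExp =>
      (S.monomial χ (S.rootMultisetOn a) ⊗ₜ[K] (1 : A)) • (Z.fil i).mkQ (Z.v i) := by
  have row_independent : LinearIndependent A fun a => Z.basis (i, a) :=
    Z.basis.linearIndependent.comp _ (Prod.mk_right_injective i)
  simp only [← map_smul, ← Z.basis_apply]
  refine row_independent.map (f := (Z.fil i).mkQ.restrictScalars A) ?_
  rw [LinearMap.ker_restrictScalars, Submodule.ker_mkQ, Z.restrictScalars_fil i.2.le,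
    Set.range_comp' Z.basis]
  refine Z.basis.linearIndependent.disjoint_span_image (Set.disjoint_left.2 ?_)
  rintro _ ⟨a, rfl⟩ h
  exact lt_irrefl (i : ℕ) h

theorem map_babyVermaWt (i : Fin r) (ξ : S.XI I) (w : Module.Dual K S.h) :
    (babyVermaWt S χ I π (Z.μ i) ξ w).map
        (babyVermaLift (Z.isHighestWeightVector_mkQ_v i)).toAddMonoidHom =
      ((Z.fil (i + 1)).toAddSubgroup ⊓ Q.wt ξ w).map (Z.fil i).mkQ.toAddMonoidHom := by
  refine le_antisymm ?_ ?_
  · rw [babyVermaWt, AddMonoidHom.map_closure, AddSubgroup.closure_le]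
    rintro _ ⟨_, ⟨u, hu, a, rfl⟩, rfl⟩
    have mem_wt := Uwt_smul_mem_wt hu (Z.v_mem_wt i)
    rw [sub_add_cancel, sub_add_cancel] at mem_wt
    refine ⟨(u ⊗ₜ[K] a) • Z.v i, ⟨Submodule.smul_mem _ _ (Z.v_mem_fil_succ i), ?_⟩, ?_⟩
    · rw [tmul_smul, ← one_tmul_smul (K := K) (U := S.U χ)]
      exact Q.wt_smul _ _ a _ mem_wt
    · rw [← smul_babyVermaGen]
      simp only [LinearMap.toAddMonoidHom_coe, map_smul, babyVermaLift_gen]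
  · rw [Z.fil_inf_wt i.2, AddSubgroup.map_le_iff_le_comap]
    intro y hy
    induction hy using Submodule.closure_induction with
    | zero => exact zero_mem _
    | add y y' _ _ hy hy' => exact add_mem hy hy'
    | smul_mem c y hy =>
      obtain ⟨⟨l, a⟩, ⟨hl, hdeg⟩, rfl⟩ := hy
      rw [AddSubgroup.mem_comap, Z.basis_apply]
      obtain hl | hl := Nat.lt_succ_iff_lt_or_eq.1 hl
      · have mem_fil : Z.v l ∈ Z.fil i := Submodule.subset_span ⟨l, hl, rfl⟩
        have mkQ_eq_zero : (Z.fil i).mkQ (Z.v l) = 0 := (Submodule.Quotient.mk_eq_zero _).2 mem_fil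
        simp only [LinearMap.toAddMonoidHom_coe, LinearMap.map_smul_of_tower, map_smul, mkQ_eq_zero,
          smul_zero]
        exact zero_mem _
      · obtain rfl := Fin.ext hl
        obtain ⟨rfl, rfl⟩ := Prod.mk.inj hdeg
        refine ⟨_, smul_monomial_smul_babyVermaGen_mem I (S.rootMultisetOn a) c, ?_⟩
        simp only [LinearMap.toAddMonoidHom_coe, LinearMap.map_smul_of_tower, map_smul,
          babyVermaLift_gen]

theorem exists_subquotient_equiv_babyVerma (i : Fin r) :
    ∃ φ : (Z.fil (i + 1) ⧸ (Z.fil i).submoduleOf (Z.fil (i + 1))) ≃ₗ[S.U χ ⊗[K] A]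
        BabyVerma S χ π (Z.μ i),
      ∀ ξ w (z : BabyVerma S χ π (Z.μ i)), z ∈ babyVermaWt S χ I π (Z.μ i) ξ w ↔
        ∃ y : Z.fil (i + 1), (y : Q.carrier) ∈ Q.wt ξ w ∧ φ (Submodule.Quotient.mk y) = z := by
  have hv := Z.isHighestWeightVector_mkQ_v i
  have lift_injective := babyVermaLift_injective hv (Z.linearIndependent_monomial_smul_mkQ_v i)
  obtain ⟨φ, hφ⟩ := exists_subquotient_equiv lift_injective
    ((range_babyVermaLift hv).trans (Z.map_fil_succ i).symm)
  refine ⟨φ, fun ξ w z => ?_⟩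
  rw [← AddSubgroup.mem_map_iff_mem (f := (babyVermaLift hv).toAddMonoidHom) lift_injective,
    Z.map_babyVermaWt]
  constructor
  · rintro ⟨y, ⟨hyF, hyw⟩, hyz⟩
    exact ⟨⟨y, hyF⟩, hyw, lift_injective ((hφ _).trans hyz)⟩
  · rintro ⟨y, hyw, rfl⟩
    exact ⟨y, ⟨y.2, hyw⟩, (hφ y).symm⟩

theorem hasZFiltration (Z : ZBasis Q r) : Q.HasZFiltration := by
  refine ⟨r, fun i => Z.fil i, fun i j h => Z.fil_mono h, by simp [fil], ?_,
    fun i => Z.fil_eq_iSup (Nat.lt_succ_iff.1 i.2),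
    fun i => ⟨Z.μ i, Z.exists_subquotient_equiv_babyVerma i⟩⟩
  have lt_r : {x : Fin r × S.NegExp | (x.1 : ℕ) < r} = Set.univ :=
    Set.eq_univ_of_forall fun x => x.1.2
  change Z.fil r = ⊤
  rw [← Submodule.restrictScalars_eq_top_iff A, Z.restrictScalars_fil le_rfl, lt_r,
    Set.image_univ, Z.basis.span_eq]

end ZBasis

end CA

namespace CA

open ReductiveGroup

/-! ### The `Z`-filtration of `⨁ⱼ U_χ ⊗_{U⁰} A^{λⱼ}` -/

theorem exists_equiv_antitone {T : Type*} [Finite T] (f : T → ℤ) :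
    ∃ (r : ℕ) (o : Fin r ≃ T), Antitone (f ∘ o) := by
  obtain ⟨r, ⟨e⟩⟩ := Finite.exists_equiv_fin T
  refine ⟨r, (Tuple.sort fun i => -f (e.symm i)).trans e.symm, fun i j h => ?_⟩
  exact neg_le_neg_iff.1 (Tuple.monotone_sort (fun i => -f (e.symm i)) h)

variable {K : Type u} [Field K] {p : ℕ} {S : ReductiveGroup K p} {χ : Module.Dual K S.g}
  {I : Set S.R} {A : Type v} [CommRing A]

theorem basisWt_reindex {J J' : Type*} {V : Type (max u v)} [AddCommGroup V] [Module A V]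
    (b : Module.Basis J A V) (e : J ≃ J') (ω : J' → S.X) (ξ : S.XI I) (w : Module.Dual K S.h) :
    basisWt I (b.reindex e) ω ξ w = basisWt I b (ω ∘ e) ξ w := by
  rw [basisWt, basisWt, b.coe_reindex, Set.image_comp, Equiv.image_symm_eq_preimage]
  rfl

variable [Algebra K A] {π : S.U0 →ₐ[K] A} {k : ℕ} {lam : Fin k → S.X}

variable (χ π lam) in
/-- The products of the restricted monomials in the positive root vectors with the generators of
`⨁ⱼ U_χ ⊗_{U⁰} A^{λⱼ}`. -/
def posVec (t : Fin k × S.PosExp) : FreeModule χ π lam :=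
  (S.monomial χ (S.rootMultisetOn t.2) ⊗ₜ[K] (1 : A)) • freeGen π lam t.1

variable (lam) in
/-- The weights of the vectors `posVec`. -/
def posWeight (t : Fin k × S.PosExp) : S.X := lam t.1 + S.monomialWeight (S.rootMultisetOn t.2)

open Classical in
variable (S k) in
/-- The splitting of the exponents of a monomial into those of the positive root vectors and those
of the negative ones. -/
def splitExp : (Σ _ : Fin k, S.R → Fin p) ≃ (Fin k × S.PosExp) × S.NegExp :=
  (Equiv.sigmaEquivProd _ _).trans <|
    ((Equiv.refl _).prodCongr (Equiv.piEquivPiSubtypeProd S.IsPos fun _ => Fin p)).trans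
      (Equiv.prodAssoc _ _ _).symm

theorem freeWeight_eq_posWeight_add (x : Σ _ : Fin k, S.R → Fin p) :
    freeWeight lam x = posWeight lam (splitExp S k x).1 +
      S.monomialWeight (S.rootMultisetOn (splitExp S k x).2) := by
  rw [freeWeight, rootMultiset_eq_add S.IsPos, monomialWeight_add, add_comm (S.monomialWeight _),
    ← add_assoc]
  rfl

variable [Fact p.Prime] [CharP K p]

theorem freeBasis_eq_monomial_smul_posVec (x : Σ _ : Fin k, S.R → Fin p) :
    freeBasis χ π lam x = (S.monomial χ (S.rootMultisetOn (splitExp S k x).2) ⊗ₜ[K] (1 : A)) •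
      posVec χ π lam (splitExp S k x).1 := by
  rw [freeBasis_apply, rootMultiset_eq_add S.IsPos, monomial_neg_add_pos]
  exact mul_tmul_one_smul (K := K) (A := A) (V := FreeModule χ π lam)
    (S.monomial χ _) (S.monomial χ _) (freeGen π lam x.1)

theorem e_smul_posVec_mem_span (hχ : S.IsStandardLeviForm χ I) {α : S.R} (hα : S.IsPos α)
    (t : Fin k × S.PosExp) :
    (S.ofLie χ (S.e α) ⊗ₜ[K] (1 : A)) • posVec χ π lam t ∈ Submodule.span A
      (posVec χ π lam '' {t' | S.posHeight t.2 < S.posHeight t'.2}) := by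
  have h := mul_tmul_one_smul (K := K) (A := A) (V := FreeModule χ π lam)
    (S.ofLie χ (S.e α)) (S.monomial χ (S.rootMultisetOn t.2)) (freeGen π lam t.1)
  rw [posVec, ← h]
  refine Submodule.span_mono ?_
    (tmul_smul_mem_span (e_mul_monomial_pos_mem_span hχ hα t.2) (1 : A) (freeGen π lam t.1))
  rintro _ ⟨_, ⟨b, hb, rfl⟩, rfl⟩
  exact ⟨(t.1, b), hb, rfl⟩

section Enumeration

variable {r : ℕ} (o : Fin r ≃ Fin k × S.PosExp)

variable (χ π lam) in
/-- The basis of `⨁ⱼ U_χ ⊗_{U⁰} A^{λⱼ}` formed by the products of the restricted monomials in the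
negative root vectors with the vectors `posVec`, for an enumeration `o` of the latter. -/
def splitBasis : Module.Basis (Fin r × S.NegExp) A (FreeModule χ π lam) :=
  (freeBasis χ π lam).reindex ((splitExp S k).trans (o.symm.prodCongr (Equiv.refl S.NegExp)))

theorem splitBasis_apply (i : Fin r) (a : S.NegExp) : splitBasis χ π lam o (i, a) =
    (S.monomial χ (S.rootMultisetOn a) ⊗ₜ[K] (1 : A)) • posVec χ π lam (o i) := by
  have split_symm : splitExp S k (((splitExp S k).trans
      (o.symm.prodCongr (Equiv.refl S.NegExp))).symm (i, a)) = (o i, a) :=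
    Equiv.apply_symm_apply _ _
  rw [splitBasis, Module.Basis.reindex_apply, freeBasis_eq_monomial_smul_posVec, split_symm]

theorem basisWt_splitBasis (ξ : S.XI I) (w : Module.Dual K S.h) :
    basisWt I (splitBasis χ π lam o)
      (fun x => posWeight lam (o x.1) + S.monomialWeight (S.rootMultisetOn x.2)) ξ w =
        basisWt I (freeBasis χ π lam) (freeWeight lam) ξ w := by
  rw [splitBasis, basisWt_reindex]
  congr 1
  refine funext fun x => ?_
  rw [freeWeight_eq_posWeight_add]
  exact congrArg (posWeight lam · + _) (o.apply_symm_apply (splitExp S k x).1)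

theorem e_smul_posVec_mem_span_Iio (hχ : S.IsStandardLeviForm χ I)
    (ho : Antitone fun i => S.posHeight (o i).2) {α : S.R} (hα : S.IsPos α) (i : Fin r) :
    (S.ofLie χ (S.e α) ⊗ₜ[K] (1 : A)) • posVec χ π lam (o i) ∈
      Submodule.span A ((fun i => posVec χ π lam (o i)) '' Set.Iio i) := by
  refine Submodule.span_mono ?_ (e_smul_posVec_mem_span hχ hα (o i))
  rintro _ ⟨t, ht, rfl⟩
  obtain ⟨l, rfl⟩ := o.surjective t
  exact ⟨l, ho.reflect_lt ht, rfl⟩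

end Enumeration

theorem hasZFiltration_free (hχ : S.IsStandardLeviForm χ I) :
    (free π lam hχ).HasZFiltration := by
  obtain ⟨r, o, ho⟩ := exists_equiv_antitone fun t : Fin k × S.PosExp => S.posHeight t.2
  let _ : Module A (free π lam hχ).carrier := inferInstanceAs (Module A (FreeModule χ π lam))
  have _ : IsScalarTower A (S.U χ ⊗[K] A) (free π lam hχ).carrier :=
    inferInstanceAs (IsScalarTower A (S.U χ ⊗[K] A) (FreeModule χ π lam))
  let Z : ZBasis (free π lam hχ) r :=
    { v := fun i => posVec χ π lam (o i)
      μ := fun i => posWeight lam (o i)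
      basis := splitBasis χ π lam o
      basis_apply := splitBasis_apply o
      e_smul_mem := fun i _ hα => e_smul_posVec_mem_span_Iio o hχ ho hα i
      mem_wt_iff := fun ξ w y =>
        (SetLike.ext_iff.1 (basisWt_splitBasis (χ := χ) (π := π) (lam := lam) o ξ w) y).symm }
  exact Z.hasZFiltration

end CA

end GradedLevi

end

theorem mainTheorem7_general {K : Type u} [Field K] {p : ℕ} [Fact p.Prime] [CharP K p]
    (S : GradedLevi.ReductiveGroup K p) (χ : Module.Dual K S.g) (I : Set S.R)
    (hχ : S.IsStandardLeviForm χ I)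
    {A : Type v} [CommRing A] [Algebra K A] (π : S.U0 →ₐ[K] A)
    (M : GradedLevi.CA S χ I π) :
    ∃ (Q : GradedLevi.CA S χ I π) (f : Q ⟶ M),
      CategoryTheory.Projective Q ∧ Function.Surjective (GradedLevi.CA.linearMap f) ∧
        Q.HasZFiltration := by
  obtain ⟨k, lam, m, hm, span_eq_top⟩ := M.exists_generating_weight_vectors
  refine ⟨GradedLevi.CA.free π lam hχ, GradedLevi.CA.freeLift hχ m hm,
    GradedLevi.CA.projective_free hχ, ?_, GradedLevi.CA.hasZFiltration_free hχ⟩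
  rw [← LinearMap.range_eq_top, eq_top_iff, ← span_eq_top, Submodule.span_le]
  rintro _ ⟨j, rfl⟩
  exact ⟨_, GradedLevi.CA.freeLift_freeGen hχ m hm j⟩

theorem mainTheorem7 {K : Type u} [Field K] [IsAlgClosed K] {p : ℕ} [Fact p.Prime] [CharP K p]
    (S : GradedLevi.ReductiveGroup K p) (χ : Module.Dual K S.g) (I : Set S.R)
    (hχ : S.IsStandardLeviForm χ I)
    {A : Type v} [CommRing A] [IsNoetherianRing A] [Algebra K A] (π : S.U0 →ₐ[K] A)
    (M : GradedLevi.CA S χ I π) :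
    ∃ (Q : GradedLevi.CA S χ I π) (f : Q ⟶ M),
      CategoryTheory.Projective Q ∧ Function.Surjective (GradedLevi.CA.linearMap f) ∧
        Q.HasZFiltration :=
  mainTheorem7_general S χ I hχ π M
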